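/- **Setting.** Let $K$ be a connected two-dimensional CW complex and $K_1,K_2,K_3\subseteq K$ subcomplexes with $K=K_1\cup K_2\cup K_3$ and $K_1\cap K_2\cap K_3=K^1$, the 1-skeleton. Collapsing a maximal tree of $K^1$, we assume that $K$ has exactly one 0-cell, which is the base point. Put $F=\pi_1(K^1)$, the free group on the 1-cells; let $r_e\in F$ be the class of the attaching map of the 2-cell $e$; put $R_i=\ker(\pi_1(K^1)\to\pi_1(K_i))$ (the normal closure of the $r_e$ with $e$ in $K_i$) and $G=F/R_1R_2R_3=\pi_1(K)$. Write $[x,y]=x^{-1}y^{-1}xy$, $x^y=y^{-1}xy$, and $$I_3=I_3(F;R_1,R_2,R_3)=\frac{R_1\cap R_2\cap R_3}{[R_1,R_2\cap R_3]\,[R_2,R_3\cap R_1]\,[R_3,R_1\cap R_2]},$$ an abelian group on which $G$ acts by conjugation in $F$; its coinvariants are denoted $I_3(F;R_1,R_2,R_3)_F$. The group $\pi_2(K,K^1)$ is the free crossed $F$-module on the 2-cells, generated by symbols $e^{(w)}$ ($e$ a 2-cell, $w\in F$) with $\partial e^{(w)}=w\,r_e\,w^{-1}$, subject to the Peiffer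 relations $xyx^{-1}={}^{\partial x}y$; and $\pi_2(K)=\ker(\partial:\pi_2(K,K^1)\to F)$. Thus each element of $\pi_2(K)$ is represented by an identity sequence $c=(c_1,\dots,c_m)$, a finite sequence of symbols $(e^{(w)})^{\pm1}$ whose values in $F$ have product $1$. **The map $\Lambda$.** Choose for every 2-cell an index $i\in\{1,2,3\}$ with the cell in $K_i$; this divides the terms of an identity sequence $c$ into terms from $K_1$, at places $r_1<\dots<r_l$, terms from $K_2$, at places $s_1<\dots<s_k$, and terms from $K_3$. With the values of the terms in $F$ put $$r_c=c_{r_1}\cdots c_{r_l}\in R_1,\qquad s_c=\prod_{i=1}^{k}c_{s_i}^{\,\prod_{r_j>s_i}c_{r_j}}\in R_2,$$ the products being taken in increasing order of indices. Then $[r_c,s_c]\in R_1\cap R_2\cap R_3$, and $\Lambda:\pi_2(K)\to I_3$ sends the element represented by $c$ to the class of $[r_c,s_c]$; this class does not depend on the choice of $c$. The map $\Lambda$ is quadratic, and for Whitehead's universal quadratic functor $\Gamma$ it induces a homomorphism of $G$-modules $\bar\Lambda:\pi_3(K)=\Gamma(\pi_2(K))\to I_3$ with $\bar\Lambda\circ\gamma=\Lambda$.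 **The map $\Psi_4$.** Let $\tilde K$ be the universal cover of $K$. The exact complex of $G$-modules $$0\to\pi_2(K)\to C_2(\tilde K)\to C_1(\tilde K)\to\mathbb Z[G]\to\mathbb Z\to0$$ gives by dimension shifting (three connecting homomorphisms) a map $H_4(G)\to H_1(G,\pi_2(K))$. For an abelian group $A$ let $SP^2(A)=A\otimes A/\langle a\otimes b-b\otimes a\rangle$ and $P_2(A)=\Delta(A)/\Delta^3(A)$, where $\Delta(A)$ is the augmentation ideal of $\mathbb Z[A]$. The short exact sequence $0\to SP^2(\pi_2(K))\to P_2(\pi_2(K))\to\pi_2(K)\to0$ gives a connecting map $H_1(G,\pi_2(K))\to H_0(G,SP^2(\pi_2(K)))$. Composing with the map induced by $SP^2\to\Gamma$, $a\cdot b\mapsto\gamma(a+b)-\gamma(a)-\gamma(b)$, and with the map induced by $\bar\Lambda$, one obtains $$\Psi_4:H_4(G)\to H_1(G,\pi_2(K))\to H_0(G,SP^2(\pi_2(K)))\to H_0(G,\Gamma(\pi_2(K)))\to I_3(F;R_1,R_2,R_3)_F .$$ **Statement.** For every such $K,K_1,K_2,K_3$ and every choice of the indices of the 2-cells: 1. If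 $b\in i_{12}\pi_2(K_1\cup K_2)+i_{13}\pi_2(K_1\cup K_3)+i_{23}\pi_2(K_2\cup K_3)\subseteq\pi_2(K)$, where $i_{pq}$ is induced by the inclusion $K_p\cup K_q\to K$, then $\Lambda(a+b)=\Lambda(a)$ for every $a\in\pi_2(K)$. 2. The composite $$H_4(F/R_1R_2)\oplus H_4(F/R_2R_3)\oplus H_4(F/R_1R_3)\longrightarrow H_4(G)\xrightarrow{\ \Psi_4\ }I_3(F;R_1,R_2,R_3)_F,$$ whose first map is induced by the projections $F/R_pR_q\to G$, is zero. (Homology without indicated coefficients has coefficients in $\mathbb Z$.) -/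

import Mathlib

noncomputable section

namespace TwoComplex


section Crossed

variable {A F : Type} [Group F]

/-- The Peiffer relations `e_a^v e_b^w (e_a^v)⁻¹ (e_b^u)⁻¹`, `u = v r_a v⁻¹ w`. -/
def peifferRels (r : A → F) : Set (FreeGroup (A × F)) :=
  {x | ∃ (a b : A) (v w : F), x = FreeGroup.of (a, v) * FreeGroup.of (b, w) *
    (FreeGroup.of (a, v))⁻¹ * (FreeGroup.of (b, v * r a * v⁻¹ * w))⁻¹}

/-- The relative homotopy group `π₂(K, K¹)` as the total group of the free crossed module on
the attaching elements `r : A → F = π₁(K¹)`: the generator `(a, w)` is `e_a^w`. -/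
abbrev RelPi2 (r : A → F) : Type := PresentedGroup (peifferRels r)

/-- On the free group on the symbols `e_a^w`: `e_a^w ↦ w r_a w⁻¹`. -/
def preBd (r : A → F) : FreeGroup (A × F) →* F :=
  FreeGroup.lift fun p => p.2 * r p.1 * p.2⁻¹

lemma preBd_rels (r : A → F) : ∀ x ∈ peifferRels r, preBd r x = 1 := by
  rintro x ⟨a, b, v, w, rfl⟩
  simp only [preBd, map_mul, map_inv, FreeGroup.lift_apply_of]
  group

/-- The boundary `∂ : π₂(K, K¹) → π₁(K¹)`, `e_a^w ↦ w r_a w⁻¹`. -/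
def bd (r : A → F) : RelPi2 r →* F :=
  PresentedGroup.toGroup (f := fun p : A × F => p.2 * r p.1 * p.2⁻¹) (preBd_rels r)

@[simp] lemma bd_of (r : A → F) (a : A) (w : F) :
    bd r (PresentedGroup.of (a, w)) = w * r a * w⁻¹ :=
  PresentedGroup.toGroup.of (preBd_rels r)

lemma bd_mk (r : A → F) (x : FreeGroup (A × F)) :
    bd r (PresentedGroup.mk _ x) = preBd r x := rfl

/-- The action of `g` on the free group on the symbols `e_a^w`: `e_a^w ↦ e_a^{gw}`. -/
def preAct (A : Type) {F : Type} [Group F] (g : F) : FreeGroup (A × F) →* FreeGroup (A × F) :=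
  FreeGroup.map fun p => (p.1, g * p.2)

lemma actOne_rels (r : A → F) (g : F) : ∀ x ∈ peifferRels r,
    FreeGroup.lift (fun p : A × F => (PresentedGroup.of (p.1, g * p.2) : RelPi2 r)) x = 1 := by
  rintro x ⟨a, b, v, w, rfl⟩
  have : (PresentedGroup.mk (peifferRels r)) (FreeGroup.of (a, g * v) * FreeGroup.of (b, g * w) *
    (FreeGroup.of (a, g * v))⁻¹ * (FreeGroup.of (b, g * v * r a * (g * v)⁻¹ * (g * w)))⁻¹) = 1 := by
    apply (QuotientGroup.eq_one_iff _).2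
    exact Subgroup.subset_normalClosure ⟨a, b, g * v, g * w, rfl⟩
  simp only [map_mul, map_inv, FreeGroup.lift_apply_of]
  have e : g * (v * r a * v⁻¹ * w) = g * v * r a * (g * v)⁻¹ * (g * w) := by group
  rw [e]
  simpa [PresentedGroup.of] using this

/-- The action of a single `g ∈ F` on `π₂(K, K¹)`, `e_a^w ↦ e_a^{gw}`. -/
def actOne (r : A → F) (g : F) : RelPi2 r →* RelPi2 r :=
  PresentedGroup.toGroup (f := fun p => (PresentedGroup.of (p.1, g * p.2) : RelPi2 r))
    (actOne_rels r g)

@[simp] lemma actOne_of (r : A → F) (g : F) (a : A) (w : F) :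
    actOne r g (PresentedGroup.of (a, w)) = PresentedGroup.of (a, g * w) := by
  simp [actOne]

lemma actOne_mk (r : A → F) (g : F) (x : FreeGroup (A × F)) :
    actOne r g (PresentedGroup.mk _ x) = PresentedGroup.mk _ (preAct A g x) := by
  have : (actOne r g).comp (PresentedGroup.mk _) = (PresentedGroup.mk _).comp (preAct A g) := by
    ext p
    obtain ⟨a, w⟩ := p
    exact (actOne_of r g a w).trans (by simp [preAct]; rfl)
  exact DFunLike.congr_fun this x

lemma actOne_one (r : A → F) (c : RelPi2 r) : actOne r 1 c = c := by
  have : actOne r 1 = MonoidHom.id _ := by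
    apply PresentedGroup.ext; rintro ⟨a, w⟩; simp
  exact DFunLike.congr_fun this c

lemma actOne_mul (r : A → F) (g h : F) (c : RelPi2 r) :
    actOne r (g * h) c = actOne r g (actOne r h c) := by
  have : actOne r (g * h) = (actOne r g).comp (actOne r h) := by
    apply PresentedGroup.ext; rintro ⟨a, w⟩; simp [mul_assoc]
  exact DFunLike.congr_fun this c

lemma bd_act (r : A → F) (g : F) (c : RelPi2 r) : bd r (actOne r g c) = g * bd r c * g⁻¹ := by
  have : (bd r).comp (actOne r g) = (MulAut.conj g).toMonoidHom.comp (bd r) := by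
    apply PresentedGroup.ext; rintro ⟨a, w⟩
    simp [mul_assoc]
  exact DFunLike.congr_fun this c

/-- The Peiffer identity. -/
lemma conj_eq_act (r : A → F) (c d : RelPi2 r) : c * d * c⁻¹ = actOne r (bd r c) d := by
  induction c using PresentedGroup.induction_on generalizing d with
  | _ x =>
    induction x using FreeGroup.induction_on generalizing d with
    | C1 => simp [actOne_one]
    | of p =>
      obtain ⟨a, v⟩ := p
      have : (MulAut.conj (PresentedGroup.of (a, v) : RelPi2 r)).toMonoidHom =
          actOne r (bd r (PresentedGroup.of (a, v))) := by
        apply PresentedGroup.ext; rintro ⟨b, w⟩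
        have : (PresentedGroup.mk (peifferRels r)) (FreeGroup.of (a, v) * FreeGroup.of (b, w) *
            (FreeGroup.of (a, v))⁻¹ * (FreeGroup.of (b, v * r a * v⁻¹ * w))⁻¹) = 1 := by
          apply (QuotientGroup.eq_one_iff _).2
          exact Subgroup.subset_normalClosure ⟨a, b, v, w, rfl⟩
        rw [map_mul, map_inv, mul_inv_eq_one] at this
        rw [bd_of, actOne_of]
        simpa [PresentedGroup.of] using this
      exact DFunLike.congr_fun this d
    | inv_of p hp =>
      rw [map_inv]
      set c := (PresentedGroup.mk (peifferRels r)) (FreeGroup.of p)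
      have h1 := hp (actOne r (bd r c⁻¹) d)
      rw [← actOne_mul, ← map_mul, mul_inv_cancel, map_one, actOne_one] at h1
      rw [mul_inv_eq_iff_eq_mul] at h1
      rw [inv_inv, mul_assoc, ← h1, inv_mul_cancel_left]
    | mul x y hx hy =>
      rw [map_mul, map_mul, actOne_mul, ← hy, ← hx]
      group

lemma ker_bd_comm (r : A → F) (c d : RelPi2 r) (hc : bd r c = 1) : c * d = d * c := by
  have := conj_eq_act r c d
  rwa [hc, actOne_one, mul_inv_eq_iff_eq_mul] at this

instance (r : A → F) : CommGroup (bd r).ker :=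
  { (inferInstance : Group (bd r).ker) with
    mul_comm := fun a b => Subtype.ext (ker_bd_comm r a b a.2) }

/-- `π₂(K) = ker (∂ : π₂(K, K¹) → π₁(K¹))`, written additively. -/
abbrev Pi2 (r : A → F) : Type := Additive (bd r).ker

/-- The action of `g ∈ F` on `π₂(K)`, as an additive map. -/
def pi2ActOne (r : A → F) (g : F) : Pi2 r →+ Pi2 r :=
  MonoidHom.toAdditive (((actOne r g).comp (bd r).ker.subtype).codRestrict (bd r).ker
    (fun c => by
      have h : bd r (c : RelPi2 r) = 1 := c.2
      change bd r (actOne r g c) = 1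
      simp [bd_act, h]))

lemma pi2ActOne_coe (r : A → F) (g : F) (x : Pi2 r) :
    ((pi2ActOne r g x).toMul : RelPi2 r) = actOne r g (x.toMul : RelPi2 r) := rfl

lemma Pi2.ext {r : A → F} {x y : Pi2 r} (h : (x.toMul : RelPi2 r) = (y.toMul : RelPi2 r)) :
    x = y := Additive.toMul.injective (Subtype.ext h)

/-- The action of `F = π₁(K¹)` on `π₂(K)`. -/
def pi2Act (r : A → F) : Representation ℤ F (Pi2 r) where
  toFun g := (pi2ActOne r g).toIntLinearMap
  map_one' := by
    refine LinearMap.ext fun x => Pi2.ext ?_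
    exact actOne_one r _
  map_mul' g h := by
    refine LinearMap.ext fun x => Pi2.ext ?_
    exact actOne_mul r g h _

lemma bd_mem (r : A → F) (c : RelPi2 r) : bd r c ∈ Subgroup.normalClosure (Set.range r) := by
  induction c using PresentedGroup.induction_on with
  | _ x =>
    induction x using FreeGroup.induction_on with
    | C1 => simp
    | of p =>
      obtain ⟨a, v⟩ := p
      change bd r (PresentedGroup.of (a, v)) ∈ _
      rw [bd_of]
      exact Subgroup.normalClosure_normal.conj_mem _
        (Subgroup.subset_normalClosure (Set.mem_range_self a)) _
    | inv_of p hp => rw [map_inv, map_inv]; exact inv_mem hp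
    | mul x y hx hy => rw [map_mul, map_mul]; exact mul_mem hx hy

lemma range_bd (r : A → F) : (bd r).range = Subgroup.normalClosure (Set.range r) := by
  apply le_antisymm
  · rintro _ ⟨c, rfl⟩; exact bd_mem r c
  · have : (bd r).range.Normal := by
      refine ⟨?_⟩
      rintro _ ⟨c, rfl⟩ g
      exact ⟨actOne r g c, bd_act r g c⟩
    apply Subgroup.normalClosure_le_normal
    rintro _ ⟨a, rfl⟩
    exact ⟨PresentedGroup.of (a, 1), by simp⟩

/-- `R = ⟨⟨r_a⟩⟩` acts trivially on `π₂(K)`. -/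
lemma pi2Act_trivial (r : A → F) {n : F} (hn : n ∈ Subgroup.normalClosure (Set.range r)) :
    pi2Act r n = 1 := by
  rw [← range_bd] at hn
  obtain ⟨c, rfl⟩ := hn
  refine LinearMap.ext fun x => Pi2.ext ?_
  change actOne r (bd r c) (x.toMul : RelPi2 r) = x.toMul
  rw [← conj_eq_act, mul_inv_eq_iff_eq_mul]
  exact (ker_bd_comm r _ _ x.toMul.2).symm

/-- `π₂(K)` as a module over `G = F / N`, `N = ⟨⟨r_a⟩⟩`. -/
def pi2Rep (r : A → F) (N : Subgroup F) [N.Normal]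
    (hN : N = Subgroup.normalClosure (Set.range r)) : Representation ℤ (F ⧸ N) (Pi2 r) :=
  QuotientGroup.lift N (pi2Act r) fun _ hn => pi2Act_trivial r (hN ▸ hn)

/-- The map on relative homotopy groups induced by the inclusion of the subcomplex `K¹ ∪ S`. -/
def relIncl (r : A → F) (S : Set A) : RelPi2 (fun a : S => r a) →* RelPi2 r :=
  PresentedGroup.toGroup (f := fun p : S × F => (PresentedGroup.of ((p.1 : A), p.2) : RelPi2 r))
    (by
      rintro x ⟨a, b, v, w, rfl⟩
      have := conj_eq_act r (PresentedGroup.of ((a : A), v)) (PresentedGroup.of ((b : A), w))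
      rw [bd_of, actOne_of, ← mul_inv_eq_one] at this
      simpa using this)

lemma bd_relIncl (r : A → F) (S : Set A) (c : RelPi2 (fun a : S => r a)) :
    bd r (relIncl r S c) = bd (fun a : S => r a) c := by
  have : (bd r).comp (relIncl r S) = bd (fun a : S => r a) := by
    apply PresentedGroup.ext; rintro ⟨a, w⟩
    simp [relIncl]
  exact DFunLike.congr_fun this c

/-- The map `π₂(K¹ ∪ S) → π₂(K)` induced by the inclusion, for a set `S` of 2-cells of `K`. -/
def pi2Incl (r : A → F) (S : Set A) : Pi2 (fun a : S => r a) →+ Pi2 r :=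
  MonoidHom.toAdditive (((relIncl r S).comp (bd (fun a : S => r a)).ker.subtype).codRestrict
    (bd r).ker (fun c => (bd_relIncl r S c).trans c.2))

end Crossed
section CommLemmas

/-- The commutator convention `[x, y] = x⁻¹ y⁻¹ x y`. -/
def comm {Q : Type} [Group Q] (x y : Q) : Q := x⁻¹ * y⁻¹ * x * y

lemma map_comm {Q Q' : Type} [Group Q] [Group Q'] (f : Q →* Q') (x y : Q) :
    f (comm x y) = comm (f x) (f y) := by simp [comm]

variable {Q : Type} [Group Q] {A B C : Subgroup Q} [A.Normal] [B.Normal] [C.Normal]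

lemma comm_mem_left {x : Q} (hx : x ∈ A) (y : Q) : comm x y ∈ A := by
  have h := mul_mem (inv_mem hx) (Subgroup.Normal.conj_mem ‹A.Normal› x hx y⁻¹)
  rw [inv_inv] at h
  simpa [comm, mul_assoc] using h

lemma comm_mem_right (x : Q) {y : Q} (hy : y ∈ A) : comm x y ∈ A := by
  have h := mul_mem (Subgroup.Normal.conj_mem ‹A.Normal› _ (inv_mem hy) x⁻¹) hy
  rw [inv_inv] at h
  simpa [comm, mul_assoc] using h

lemma comm_mul_left (x x' y : Q) : comm (x * x') y = x'⁻¹ * comm x y * x' * comm x' y := by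
  simp only [comm]; group

lemma comm_mul_right (x y y' : Q) : comm x (y * y') = comm x y' * (y'⁻¹ * comm x y * y') := by
  simp only [comm]; group

lemma comm_inv (x y : Q) : (comm x y)⁻¹ = comm y x := by
  simp only [comm]; group

/-- Modulo a normal subgroup. -/
lemma comm_mem_of_inv_mul {p q : Q} (h : p⁻¹ * q ∈ B) : comm p q ∈ B := by
  have : comm p q = comm p (p⁻¹ * q) := by simp only [comm]; group
  rw [this]; exact comm_mem_right _ h

lemma conj_eq_of_commute {x y : Q} (h : Commute x y) : x⁻¹ * y * x = y := by
  rw [mul_assoc, ← h.eq, inv_mul_cancel_left]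

lemma comm_eq_one {x y : Q} (h : Commute x y) : comm x y = 1 := by
  rw [comm, mul_assoc, h.eq]; group

/-- The cross effect. -/
lemma comm_cross (hA : ∀ a ∈ A, ∀ x ∈ B ⊓ C, Commute a x)
    (hB : ∀ b ∈ B, ∀ x ∈ C ⊓ A, Commute b x) (hC : ∀ c ∈ C, ∀ x ∈ A ⊓ B, Commute c x)
    {p q p' q' : Q} (hp : p ∈ A) (hq : q ∈ C) (hpq : p⁻¹ * q ∈ B)
    (hp' : p' ∈ A) (hq' : q' ∈ C) (hpq' : p'⁻¹ * q' ∈ B) :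
    comm (p * p') (q * q') = comm p q * comm p' q' * (comm p q' * comm p' q) ∧
      comm p q' * comm p' q ∈ A ⊓ B ⊓ C := by
  have m1 : comm p q' ∈ C ⊓ A := ⟨comm_mem_right _ hq', comm_mem_left hp _⟩
  have m2 : comm p' q ∈ C ⊓ A := ⟨comm_mem_right _ hq, comm_mem_left hp' _⟩
  have l1 : comm p q ∈ A ⊓ B ⊓ C :=
    ⟨⟨comm_mem_left hp _, comm_mem_of_inv_mul hpq⟩, comm_mem_right _ hq⟩
  have l2 : comm p' q' ∈ A ⊓ B ⊓ C :=
    ⟨⟨comm_mem_left hp' _, comm_mem_of_inv_mul hpq'⟩, comm_mem_right _ hq'⟩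
  have hmem : comm p q' * comm p' q ∈ B := by
    rw [← QuotientGroup.eq_one_iff]
    have e1 : (q : Q ⧸ B) = p := (QuotientGroup.eq.2 hpq).symm
    have e2 : (q' : Q ⧸ B) = p' := (QuotientGroup.eq.2 hpq').symm
    simp only [comm, QuotientGroup.mk_mul, QuotientGroup.mk_inv, e1, e2]
    group
  have hβ : comm p q' * comm p' q ∈ A ⊓ B ⊓ C :=
    ⟨⟨mul_mem m1.2 m2.2, hmem⟩, mul_mem m1.1 m2.1⟩
  refine ⟨?_, hβ⟩
  have c2 : q'⁻¹ * comm p' q * q' = p'⁻¹ * comm p' q * p' := by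
    have h := (hB _ hpq' _ m2).eq
    calc q'⁻¹ * comm p' q * q'
        = q'⁻¹ * comm p' q * p' * (p'⁻¹ * q') := by group
      _ = q'⁻¹ * p' * ((p'⁻¹ * comm p' q * p') * (p'⁻¹ * q')) := by group
      _ = q'⁻¹ * p' * ((p'⁻¹ * q') * (p'⁻¹ * comm p' q * p')) := by
          have m3 : p'⁻¹ * comm p' q * p' ∈ C ⊓ A := by
            have := Subgroup.Normal.conj_mem (inferInstance : (C ⊓ A).Normal) _ m2 p'⁻¹
            rwa [inv_inv] at this
          rw [(hB _ hpq' _ m3).eq]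
      _ = _ := by group
  have c1 : q'⁻¹ * comm p q * q' = comm p q := conj_eq_of_commute (hC _ hq' _ ⟨l1.1.1, l1.1.2⟩)
  have c3 : p'⁻¹ * comm p q * p' = comm p q := conj_eq_of_commute (hA _ hp' _ ⟨l1.1.2, l1.2⟩)
  have c4 : p'⁻¹ * (comm p q' * comm p' q) * p' = comm p q' * comm p' q :=
    conj_eq_of_commute (hA _ hp' _ ⟨hβ.1.2, hβ.2⟩)
  have c5 : Commute (comm p q') (comm p q) := hA _ m1.2 _ ⟨l1.1.2, l1.2⟩
  have c6 : p'⁻¹ * comm p' q' * p' = comm p' q' :=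
    conj_eq_of_commute (hA _ hp' _ ⟨l2.1.2, l2.2⟩)
  have c7 : Commute (comm p q') (comm p' q') := hA _ m1.2 _ ⟨l2.1.2, l2.2⟩
  calc comm (p * p') (q * q')
      = p'⁻¹ * (comm p q' * (q'⁻¹ * comm p q * q')) * p' *
          (comm p' q' * (q'⁻¹ * comm p' q * q')) := by
        rw [comm_mul_left, comm_mul_right p, comm_mul_right p']
    _ = p'⁻¹ * (comm p q * comm p q') * p' * (comm p' q' * (p'⁻¹ * comm p' q * p')) := by
        rw [c1, c2, c5.eq]
    _ = (p'⁻¹ * comm p q * p') * (p'⁻¹ * (comm p q' * (p' * comm p' q' * p'⁻¹) * comm p' q) * p')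
        := by group
    _ = comm p q * (p'⁻¹ * (comm p' q' * (comm p q' * comm p' q)) * p') := by
        rw [c3]
        have : p' * comm p' q' * p'⁻¹ = comm p' q' := by
          rw [← eq_mul_inv_iff_mul_eq, inv_inv] at *
          rw [(hA _ hp' _ ⟨l2.1.2, l2.2⟩).eq]
        rw [this, c7.eq]; simp only [mul_assoc]
    _ = comm p q * ((p'⁻¹ * comm p' q' * p') * (p'⁻¹ * (comm p q' * comm p' q) * p')) := by group
    _ = _ := by rw [c6, c4, mul_assoc]

/-- Additivity of the cross effect. -/
lemma cross_add (hA : ∀ a ∈ A, ∀ x ∈ B ⊓ C, Commute a x)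
    (hB : ∀ b ∈ B, ∀ x ∈ C ⊓ A, Commute b x) (hC : ∀ c ∈ C, ∀ x ∈ A ⊓ B, Commute c x)
    {p q p₁ q₁ p' q' : Q} (hp : p ∈ A) (hq : q ∈ C) (hpq : p⁻¹ * q ∈ B)
    (hp₁ : p₁ ∈ A) (hq₁ : q₁ ∈ C) (hpq₁ : p₁⁻¹ * q₁ ∈ B)
    (hp' : p' ∈ A) (hq' : q' ∈ C) (hpq' : p'⁻¹ * q' ∈ B) :
    comm (p * p₁) q' * comm p' (q * q₁) =
      (comm p q' * comm p' q) * (comm p₁ q' * comm p' q₁) := by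
  have m2 : comm p' q ∈ C ⊓ A := ⟨comm_mem_right _ hq, comm_mem_left hp' _⟩
  have m3 : p₁⁻¹ * comm p' q * p₁ ∈ C ⊓ A := by
    have := Subgroup.Normal.conj_mem (inferInstance : (C ⊓ A).Normal) _ m2 p₁⁻¹
    rwa [inv_inv] at this
  have c2 : q₁⁻¹ * comm p' q * q₁ = p₁⁻¹ * comm p' q * p₁ := by
    calc q₁⁻¹ * comm p' q * q₁
        = q₁⁻¹ * p₁ * ((p₁⁻¹ * comm p' q * p₁) * (p₁⁻¹ * q₁)) := by group
      _ = q₁⁻¹ * p₁ * ((p₁⁻¹ * q₁) * (p₁⁻¹ * comm p' q * p₁)) := by rw [(hB _ hpq₁ _ m3).eq]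
      _ = _ := by group
  have hβ := (comm_cross hA hB hC hp hq hpq hp' hq' hpq').2
  have hβ₁ := (comm_cross hA hB hC hp₁ hq₁ hpq₁ hp' hq' hpq').2
  have c4 : p₁⁻¹ * (comm p q' * comm p' q) * p₁ = comm p q' * comm p' q :=
    conj_eq_of_commute (hA _ hp₁ _ ⟨hβ.1.2, hβ.2⟩)
  have c8 : Commute (p₁⁻¹ * comm p' q * p₁) (comm p₁ q' * comm p' q₁) :=
    hA _ m3.2 _ ⟨hβ₁.1.2, hβ₁.2⟩
  calc comm (p * p₁) q' * comm p' (q * q₁)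
      = p₁⁻¹ * comm p q' * p₁ * ((comm p₁ q' * comm p' q₁) * (p₁⁻¹ * comm p' q * p₁)) := by
        rw [comm_mul_left, comm_mul_right, c2]; group
    _ = (p₁⁻¹ * (comm p q' * comm p' q) * p₁) * (comm p₁ q' * comm p' q₁) := by
        rw [← c8.eq]; group
    _ = _ := by rw [c4]

/-- Invariance under inversion. -/
lemma comm_inv_inv (hA : ∀ a ∈ A, ∀ x ∈ B ⊓ C, Commute a x)
    (hC : ∀ c ∈ C, ∀ x ∈ A ⊓ B, Commute c x)
    {p q : Q} (hp : p ∈ A) (hq : q ∈ C) (hpq : p⁻¹ * q ∈ B) :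
    comm p⁻¹ q⁻¹ = comm p q := by
  have l1 : comm p q ∈ A ⊓ B ⊓ C :=
    ⟨⟨comm_mem_left hp _, comm_mem_of_inv_mul hpq⟩, comm_mem_right _ hq⟩
  have h1 : q⁻¹ * comm p q * q = comm p q := conj_eq_of_commute (hC _ hq _ ⟨l1.1.1, l1.1.2⟩)
  have h2 : p⁻¹ * comm p q * p = comm p q := conj_eq_of_commute (hA _ hp _ ⟨l1.1.2, l1.2⟩)
  have h3 : p⁻¹ * (q⁻¹ * comm p⁻¹ q⁻¹ * q) * p = comm p q := by simp only [comm]; group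
  have h4 : p⁻¹ * (q⁻¹ * comm p q * q) * p = comm p q := by rw [h1, h2]
  have h5 := h3.trans h4.symm
  exact mul_left_cancel (mul_right_cancel (mul_left_cancel (mul_right_cancel h5)))

/-- Changing `(p, q)` by `(a u, b u)` with `a ∈ A ∩ B`, `b ∈ B ∩ C`, `u ∈ C ∩ A`. -/
lemma comm_null (hA : ∀ a ∈ A, ∀ x ∈ B ⊓ C, Commute a x)
    (hB : ∀ b ∈ B, ∀ x ∈ C ⊓ A, Commute b x) (hC : ∀ c ∈ C, ∀ x ∈ A ⊓ B, Commute c x)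
    {p q a b u : Q} (hp : p ∈ A) (hq : q ∈ C) (hpq : p⁻¹ * q ∈ B)
    (ha : a ∈ A ⊓ B) (hb : b ∈ B ⊓ C) (hu : u ∈ C ⊓ A) :
    comm (p * (a * u)) (q * (b * u)) = comm p q := by
  have hab : Commute a b := hA _ ha.1 _ hb
  have hau : Commute a u := (hC _ hu.1 _ ha).symm
  have hbu : Commute b u := hB _ hb.1 _ hu
  have h1 := (comm_cross hA hB hC hp hq hpq (mul_mem ha.1 hu.2) (mul_mem hb.2 hu.1) (by
    have : (a * u)⁻¹ * (b * u) = u⁻¹ * (a⁻¹ * b) * u := by group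
    rw [this]
    have := Subgroup.Normal.conj_mem ‹B.Normal› _ (mul_mem (inv_mem ha.2) hb.1) u⁻¹
    rwa [inv_inv] at this)).1
  have e1 : comm (a * u) (b * u) = 1 := by
    apply comm_eq_one
    exact (hab.mul_right hau).mul_left (hbu.symm.mul_right (Commute.refl u))
  have e2 : comm p (b * u) = comm p u := by
    rw [comm_mul_right, comm_eq_one (hA _ hp _ hb)]; group
  have e3 : comm (a * u) q = comm u q := by
    rw [comm_mul_left, comm_eq_one (hC _ hq _ ha).symm]; group
  have e4 : comm u q = comm u p := by
    have c := hB _ hpq _ hu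
    have : comm u p ∈ C ⊓ A := ⟨comm_mem_left hu.1 _, comm_mem_left hu.2 _⟩
    have d := hB _ hpq _ this
    have : q = p * (p⁻¹ * q) := by group
    rw [this, comm_mul_right, comm_eq_one c.symm, conj_eq_of_commute d, one_mul]
  rw [h1, e1, e2, e3, e4, ← comm_inv u p]
  group

end CommLemmas
section I3

variable {F : Type} [Group F]

/-- `[R₁, R₂ ∩ R₃][R₂, R₃ ∩ R₁][R₃, R₁ ∩ R₂]`. -/
def commProd (R : Fin 3 → Subgroup F) : Subgroup F :=
  ⁅R 0, R 1 ⊓ R 2⁆ ⊔ ⁅R 1, R 2 ⊓ R 0⁆ ⊔ ⁅R 2, R 0 ⊓ R 1⁆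

/-- `R₁ ∩ R₂ ∩ R₃`. -/
def tripleInter (R : Fin 3 → Subgroup F) : Subgroup F := R 0 ⊓ R 1 ⊓ R 2

variable (R : Fin 3 → Subgroup F) [hR : ∀ i, (R i).Normal]

instance : (commProd R).Normal := by unfold commProd; infer_instance

instance : (tripleInter R).Normal := by unfold tripleInter; infer_instance

lemma commProd_le : commProd R ≤ tripleInter R := by
  have a (i j k : Fin 3) : ⁅R i, R j ⊓ R k⁆ ≤ R i ⊓ R j ⊓ R k :=
    (Subgroup.commutator_le_inf _ _).trans (le_of_eq (by rw [inf_assoc]))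
  unfold commProd tripleInter
  refine sup_le (sup_le (a 0 1 2) ?_) ?_
  · exact (a 1 2 0).trans (le_of_eq (by ac_rfl))
  · exact (a 2 0 1).trans (le_of_eq (by ac_rfl))

/-- The quotient `(R₁ ∩ R₂ ∩ R₃) / [R₁, R₂ ∩ R₃][R₂, R₃ ∩ R₁][R₃, R₁ ∩ R₂]`, multiplicatively. -/
abbrev I3Mul : Type := tripleInter R ⧸ (commProd R).subgroupOf (tripleInter R)

/-- The inclusion of `I₃` into `F / [R₁, R₂ ∩ R₃][R₂, R₃ ∩ R₁][R₃, R₁ ∩ R₂]`. -/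
def I3Incl : I3Mul R →* F ⧸ commProd R :=
  QuotientGroup.map _ _ (tripleInter R).subtype (fun _ h => h)

lemma I3Incl_injective : Function.Injective (I3Incl R) := by
  rw [injective_iff_map_eq_one]
  intro x
  induction x using QuotientGroup.induction_on with
  | H x =>
    intro h
    exact (QuotientGroup.eq_one_iff x).2 ((QuotientGroup.eq_one_iff (x : F)).1 h)

lemma I3Incl_mem (x : I3Mul R) : ∃ y ∈ tripleInter R, I3Incl R x = (y : F ⧸ commProd R) := by
  induction x using QuotientGroup.induction_on with
  | H x => exact ⟨x, x.2, rfl⟩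

/-- The images `R̄ᵢ` of the `Rᵢ` in `F / [R₁, R₂ ∩ R₃][R₂, R₃ ∩ R₁][R₃, R₁ ∩ R₂]`. -/
def barR (i : Fin 3) : Subgroup (F ⧸ commProd R) := (R i).map (QuotientGroup.mk' _)

instance (i : Fin 3) : (barR R i).Normal :=
  Subgroup.Normal.map (hR i) _ (QuotientGroup.mk'_surjective _)

lemma commute_of_mem {i j k : Fin 3} (h : ⁅R i, R j ⊓ R k⁆ ≤ commProd R)
    (hk : commProd R ≤ R k) (a : F ⧸ commProd R) (ha : a ∈ barR R i)
    (x : F ⧸ commProd R) (hx : x ∈ barR R j ⊓ barR R k) : Commute a x := by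
  obtain ⟨a, ha, rfl⟩ := ha
  obtain ⟨⟨y, hy, rfl⟩, ⟨z, hz, hzy⟩⟩ := hx
  have hyk : y ∈ R k := by
    have h1 : z⁻¹ * y ∈ commProd R := QuotientGroup.eq.1 hzy
    simpa using mul_mem hz (hk h1)
  have := h (Subgroup.commutator_mem_commutator ha (Subgroup.mem_inf.2 ⟨hy, hyk⟩))
  have h2 := (QuotientGroup.eq_one_iff (N := commProd R) _).2 this
  change ((a : F ⧸ commProd R)) * y = y * a
  rw [commutatorElement_def] at h2
  simp only [QuotientGroup.mk_mul, QuotientGroup.mk_inv] at h2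
  rw [mul_inv_eq_one, mul_inv_eq_iff_eq_mul] at h2
  exact h2

lemma comm0 : ∀ a ∈ barR R 0, ∀ x ∈ barR R 1 ⊓ barR R 2, Commute a x :=
  commute_of_mem R (le_sup_left.trans le_sup_left) ((commProd_le R).trans inf_le_right)

lemma comm1 : ∀ a ∈ barR R 1, ∀ x ∈ barR R 2 ⊓ barR R 0, Commute a x :=
  commute_of_mem R (le_sup_right.trans le_sup_left)
    ((commProd_le R).trans (inf_le_left.trans inf_le_left))

lemma comm2 : ∀ a ∈ barR R 2, ∀ x ∈ barR R 0 ⊓ barR R 1, Commute a x :=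
  commute_of_mem R le_sup_right ((commProd_le R).trans (inf_le_left.trans inf_le_right))

lemma mem_barR {x : F} {i : Fin 3} (h : x ∈ R i) : (x : F ⧸ commProd R) ∈ barR R i :=
  ⟨x, h, rfl⟩

lemma tripleInter_commute {n y : F} (hn : n ∈ R 0 ⊔ R 1 ⊔ R 2) (hy : y ∈ tripleInter R) :
    Commute (n : F ⧸ commProd R) y := by
  have key : R 0 ⊔ R 1 ⊔ R 2 ≤
      (Subgroup.centralizer {(y : F ⧸ commProd R)}).comap (QuotientGroup.mk' _) := by
    refine sup_le (sup_le ?_ ?_) ?_ <;> intro x hx <;>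
      refine Subgroup.mem_centralizer_singleton_iff.2 ?_
    · exact (comm0 R x (mem_barR R hx) y ⟨mem_barR R hy.1.2, mem_barR R hy.2⟩).eq
    · exact (comm1 R x (mem_barR R hx) y ⟨mem_barR R hy.2, mem_barR R hy.1.1⟩).eq
    · exact (comm2 R x (mem_barR R hx) y ⟨mem_barR R hy.1.1, mem_barR R hy.1.2⟩).eq
  exact Subgroup.mem_centralizer_singleton_iff.1 (key hn)

instance : CommGroup (I3Mul R) :=
  { (inferInstance : Group (I3Mul R)) with
    mul_comm := fun a b => by
      apply I3Incl_injective
      obtain ⟨x, hx, ex⟩ := I3Incl_mem R a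
      obtain ⟨y, hy, ey⟩ := I3Incl_mem R b
      rw [map_mul, map_mul, ex, ey]
      exact tripleInter_commute R (le_sup_right (a := R 0 ⊔ R 1) hx.2) hy }

/-- `I₃(F; R₁, R₂, R₃)`, written additively. -/
abbrev I3 : Type := Additive (I3Mul R)

/-- Conjugation `x ↦ g x g⁻¹` on `I₃(F; R₁, R₂, R₃)`. -/
def I3ActOne (g : F) : I3 R →+ I3 R :=
  MonoidHom.toAdditive (QuotientGroup.map _ _
    (((MulAut.conj g).toMonoidHom.comp (tripleInter R).subtype).codRestrict (tripleInter R)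
      (fun x => (inferInstance : (tripleInter R).Normal).conj_mem _ x.2 g))
    (fun _ hx => (inferInstance : (commProd R).Normal).conj_mem _ hx g))

lemma I3Incl_act (g : F) (x : I3 R) :
    I3Incl R (I3ActOne R g x).toMul = g * I3Incl R x.toMul * (g : F ⧸ commProd R)⁻¹ := by
  obtain ⟨x, rfl⟩ := QuotientGroup.mk_surjective (Additive.toMul x)
  rfl

lemma I3.ext {x y : I3 R} (h : I3Incl R x.toMul = I3Incl R y.toMul) : x = y :=
  Additive.toMul.injective (I3Incl_injective R h)

/-- The conjugation action of `F` on `I₃(F; R₁, R₂, R₃)`. -/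
def I3Act : Representation ℤ F (I3 R) where
  toFun g := (I3ActOne R g).toIntLinearMap
  map_one' := LinearMap.ext fun x => I3.ext R ((I3Incl_act R 1 x).trans (by simp))
  map_mul' g h := LinearMap.ext fun x => I3.ext R (by
    change I3Incl R (I3ActOne R (g * h) x).toMul = I3Incl R (I3ActOne R g (I3ActOne R h x)).toMul
    simp [I3Incl_act, mul_assoc])

/-- `I₃(F; R₁, R₂, R₃)` as a module over `F / R₁R₂R₃`. -/
def I3Rep : Representation ℤ (F ⧸ (R 0 ⊔ R 1 ⊔ R 2)) (I3 R) :=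
  QuotientGroup.lift _ (I3Act R) fun n hn => LinearMap.ext fun x => I3.ext R (by
    obtain ⟨y, hy, ey⟩ := I3Incl_mem R x.toMul
    change I3Incl R (I3ActOne R n x).toMul = I3Incl R x.toMul
    rw [I3Incl_act, ey, mul_inv_eq_iff_eq_mul]
    exact tripleInter_commute R hn hy)

end I3

section Lambda

variable {A F : Type} [Group F]

/-- A finite sequence of formal terms `(e_a^w)^{±1}`; the entry `((a, w), true)` stands for
`e_a^w`, with value `w r_a w⁻¹` in `F`, and `((a, w), false)` for its inverse. -/
abbrev Seq (A F : Type) : Type := List ((A × F) × Bool)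

/-- The element of `F` given by a term of a sequence. -/
def termVal (r : A → F) (t : (A × F) × Bool) : F :=
  cond t.2 (t.1.2 * r t.1.1 * t.1.2⁻¹) (t.1.2 * r t.1.1 * t.1.2⁻¹)⁻¹

/-- `r_c`: the product, in the given order, of the terms of a sequence that have label `1`. -/
def rPart (r : A → F) (lab : A → Fin 3) : Seq A F → F
  | [] => 1
  | t :: c => if lab t.1.1 = 0 then termVal r t * rPart r lab c else rPart r lab c

/-- `s_c`: the product, in the given order, of the terms of a sequence that have label `2`, each
conjugated (`x ↦ g⁻¹ x g`) by the product `g` of all later terms that have label `1`. -/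
def sPart (r : A → F) (lab : A → Fin 3) : Seq A F → F
  | [] => 1
  | t :: c => if lab t.1.1 = 1 then
      (rPart r lab c)⁻¹ * termVal r t * rPart r lab c * sPart r lab c else sPart r lab c

/-- The product of the terms with label `1`, as a homomorphism. -/
def rho0 (r : A → F) (lab : A → Fin 3) : FreeGroup (A × F) →* F :=
  FreeGroup.lift fun p => if lab p.1 = 0 then p.2 * r p.1 * p.2⁻¹ else 1

/-- The product of the terms with label `1` or `2`, as a homomorphism. -/
def rho01 (r : A → F) (lab : A → Fin 3) : FreeGroup (A × F) →* F :=
  FreeGroup.lift fun p => if lab p.1 = 2 then 1 else p.2 * r p.1 * p.2⁻¹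

lemma rPart_eq (r : A → F) (lab : A → Fin 3) (c : Seq A F) :
    rPart r lab c = rho0 r lab (FreeGroup.mk c) := by
  induction c with
  | nil => simp [rPart, rho0]
  | cons t c ih =>
    obtain ⟨⟨a, w⟩, b⟩ := t
    simp only [rho0, FreeGroup.lift_mk] at ih ⊢
    by_cases h : lab a = 0 <;> cases b <;> simp [rPart, termVal, h, ih]

lemma rPart_mul_sPart (r : A → F) (lab : A → Fin 3) (c : Seq A F) :
    rPart r lab c * sPart r lab c = rho01 r lab (FreeGroup.mk c) := by
  induction c with
  | nil => simp [rPart, sPart, rho01]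
  | cons t c ih =>
    obtain ⟨⟨a, w⟩, b⟩ := t
    have e : rho01 r lab (FreeGroup.mk (((a, w), b) :: c)) =
        (if lab a = 2 then 1 else termVal r ((a, w), b)) * rho01 r lab (FreeGroup.mk c) := by
      have : (FreeGroup.mk (((a, w), b) :: c) : FreeGroup (A × F)) =
        FreeGroup.mk [((a, w), b)] * FreeGroup.mk c := rfl
      rw [this, map_mul]
      by_cases h : lab a = 2 <;> cases b <;> simp [rho01, termVal, h]
    rw [e, ← ih]
    have : lab a = 0 ∨ lab a = 1 ∨ lab a = 2 := by
      generalize lab a = i; fin_cases i <;> simp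
    rcases this with h | h | h <;> simp [rPart, sPart, h, mul_assoc]

lemma comm_rPart_sPart (r : A → F) (lab : A → Fin 3) (c : Seq A F) :
    comm (rPart r lab c) (sPart r lab c) =
      comm (rho0 r lab (FreeGroup.mk c)) (rho01 r lab (FreeGroup.mk c)) := by
  rw [← rPart_mul_sPart, ← rPart_eq]
  simp only [comm]; group

variable {R : Fin 3 → Subgroup F} [hR : ∀ i, (R i).Normal] {r : A → F} {lab : A → Fin 3}

lemma rho0_mem (h : ∀ a, r a ∈ R (lab a)) (x : FreeGroup (A × F)) : rho0 r lab x ∈ R 0 := by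
  have : (QuotientGroup.mk' (R 0)).comp (rho0 r lab) = 1 := by
    ext ⟨a, w⟩
    simp only [rho0, MonoidHom.comp_apply, FreeGroup.lift_apply_of, MonoidHom.one_apply]
    split_ifs with h0
    · exact (QuotientGroup.eq_one_iff _).2 ((hR 0).conj_mem _ (h0 ▸ h a) w)
    · simp
  exact (QuotientGroup.eq_one_iff _).1 (DFunLike.congr_fun this x)

lemma rho_mem1 (h : ∀ a, r a ∈ R (lab a)) (x : FreeGroup (A × F)) :
    (rho0 r lab x)⁻¹ * rho01 r lab x ∈ R 1 := by
  have : (QuotientGroup.mk' (R 1)).comp (rho0 r lab) =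
      (QuotientGroup.mk' (R 1)).comp (rho01 r lab) := by
    ext ⟨a, w⟩
    simp only [rho0, rho01, MonoidHom.comp_apply, FreeGroup.lift_apply_of]
    have h3 : lab a = 0 ∨ lab a = 1 ∨ lab a = 2 := by
      generalize lab a = i; fin_cases i <;> simp
    rcases h3 with h0 | h0 | h0
    · simp [h0]
    · simp only [h0, one_ne_zero, if_false, map_one]
      rw [if_neg (by decide)]
      exact ((QuotientGroup.eq_one_iff _).2 ((hR 1).conj_mem _ (h0 ▸ h a) w)).symm
    · simp [h0]
  exact QuotientGroup.eq.1 (DFunLike.congr_fun this x)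

lemma rho_mem2 (h : ∀ a, r a ∈ R (lab a)) (x : FreeGroup (A × F)) :
    (rho01 r lab x)⁻¹ * preBd r x ∈ R 2 := by
  have : (QuotientGroup.mk' (R 2)).comp (rho01 r lab) =
      (QuotientGroup.mk' (R 2)).comp (preBd r) := by
    ext ⟨a, w⟩
    simp only [preBd, rho01, MonoidHom.comp_apply, FreeGroup.lift_apply_of]
    split_ifs with h0
    · exact ((QuotientGroup.eq_one_iff _).2 ((hR 2).conj_mem _ (h0 ▸ h a) w)).symm
    · rfl
  exact QuotientGroup.eq.1 (DFunLike.congr_fun this x)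

lemma rho01_mem (h : ∀ a, r a ∈ R (lab a)) {x : FreeGroup (A × F)} (hx : preBd r x = 1) :
    rho01 r lab x ∈ R 2 := by
  simpa [hx] using rho_mem2 h x

/-- For an identity sequence `c` one has `[r_c, s_c] ∈ R₁ ∩ R₂ ∩ R₃`. -/
lemma comm_mem_tripleInter (h : ∀ a, r a ∈ R (lab a)) {c : Seq A F}
    (hc : preBd r (FreeGroup.mk c) = 1) :
    comm (rPart r lab c) (sPart r lab c) ∈ tripleInter R := by
  rw [comm_rPart_sPart]
  exact ⟨⟨comm_mem_left (rho0_mem h _) _, comm_mem_of_inv_mul (rho_mem1 h _)⟩,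
    comm_mem_right _ (rho01_mem h hc)⟩

/-- The element of `π₂(K, K¹)` represented by a sequence. -/
def seqClass (r : A → F) (c : Seq A F) : RelPi2 r := PresentedGroup.mk _ (FreeGroup.mk c)

lemma seqClass_surjective (r : A → F) : Function.Surjective (seqClass r) := by
  intro x
  obtain ⟨y, rfl⟩ := PresentedGroup.mk_surjective _ x
  obtain ⟨c, rfl⟩ := Quot.exists_rep y
  exact ⟨c, rfl⟩

lemma bd_seqClass (r : A → F) (c : Seq A F) : bd r (seqClass r c) = (c.map (termVal r)).prod := by
  rw [seqClass, bd_mk, preBd, FreeGroup.lift_mk]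
  rfl

/-- A sequence that represents a given element of `π₂(K)`. -/
def reprSeq (x : Pi2 r) : Seq A F :=
  Classical.choose (seqClass_surjective r (x.toMul : RelPi2 r))

lemma seqClass_reprSeq (x : Pi2 r) : seqClass r (reprSeq x) = (x.toMul : RelPi2 r) :=
  Classical.choose_spec (seqClass_surjective r (x.toMul : RelPi2 r))

lemma preBd_reprSeq (x : Pi2 r) : preBd r (FreeGroup.mk (reprSeq x)) = 1 := by
  rw [← bd_mk]
  exact (congrArg (bd r) (seqClass_reprSeq x)).trans x.toMul.2

/-- `Λ : π₂(K) → I₃(F; R₁, R₂, R₃)`, sending the class of an identity sequence `c` to the class of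
`[r_c, s_c]` (see `Lambda_seq` for the independence of `c`). -/
def Lambda (h : ∀ a, r a ∈ R (lab a)) (x : Pi2 r) : I3 R :=
  Additive.ofMul (QuotientGroup.mk
    ⟨comm (rPart r lab (reprSeq x)) (sPart r lab (reprSeq x)),
      comm_mem_tripleInter h (preBd_reprSeq x)⟩)

/-- The pairs `(a u, b u)` with `a ∈ R₁ ∩ R₂`, `b ∈ R₂ ∩ R₃`, `u ∈ R₃ ∩ R₁` modulo commutators. -/
def nullSub (R : Fin 3 → Subgroup F) [hR : ∀ i, (R i).Normal] (r : A → F) (lab : A → Fin 3) :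
    Subgroup (FreeGroup (A × F)) where
  carrier := {x | ∃ a ∈ barR R 0 ⊓ barR R 1, ∃ b ∈ barR R 1 ⊓ barR R 2, ∃ u ∈ barR R 2 ⊓ barR R 0,
    (rho0 r lab x : F ⧸ commProd R) = a * u ∧ (rho01 r lab x : F ⧸ commProd R) = b * u}
  one_mem' := ⟨1, one_mem _, 1, one_mem _, 1, one_mem _, by simp, by simp⟩
  mul_mem' := by
    rintro x y ⟨a, ha, b, hb, u, hu, e1, e2⟩ ⟨a', ha', b', hb', u', hu', e1', e2'⟩
    refine ⟨a * (u * a' * u⁻¹), mul_mem ha (Subgroup.Normal.conj_mem inferInstance _ ha' u),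
      b * (u * b' * u⁻¹), mul_mem hb (Subgroup.Normal.conj_mem inferInstance _ hb' u),
      u * u', mul_mem hu hu', ?_, ?_⟩
    · rw [map_mul, QuotientGroup.mk_mul, e1, e1']; group
    · rw [map_mul, QuotientGroup.mk_mul, e2, e2']; group
  inv_mem' := by
    rintro x ⟨a, ha, b, hb, u, hu, e1, e2⟩
    refine ⟨u⁻¹ * a⁻¹ * u⁻¹⁻¹, Subgroup.Normal.conj_mem inferInstance _ (inv_mem ha) u⁻¹,
      u⁻¹ * b⁻¹ * u⁻¹⁻¹, Subgroup.Normal.conj_mem inferInstance _ (inv_mem hb) u⁻¹,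
      u⁻¹, inv_mem hu, ?_, ?_⟩
    · rw [map_inv, QuotientGroup.mk_inv, e1]; group
    · rw [map_inv, QuotientGroup.mk_inv, e2]; group

lemma nullSub_normal (h : ∀ a, r a ∈ R (lab a)) : (nullSub R r lab).Normal := by
  refine ⟨?_⟩
  rintro x ⟨a, ha, b, hb, u, hu, e1, e2⟩ g
  set g0 : F ⧸ commProd R := (rho0 r lab g : F ⧸ commProd R)
  set g1 : F ⧸ commProd R := (rho01 r lab g : F ⧸ commProd R)
  have hg : g0⁻¹ * g1 ∈ barR R 1 := mem_barR R (rho_mem1 h g)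
  have hc : g1 * u * g1⁻¹ = g0 * u * g0⁻¹ := by
    have := (comm1 R _ hg u hu).eq
    calc g1 * u * g1⁻¹ = g0 * ((g0⁻¹ * g1) * u) * g1⁻¹ := by group
      _ = g0 * u * g0⁻¹ := by rw [this]; group
  refine ⟨g0 * a * g0⁻¹, Subgroup.Normal.conj_mem inferInstance _ ha g0,
    g1 * b * g1⁻¹, Subgroup.Normal.conj_mem inferInstance _ hb g1,
    g0 * u * g0⁻¹, Subgroup.Normal.conj_mem inferInstance _ hu g0, ?_, ?_⟩
  · simp only [map_mul, map_inv, QuotientGroup.mk_mul, QuotientGroup.mk_inv, e1]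
    change g0 * (a * u) * g0⁻¹ = _
    group
  · simp only [map_mul, map_inv, QuotientGroup.mk_mul, QuotientGroup.mk_inv, e2]
    change g1 * (b * u) * g1⁻¹ = _
    rw [← hc]; group

lemma peiffer_mem_nullSub (h : ∀ a, r a ∈ R (lab a)) :
    Subgroup.normalClosure (peifferRels r) ≤ nullSub R r lab := by
  have := nullSub_normal h
  apply Subgroup.normalClosure_le_normal
  rintro x ⟨a, b, v, w, rfl⟩
  have h3 (i : Fin 3) : i = 0 ∨ i = 1 ∨ i = 2 := by fin_cases i <;> simp
  obtain ⟨e, hee⟩ : ∃ e, e = v * r a * v⁻¹ := ⟨_, rfl⟩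
  obtain ⟨f, hff⟩ : ∃ f, f = w * r b * w⁻¹ := ⟨_, rfl⟩
  have he : e ∈ R (lab a) := hee ▸ (hR _).conj_mem _ (h a) v
  have hf : f ∈ R (lab b) := hff ▸ (hR _).conj_mem _ (h b) w
  have hu : (e * w) * r b * (e * w)⁻¹ = e * f * e⁻¹ := by
    rw [hff]; group
  have hk1 : f * (e * f * e⁻¹)⁻¹ ∈ R (lab a) := by
    have : f * (e * f * e⁻¹)⁻¹ = (f * e * f⁻¹) * e⁻¹ := by group
    rw [this]; exact mul_mem ((hR _).conj_mem _ he f) (inv_mem he)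
  have hk2 : f * (e * f * e⁻¹)⁻¹ ∈ R (lab b) :=
    mul_mem hf (inv_mem ((hR _).conj_mem _ hf e))
  set k : F := f * (e * f * e⁻¹)⁻¹ with hk
  change ∃ _ ∈ _, _
  simp only [rho0, rho01, map_mul, map_inv, FreeGroup.lift_apply_of, hu, ← hee, ← hff]
  have hc : e * f * e⁻¹ * (e * f * e⁻¹)⁻¹ = 1 := by group
  have hk' : f * (e * f * e⁻¹)⁻¹ = k := rfl
  clear_value k
  rcases h3 (lab b) with hb | hb | hb <;> rcases h3 (lab a) with ha | ha | ha <;>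
    rw [ha] at hk1 <;> rw [hb] at hk2 <;>
    simp only [ha, hb, if_true, if_false, Fin.isValue, Fin.reduceEq, one_ne_zero, mul_one, one_mul,
      inv_one, hc, hk', mul_inv_cancel, QuotientGroup.mk_one]
  · exact ⟨1, one_mem _, 1, one_mem _, 1, one_mem _, by simp, by simp⟩
  · exact ⟨k, ⟨mem_barR R hk2, mem_barR R hk1⟩, 1, one_mem _, 1, one_mem _, by simp, by simp⟩
  · exact ⟨1, one_mem _, 1, one_mem _, k, ⟨mem_barR R hk1, mem_barR R hk2⟩, by simp, by simp⟩
  · exact ⟨1, one_mem _, 1, one_mem _, 1, one_mem _, by simp, by simp⟩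
  · exact ⟨1, one_mem _, 1, one_mem _, 1, one_mem _, by simp, by simp⟩
  · exact ⟨1, one_mem _, k, ⟨mem_barR R hk2, mem_barR R hk1⟩, 1, one_mem _, by simp, by simp⟩
  · exact ⟨1, one_mem _, 1, one_mem _, 1, one_mem _, by simp, by simp⟩
  · exact ⟨1, one_mem _, 1, one_mem _, 1, one_mem _, by simp, by simp⟩
  · exact ⟨1, one_mem _, 1, one_mem _, 1, one_mem _, by simp, by simp⟩

lemma lambda_wd (h : ∀ a, r a ∈ R (lab a)) {x y : FreeGroup (A × F)} (hx : preBd r x = 1)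
    (hxy : PresentedGroup.mk (peifferRels r) x = PresentedGroup.mk _ y) :
    comm (rho0 r lab x : F ⧸ commProd R) (rho01 r lab x) =
      comm (rho0 r lab y : F ⧸ commProd R) (rho01 r lab y) := by
  obtain ⟨a, ha, b, hb, u, hu, e1, e2⟩ := peiffer_mem_nullSub h (QuotientGroup.eq.1 hxy)
  have hy : y = x * (x⁻¹ * y) := by group
  rw [hy]
  simp only [map_mul (rho0 r lab) x, map_mul (rho01 r lab) x, QuotientGroup.mk_mul, e1, e2]
  exact (comm_null (comm0 R) (comm1 R) (comm2 R) (mem_barR R (rho0_mem h x))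
    (mem_barR R (rho01_mem h hx)) (mem_barR R (rho_mem1 h x)) ha hb hu).symm

lemma I3Incl_Lambda (h : ∀ a, r a ∈ R (lab a)) (x : Pi2 r) {y : FreeGroup (A × F)}
    (hy : PresentedGroup.mk (peifferRels r) y = (x.toMul : RelPi2 r)) :
    I3Incl R (Lambda h x).toMul = comm (rho0 r lab y : F ⧸ commProd R) (rho01 r lab y) := by
  have h1 : I3Incl R (Lambda h x).toMul =
    ((comm (rPart r lab (reprSeq x)) (sPart r lab (reprSeq x)) : F) : F ⧸ commProd R) := rfl
  rw [h1, comm_rPart_sPart]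
  refine (map_comm (QuotientGroup.mk' (commProd R)) _ _).trans ?_
  exact lambda_wd h (preBd_reprSeq x) ((seqClass_reprSeq x).trans hy.symm)

/-- `Λ` may be computed from any identity sequence representing the element. -/
lemma Lambda_seq (h : ∀ a, r a ∈ R (lab a)) (x : Pi2 r) (c : Seq A F)
    (hc : seqClass r c = (x.toMul : RelPi2 r)) (hm : comm (rPart r lab c) (sPart r lab c) ∈
      tripleInter R) :
    Lambda h x = Additive.ofMul (QuotientGroup.mk ⟨comm (rPart r lab c) (sPart r lab c), hm⟩) := by
  apply I3.ext
  rw [I3Incl_Lambda h x hc]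
  refine Eq.trans ?_ (congrArg (QuotientGroup.mk' (commProd R)) (comm_rPart_sPart r lab c).symm)
  exact (map_comm (QuotientGroup.mk' (commProd R)) _ _).symm

/-- The cross effect of `Λ`. -/
def crossL (h : ∀ a, r a ∈ R (lab a)) (x y : Pi2 r) : I3 R :=
  Lambda h (x + y) - Lambda h x - Lambda h y

lemma exists_rep (x : Pi2 r) : ∃ y : FreeGroup (A × F),
    PresentedGroup.mk (peifferRels r) y = (x.toMul : RelPi2 r) ∧ preBd r y = 1 :=
  ⟨FreeGroup.mk (reprSeq x), seqClass_reprSeq x, preBd_reprSeq x⟩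

lemma I3Incl_crossL (h : ∀ a, r a ∈ R (lab a)) (x x' : Pi2 r) {y y' : FreeGroup (A × F)}
    (hy : PresentedGroup.mk (peifferRels r) y = (x.toMul : RelPi2 r)) (hb : preBd r y = 1)
    (hy' : PresentedGroup.mk (peifferRels r) y' = (x'.toMul : RelPi2 r)) (hb' : preBd r y' = 1) :
    I3Incl R (crossL h x x').toMul =
      comm (rho0 r lab y : F ⧸ commProd R) (rho01 r lab y') *
        comm (rho0 r lab y' : F ⧸ commProd R) (rho01 r lab y) := by
  have e1 : Lambda h (x + x') = crossL h x x' + Lambda h x + Lambda h x' := by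
    simp only [crossL]; abel
  have e2 := congrArg (fun z => I3Incl R z.toMul) e1
  simp only [toMul_add, map_mul] at e2
  have hyy : PresentedGroup.mk (peifferRels r) (y * y') = ((x + x').toMul : RelPi2 r) := by
    rw [map_mul, hy, hy']; rfl
  rw [I3Incl_Lambda h _ hyy, I3Incl_Lambda h x hy, I3Incl_Lambda h x' hy', map_mul, map_mul,
    QuotientGroup.mk_mul, QuotientGroup.mk_mul] at e2
  have e3 := (comm_cross (comm0 R) (comm1 R) (comm2 R) (mem_barR R (rho0_mem h y))
    (mem_barR R (rho01_mem h hb)) (mem_barR R (rho_mem1 h y)) (mem_barR R (rho0_mem h y'))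
    (mem_barR R (rho01_mem h hb')) (mem_barR R (rho_mem1 h y'))).1
  rw [e3] at e2
  have c1 : comm (rho0 r lab y : F ⧸ commProd R) (rho01 r lab y) = I3Incl R (Lambda h x).toMul :=
    (I3Incl_Lambda h x hy).symm
  have c2 : comm (rho0 r lab y' : F ⧸ commProd R) (rho01 r lab y') =
    I3Incl R (Lambda h x').toMul := (I3Incl_Lambda h x' hy').symm
  rw [c1, c2] at e2
  have e4 : I3Incl R (crossL h x x').toMul * I3Incl R (Lambda h x).toMul *
      I3Incl R (Lambda h x').toMul = I3Incl R (Lambda h x).toMul *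
      I3Incl R (Lambda h x').toMul * I3Incl R (crossL h x x').toMul := by
    simp only [← MonoidHom.map_mul]
    rw [mul_assoc, mul_comm]
  rw [e4] at e2
  exact (mul_left_cancel e2).symm

lemma crossL_symm (h : ∀ a, r a ∈ R (lab a)) (x y : Pi2 r) : crossL h x y = crossL h y x := by
  simp only [crossL, add_comm x y]; abel

lemma crossL_add_left (h : ∀ a, r a ∈ R (lab a)) (x x' y : Pi2 r) :
    crossL h (x + x') y = crossL h x y + crossL h x' y := by
  apply I3.ext
  obtain ⟨z, hz, bz⟩ := exists_rep x
  obtain ⟨z', hz', bz'⟩ := exists_rep x'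
  obtain ⟨t, ht, bt⟩ := exists_rep y
  have hzz : PresentedGroup.mk (peifferRels r) (z * z') = ((x + x').toMul : RelPi2 r) := by
    rw [map_mul, hz, hz']; rfl
  rw [toMul_add, map_mul, I3Incl_crossL h x y hz bz ht bt, I3Incl_crossL h x' y hz' bz' ht bt,
    I3Incl_crossL h _ y hzz (by rw [map_mul, bz, bz', one_mul]) ht bt]
  simp only [map_mul (rho0 r lab), map_mul (rho01 r lab), QuotientGroup.mk_mul]
  exact cross_add (comm0 R) (comm1 R) (comm2 R) (mem_barR R (rho0_mem h z))
    (mem_barR R (rho01_mem h bz)) (mem_barR R (rho_mem1 h z)) (mem_barR R (rho0_mem h z'))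
    (mem_barR R (rho01_mem h bz')) (mem_barR R (rho_mem1 h z')) (mem_barR R (rho0_mem h t))
    (mem_barR R (rho01_mem h bt)) (mem_barR R (rho_mem1 h t))

lemma Lambda_neg (h : ∀ a, r a ∈ R (lab a)) (x : Pi2 r) : Lambda h (-x) = Lambda h x := by
  apply I3.ext
  obtain ⟨z, hz, bz⟩ := exists_rep x
  have hzi : PresentedGroup.mk (peifferRels r) z⁻¹ = ((-x).toMul : RelPi2 r) := by
    rw [map_inv, hz]; rfl
  rw [I3Incl_Lambda h _ hzi, I3Incl_Lambda h x hz]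
  simp only [map_inv, QuotientGroup.mk_inv]
  exact comm_inv_inv (comm0 R) (comm2 R) (mem_barR R (rho0_mem h z))
    (mem_barR R (rho01_mem h bz)) (mem_barR R (rho_mem1 h z))

lemma rho0_preAct (g : F) (x : FreeGroup (A × F)) :
    rho0 r lab (preAct A g x) = g * rho0 r lab x * g⁻¹ := by
  have : (rho0 r lab).comp (preAct A g) = (MulAut.conj g).toMonoidHom.comp (rho0 r lab) := by
    ext ⟨a, w⟩
    by_cases h : lab a = 0 <;> simp [rho0, preAct, h, mul_assoc]
  exact DFunLike.congr_fun this x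

lemma rho01_preAct (g : F) (x : FreeGroup (A × F)) :
    rho01 r lab (preAct A g x) = g * rho01 r lab x * g⁻¹ := by
  have : (rho01 r lab).comp (preAct A g) = (MulAut.conj g).toMonoidHom.comp (rho01 r lab) := by
    ext ⟨a, w⟩
    by_cases h : lab a = 2 <;> simp [rho01, preAct, h, mul_assoc]
  exact DFunLike.congr_fun this x

lemma Lambda_act (h : ∀ a, r a ∈ R (lab a)) (g : F) (x : Pi2 r) :
    Lambda h (pi2Act r g x) = I3Act R g (Lambda h x) := by
  apply I3.ext
  obtain ⟨z, hz, bz⟩ := exists_rep x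
  have hzi : PresentedGroup.mk (peifferRels r) (preAct A g z) =
      ((pi2Act r g x).toMul : RelPi2 r) := by
    rw [← actOne_mk, hz]; rfl
  refine Eq.trans ?_ (I3Incl_act R g (Lambda h x)).symm
  rw [I3Incl_Lambda h _ hzi, I3Incl_Lambda h x hz, rho0_preAct, rho01_preAct]
  simp only [QuotientGroup.mk_mul, QuotientGroup.mk_inv, comm]
  group

end Lambda
section Quadratic

open TensorProduct

variable (M : Type) [AddCommGroup M]

/-- The relations `a ⊗ b - b ⊗ a`. -/
def sp2Rel : Submodule ℤ (M ⊗[ℤ] M) :=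
  Submodule.span ℤ {x | ∃ a b : M, x = a ⊗ₜ[ℤ] b - b ⊗ₜ[ℤ] a}

/-- The symmetric square `SP²(M) = M ⊗ M / ⟨a ⊗ b - b ⊗ a⟩`. -/
abbrev SP2 : Type := (M ⊗[ℤ] M) ⧸ sp2Rel M

/-- The relations of Whitehead's functor `Γ`: `γ(-a) = γ(a)`, and
`γ(a + b) - γ(a) - γ(b)` is additive in `a` (hence bilinear). -/
def gamRel : Submodule ℤ (M →₀ ℤ) :=
  Submodule.span ℤ ({x | ∃ a : M, x = Finsupp.single (-a) 1 - Finsupp.single a 1} ∪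
    {x | ∃ a a' b : M, x =
      (Finsupp.single (a + a' + b) 1 - Finsupp.single (a + a') 1 - Finsupp.single b 1) -
      (Finsupp.single (a + b) 1 - Finsupp.single a 1 - Finsupp.single b 1) -
      (Finsupp.single (a' + b) 1 - Finsupp.single a' 1 - Finsupp.single b 1)})

/-- Whitehead's universal quadratic functor `Γ(M)`. -/
abbrev Gam : Type := (M →₀ ℤ) ⧸ gamRel M

/-- The augmentation `ℤ[M] → ℤ`. -/
def augA : AddMonoidAlgebra ℤ M →+* ℤ :=
  (AddMonoidAlgebra.lift ℤ ℤ M (1 : Multiplicative M →* ℤ)).toRingHom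

/-- The augmentation ideal `Δ(M)` of `ℤ[M]`. -/
def augIdeal : Ideal (AddMonoidAlgebra ℤ M) := RingHom.ker (augA M)

/-- `Δ(M)` as an abelian group. -/
abbrev augMod : Submodule ℤ (AddMonoidAlgebra ℤ M) := (augIdeal M).restrictScalars ℤ

/-- `Δ³(M)` as a subgroup of `Δ(M)`. -/
def augCube : Submodule ℤ (augMod M) :=
  ((augIdeal M ^ 3).restrictScalars ℤ).comap (augMod M).subtype

/-- `P₂(M) = Δ(M) / Δ³(M)`. -/
abbrev P2 : Type := augMod M ⧸ augCube M

variable {M} {M' M'' : Type} [AddCommGroup M'] [AddCommGroup M'']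

/-- The class `a · b` in `SP²(M)`. -/
def SP2.mk (a b : M) : SP2 M := (sp2Rel M).mkQ (a ⊗ₜ b)

/-- The universal quadratic map `γ : M → Γ(M)`. -/
def gam (a : M) : Gam M := (gamRel M).mkQ (Finsupp.single a 1)

lemma gam_neg (a : M) : gam (-a) = gam a := by
  rw [← sub_eq_zero]
  exact (Submodule.Quotient.mk_eq_zero _).2 (Submodule.subset_span (Or.inl ⟨a, rfl⟩))

lemma gam_add_add (a a' b : M) : gam (a + a' + b) - gam (a + a') - gam b =
    (gam (a + b) - gam a - gam b) + (gam (a' + b) - gam a' - gam b) := by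
  rw [← sub_eq_zero, ← sub_sub]
  exact (Submodule.Quotient.mk_eq_zero _).2 (Submodule.subset_span (Or.inr ⟨a, a', b, rfl⟩))

lemma SP2.mk_comm (a b : M) : SP2.mk a b = SP2.mk b a := by
  rw [← sub_eq_zero]
  exact (Submodule.Quotient.mk_eq_zero _).2 (Submodule.subset_span ⟨a, b, rfl⟩)

lemma SP2.hom_ext {f g : SP2 M →ₗ[ℤ] M'} (h : ∀ a b, f (SP2.mk a b) = g (SP2.mk a b)) :
    f = g := by
  apply Submodule.linearMap_qext
  apply TensorProduct.ext'
  exact h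

lemma Gam.hom_ext {f g : Gam M →ₗ[ℤ] M'} (h : ∀ a, f (gam a) = g (gam a)) :
    f = g := by
  apply Submodule.linearMap_qext
  apply Finsupp.lhom_ext'
  intro a
  apply LinearMap.ext_ring
  exact h a

/-- A symmetric bilinear map induces a map on `SP²`. -/
def SP2.lift (f : M →ₗ[ℤ] M →ₗ[ℤ] M') (h : ∀ a b, f a b = f b a) : SP2 M →ₗ[ℤ] M' :=
  (sp2Rel M).liftQ (TensorProduct.lift f) (Submodule.span_le.2 (by
    rintro _ ⟨a, b, rfl⟩
    change TensorProduct.lift f (a ⊗ₜ b - b ⊗ₜ a) = 0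
    rw [map_sub, sub_eq_zero]
    exact h a b))

@[simp] lemma SP2.lift_mk (f : M →ₗ[ℤ] M →ₗ[ℤ] M') (h : ∀ a b, f a b = f b a) (a b : M) :
    SP2.lift f h (SP2.mk a b) = f a b := rfl

/-- The bilinear map `(a, b) ↦ a · b`. -/
def SP2.mkHom : M →ₗ[ℤ] M →ₗ[ℤ] SP2 M := (TensorProduct.mk ℤ M M).compr₂ (sp2Rel M).mkQ

lemma SP2.mkHom_apply (a b : M) : SP2.mkHom a b = SP2.mk a b := rfl

/-- Functoriality of `SP²`. -/
def SP2.map (f : M →ₗ[ℤ] M') : SP2 M →ₗ[ℤ] SP2 M' :=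
  SP2.lift ((SP2.mkHom.comp f).compl₂ f) (fun a b => SP2.mk_comm (f a) (f b))

@[simp] lemma SP2.map_mk (f : M →ₗ[ℤ] M') (a b : M) :
    SP2.map f (SP2.mk a b) = SP2.mk (f a) (f b) := rfl

/-- A quadratic map induces a homomorphism on `Γ`. -/
def Gam.lift (f : M → M') (h₁ : ∀ a, f (-a) = f a)
    (h₂ : ∀ a a' b, f (a + a' + b) - f (a + a') - f b =
      (f (a + b) - f a - f b) + (f (a' + b) - f a' - f b)) : Gam M →ₗ[ℤ] M' :=
  (gamRel M).liftQ (Finsupp.linearCombination ℤ f) (Submodule.span_le.2 (by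
    rintro _ (⟨a, rfl⟩ | ⟨a, a', b, rfl⟩)
    · simp [h₁]
    · have := h₂ a a' b
      rw [← sub_eq_zero, ← sub_sub] at this
      simpa using this))

@[simp] lemma Gam.lift_gam (f : M → M') (h₁ h₂) (a : M) :
    Gam.lift f h₁ h₂ (gam a) = f a :=
  (Finsupp.linearCombination_single ℤ 1 a).trans (one_smul ℤ (f a))

/-- Functoriality of `Γ`. -/
def Gam.map (f : M →ₗ[ℤ] M') : Gam M →ₗ[ℤ] Gam M' :=
  Gam.lift (fun a => gam (f a)) (fun a => by rw [map_neg, gam_neg])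
    (fun a a' b => by simp only [map_add]; exact gam_add_add _ _ _)

@[simp] lemma Gam.map_gam (f : M →ₗ[ℤ] M') (a : M) : Gam.map f (gam a) = gam (f a) := by
  simp [Gam.map]

lemma gam_zero : gam (0 : M) = 0 := by
  have := gam_add_add (0 : M) 0 0
  simpa using this

lemma gam_add_add' (a b b' : M) : gam (a + (b + b')) - gam a - gam (b + b') =
    (gam (a + b) - gam a - gam b) + (gam (a + b') - gam a - gam b') := by
  have := gam_add_add b b' a
  rw [add_comm _ a, add_comm b a, add_comm b' a] at this
  rw [sub_right_comm, this]
  abel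

/-- The bilinear map `(a, b) ↦ γ(a + b) - γ(a) - γ(b)`. -/
def gamCross : M →ₗ[ℤ] M →ₗ[ℤ] Gam M :=
  LinearMap.mk₂ ℤ (fun a b => gam (a + b) - gam a - gam b) gam_add_add
    (fun n a b => map_zsmul (AddMonoidHom.mk' (fun a => gam (a + b) - gam a - gam b)
      (fun a a' => gam_add_add a a' b)) n a)
    gam_add_add'
    (fun n a b => map_zsmul (AddMonoidHom.mk' (fun b => gam (a + b) - gam a - gam b)
      (gam_add_add' a)) n b)

lemma gamCross_apply (a b : M) : gamCross a b = gam (a + b) - gam a - gam b := rfl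

/-- The natural map `SP²(M) → Γ(M)`, `a · b ↦ γ(a + b) - γ(a) - γ(b)`. -/
def sp2ToGam : SP2 M →ₗ[ℤ] Gam M :=
  SP2.lift gamCross (fun a b => by
    simp only [gamCross_apply, add_comm a b]; abel)

@[simp] lemma sp2ToGam_mk (a b : M) : sp2ToGam (SP2.mk a b) = gam (a + b) - gam a - gam b :=
  rfl

/-- The group element `[a] ∈ ℤ[M]`. -/
abbrev grp (a : M) : AddMonoidAlgebra ℤ M := AddMonoidAlgebra.single a 1

@[simp] lemma augA_single (a : M) (n : ℤ) : augA M (AddMonoidAlgebra.single a n) = n := by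
  simp [augA]

lemma grp_sub_one_mem (a : M) : grp a - 1 ∈ augIdeal M := by
  simp [augIdeal, RingHom.mem_ker]

/-- The class of `[a] - 1` in `Δ(M)`. -/
def dlt (a : M) : augMod M := ⟨grp a - 1, grp_sub_one_mem a⟩

lemma alg_hom_ext {M M' : Type} [AddCommGroup M'] {f g : AddMonoidAlgebra ℤ M →ₗ[ℤ] M'} (h : ∀ a, f (grp a) = g (grp a)) :
    f = g := by
  apply AddMonoidAlgebra.lhom_ext'
  intro a
  apply LinearMap.ext_ring
  exact h a

/-- The projection `ℤ[M] → Δ(M)`, `x ↦ x - ε(x)`. -/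
def toAug : AddMonoidAlgebra ℤ M →ₗ[ℤ] augMod M :=
  ((LinearMap.id - (augA M).toIntAlgHom.toLinearMap.smulRight (1 : AddMonoidAlgebra ℤ M))).codRestrict
    _ (fun x => by simp [augIdeal, RingHom.mem_ker])

lemma toAug_grp (a : M) : toAug (grp a) = dlt a := by
  apply Subtype.ext
  simp [toAug, dlt]

lemma toAug_coe (x : augMod M) : toAug (x : AddMonoidAlgebra ℤ M) = x := by
  apply Subtype.ext
  have : augA M x = 0 := x.2
  simp [toAug, this]

lemma aug_hom_ext {f g : augMod M →ₗ[ℤ] M'} (h : ∀ a, f (dlt a) = g (dlt a)) : f = g := by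
  have : f.comp toAug = g.comp toAug := alg_hom_ext fun a => by simp [toAug_grp, h]
  ext x
  rw [← toAug_coe x]
  exact DFunLike.congr_fun this (x : AddMonoidAlgebra ℤ M)

/-- `Δ(M) → M`, `[a] - 1 ↦ a`, on all of `ℤ[M]`. -/
def sumA : AddMonoidAlgebra ℤ M →ₗ[ℤ] M :=
  (Finsupp.linearCombination ℤ (fun a : M => a)).comp
    (AddMonoidAlgebra.coeffLinearEquiv ℤ).toLinearMap

@[simp] lemma sumA_grp (a : M) : sumA (grp a) = a := by
  simp [sumA]

end Quadratic
section QuadraticExact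

open TensorProduct

variable {M M' : Type} [AddCommGroup M] [AddCommGroup M']

lemma one_eq_grp : (1 : AddMonoidAlgebra ℤ M) = grp 0 := rfl

lemma grp_mul (a b : M) : grp a * grp b = grp (a + b) := by
  simp [AddMonoidAlgebra.single_mul_single]

lemma dlt_mul (a b : M) : (grp a - 1) * (grp b - 1) = grp (a + b) - grp a - grp b + 1 := by
  rw [sub_mul, mul_sub, grp_mul]; ring

lemma sumA_mul_aug (x y : augMod M) :
    sumA ((x : AddMonoidAlgebra ℤ M) * (y : AddMonoidAlgebra ℤ M)) = 0 := by
  have : ((LinearMap.mul ℤ (AddMonoidAlgebra ℤ M)).compr₂ sumA).compl₁₂ (augMod M).subtype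
      (augMod M).subtype = 0 := by
    apply aug_hom_ext; intro a
    apply aug_hom_ext; intro b
    change sumA ((grp a - 1) * (grp b - 1)) = 0
    rw [dlt_mul, one_eq_grp]
    simp only [map_add, map_sub, sumA_grp]
    abel
  exact DFunLike.congr_fun (DFunLike.congr_fun this x) y

lemma sumA_sq {x : AddMonoidAlgebra ℤ M} (hx : x ∈ augIdeal M ^ 2) : sumA x = 0 := by
  rw [pow_two] at hx
  induction hx using Submodule.mul_induction_on' with
  | mem_mul_mem x hx y hy => exact sumA_mul_aug ⟨x, hx⟩ ⟨y, hy⟩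
  | add x _ y _ hx hy => rw [map_add, hx, hy, add_zero]

/-- The projection `P₂(M) → M`, `[a] - 1 ↦ a`. -/
def p2ToM : P2 M →ₗ[ℤ] M :=
  (augCube M).liftQ (sumA.comp (augMod M).subtype) (fun x hx => by
    refine sumA_sq (x := (x : AddMonoidAlgebra ℤ M)) ?_
    exact Ideal.pow_le_pow_right (by norm_num : 2 ≤ 3) hx)

/-- The class of `[a] - 1` in `P₂(M)`. -/
def p2 (a : M) : P2 M := (augCube M).mkQ (dlt a)

lemma p2_hom_ext {f g : P2 M →ₗ[ℤ] M'} (h : ∀ a, f (p2 a) = g (p2 a)) : f = g := by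
  apply Submodule.linearMap_qext
  exact aug_hom_ext h

lemma p2ToM_p2 (a : M) : p2ToM (p2 a) = a := by
  change sumA (grp a - 1) = a
  rw [one_eq_grp, map_sub, sumA_grp, sumA_grp, sub_zero]

/-- The class of `([a] - 1)([b] - 1)` in `P₂(M)`. -/
lemma p2_mul_eq (a b : M) : p2 (a + b) - p2 a - p2 b =
    (augCube M).mkQ ⟨(grp a - 1) * (grp b - 1),
      (augIdeal M).mul_mem_left _ (grp_sub_one_mem b)⟩ := by
  rw [p2, p2, p2, ← map_sub, ← map_sub]
  congr 1
  apply Subtype.ext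
  change (grp (a + b) - 1) - (grp a - 1) - (grp b - 1) = (grp a - 1) * (grp b - 1)
  rw [dlt_mul]; abel

lemma p2_add_add (a a' b : M) : p2 (a + a' + b) - p2 (a + a') - p2 b =
    (p2 (a + b) - p2 a - p2 b) + (p2 (a' + b) - p2 a' - p2 b) := by
  rw [p2_mul_eq, p2_mul_eq, p2_mul_eq, ← map_add, ← sub_eq_zero, ← map_sub]
  refine (Submodule.Quotient.mk_eq_zero _).2 ?_
  change (grp (a + a') - 1) * (grp b - 1) - ((grp a - 1) * (grp b - 1) +
    (grp a' - 1) * (grp b - 1)) ∈ augIdeal M ^ 3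
  have : (grp (a + a') - 1) * (grp b - 1) - ((grp a - 1) * (grp b - 1) +
    (grp a' - 1) * (grp b - 1)) = (grp a - 1) * (grp a' - 1) * (grp b - 1) := by
    rw [← grp_mul]; ring
  rw [this, pow_succ, pow_two]
  exact Ideal.mul_mem_mul (Ideal.mul_mem_mul (grp_sub_one_mem a) (grp_sub_one_mem a'))
    (grp_sub_one_mem b)

lemma p2_add_add' (a b b' : M) : p2 (a + (b + b')) - p2 a - p2 (b + b') =
    (p2 (a + b) - p2 a - p2 b) + (p2 (a + b') - p2 a - p2 b') := by
  have := p2_add_add b b' a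
  rw [add_comm _ a, add_comm b a, add_comm b' a] at this
  rw [sub_right_comm, this]
  abel

/-- The bilinear map `(a, b) ↦ ([a] - 1)([b] - 1)` to `P₂(M)`. -/
def p2Cross : M →ₗ[ℤ] M →ₗ[ℤ] P2 M :=
  LinearMap.mk₂ ℤ (fun a b => p2 (a + b) - p2 a - p2 b) p2_add_add
    (fun n a b => map_zsmul (AddMonoidHom.mk' (fun a => p2 (a + b) - p2 a - p2 b)
      (fun a a' => p2_add_add a a' b)) n a)
    p2_add_add'
    (fun n a b => map_zsmul (AddMonoidHom.mk' (fun b => p2 (a + b) - p2 a - p2 b)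
      (p2_add_add' a)) n b)

/-- The natural map `SP²(M) → P₂(M)`, `a · b ↦ ([a] - 1)([b] - 1) = [a + b] - [a] - [b] + 1`. -/
def sp2ToP2 : SP2 M →ₗ[ℤ] P2 M :=
  SP2.lift p2Cross (fun a b => by
    change p2 (a + b) - p2 a - p2 b = p2 (b + a) - p2 b - p2 a
    rw [add_comm a b]; abel)

lemma sp2ToP2_mk (a b : M) : sp2ToP2 (SP2.mk a b) = p2 (a + b) - p2 a - p2 b := rfl

/-- The extension of `M` by `SP²(M)` with cocycle `(a, b) ↦ a · b`. -/
structure QExt (M : Type) [AddCommGroup M] where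
  /-- the component in `SP²(M)` -/
  s : SP2 M
  /-- the component in `M` -/
  m : M

namespace QExt

instance : Add (QExt M) := ⟨fun x y => ⟨x.s + y.s + SP2.mk x.m y.m, x.m + y.m⟩⟩
instance : Zero (QExt M) := ⟨⟨0, 0⟩⟩
instance : Neg (QExt M) := ⟨fun x => ⟨-x.s + SP2.mk x.m x.m, -x.m⟩⟩

lemma ext' {x y : QExt M} (h₁ : x.s = y.s) (h₂ : x.m = y.m) : x = y := by
  cases x; cases y; simp_all

lemma add_s (x y : QExt M) : (x + y).s = x.s + y.s + SP2.mk x.m y.m := rfl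
lemma add_m (x y : QExt M) : (x + y).m = x.m + y.m := rfl

lemma mk_add_left (a a' b : M) : SP2.mk (a + a') b = SP2.mk a b + SP2.mk a' b := by
  simp only [← SP2.mkHom_apply, map_add, LinearMap.add_apply]
lemma mk_add_right (a b b' : M) : SP2.mk a (b + b') = SP2.mk a b + SP2.mk a b' := by
  simp only [← SP2.mkHom_apply, map_add]
lemma mk_zero_left (b : M) : SP2.mk 0 b = 0 := by
  simp only [← SP2.mkHom_apply, map_zero, LinearMap.zero_apply]
lemma mk_neg_left (a b : M) : SP2.mk (-a) b = -SP2.mk a b := by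
  simp only [← SP2.mkHom_apply, map_neg, LinearMap.neg_apply]

instance : AddCommGroup (QExt M) where
  add_assoc x y z := ext' (by simp only [add_s, add_m, mk_add_left, mk_add_right]; abel)
    (add_assoc _ _ _)
  zero_add x := ext' (by
      change 0 + x.s + SP2.mk 0 x.m = x.s
      rw [mk_zero_left]; abel) (zero_add _)
  add_zero x := ext' (by
      change x.s + 0 + SP2.mk x.m 0 = x.s
      rw [SP2.mk_comm, mk_zero_left]; abel) (add_zero _)
  neg_add_cancel x := ext' (by
      change -x.s + SP2.mk x.m x.m + x.s + SP2.mk (-x.m) x.m = 0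
      rw [mk_neg_left]; abel) (neg_add_cancel _)
  add_comm x y := ext' (by
      simp only [add_s]; rw [SP2.mk_comm]; abel) (add_comm _ _)
  nsmul := nsmulRec
  zsmul := zsmulRec

/-- The inclusion of `SP²(M)`. -/
def inl : SP2 M →ₗ[ℤ] QExt M :=
  (AddMonoidHom.mk' (fun s => (⟨s, 0⟩ : QExt M)) (fun s t => ext' (by
    change s + t = s + t + SP2.mk 0 0
    rw [mk_zero_left, add_zero]) (add_zero 0).symm)).toIntLinearMap

lemma inl_injective : Function.Injective (inl : SP2 M → QExt M) := fun _ _ h =>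
  congrArg QExt.s h

/-- The map `ℤ[M] → QExt M`, `[a] ↦ (0, a)`. -/
def tau : AddMonoidAlgebra ℤ M →ₗ[ℤ] QExt M :=
  (Finsupp.linearCombination ℤ (fun a : M => (⟨0, a⟩ : QExt M))).comp
    (AddMonoidAlgebra.coeffLinearEquiv ℤ).toLinearMap

lemma tau_grp (a : M) : tau (grp a) = ⟨0, a⟩ := by
  simp [tau]

lemma tau_mul (x y : augMod M) :
    tau ((x : AddMonoidAlgebra ℤ M) * (y : AddMonoidAlgebra ℤ M)) =
      -inl (SP2.mk (sumA (x : AddMonoidAlgebra ℤ M)) (sumA (y : AddMonoidAlgebra ℤ M))) := by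
  have : ((LinearMap.mul ℤ (AddMonoidAlgebra ℤ M)).compr₂ tau).compl₁₂ (augMod M).subtype
      (augMod M).subtype = -((SP2.mkHom.compr₂ inl).compl₁₂ (sumA.comp (augMod M).subtype)
      (sumA.comp (augMod M).subtype)) := by
    apply aug_hom_ext; intro a
    apply aug_hom_ext; intro b
    change tau ((grp a - 1) * (grp b - 1)) =
      -inl (SP2.mk (sumA (grp a - 1)) (sumA (grp b - 1)))
    rw [dlt_mul, one_eq_grp, map_sub, map_sub]
    simp only [map_add, map_sub, sumA_grp, tau_grp, sub_zero]
    rw [eq_neg_iff_add_eq_zero]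
    have h0 : (⟨0, 0⟩ : QExt M) = 0 := rfl
    have h1 : (⟨0, a⟩ : QExt M) + ⟨0, b⟩ = inl (SP2.mk a b) + ⟨0, a + b⟩ := ext' (by
      change 0 + 0 + SP2.mk a b = SP2.mk a b + 0 + SP2.mk 0 (a + b)
      rw [mk_zero_left]; abel) (by
      change a + b = 0 + (a + b)
      rw [zero_add])
    rw [h0, add_zero, sub_sub, h1]
    abel
  exact DFunLike.congr_fun (DFunLike.congr_fun this x) y

lemma tau_cube {x : AddMonoidAlgebra ℤ M} (hx : x ∈ augIdeal M ^ 3) : tau x = 0 := by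
  rw [pow_succ] at hx
  induction hx using Submodule.mul_induction_on' with
  | mem_mul_mem x hx y hy =>
    have h := tau_mul ⟨x, Ideal.pow_le_self (by norm_num) hx⟩ ⟨y, hy⟩
    refine h.trans ?_
    change -inl (SP2.mk (sumA x) _) = 0
    rw [sumA_sq hx, mk_zero_left, map_zero, neg_zero]
  | add x _ y _ hx hy => rw [map_add, hx, hy, add_zero]

/-- The induced map on `P₂(M)`. -/
def ofP2 : P2 M →ₗ[ℤ] QExt M :=
  (augCube M).liftQ (tau.comp (augMod M).subtype) (fun _ hx => tau_cube hx)

lemma ofP2_sp2 (x : SP2 M) : ofP2 (sp2ToP2 x) = -inl x := by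
  have : ofP2.comp sp2ToP2 = -(inl : SP2 M →ₗ[ℤ] QExt M) := by
    apply SP2.hom_ext
    intro a b
    change ofP2 (p2 (a + b) - p2 a - p2 b) = -inl (SP2.mk a b)
    rw [p2_mul_eq]
    refine (tau_mul (dlt a) (dlt b)).trans ?_
    change -inl (SP2.mk (sumA (grp a - 1)) (sumA (grp b - 1))) = _
    rw [one_eq_grp]
    simp only [map_sub, sumA_grp, sub_zero]
  exact DFunLike.congr_fun this x

end QExt

lemma sp2ToP2_injective : Function.Injective (sp2ToP2 : SP2 M → P2 M) := by
  intro x y h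
  apply QExt.inl_injective
  have := congrArg QExt.ofP2 h
  rwa [QExt.ofP2_sp2, QExt.ofP2_sp2, neg_inj] at this

lemma p2ToM_surjective : Function.Surjective (p2ToM : P2 M → M) := fun a => ⟨p2 a, p2ToM_p2 a⟩

lemma p2_exact : Function.Exact (sp2ToP2 : SP2 M →ₗ[ℤ] P2 M) (p2ToM : P2 M →ₗ[ℤ] M) := by
  rw [LinearMap.exact_iff]
  apply le_antisymm
  · intro x hx
    let q := (LinearMap.range (sp2ToP2 : SP2 M →ₗ[ℤ] P2 M)).mkQ
    let s : M →ₗ[ℤ] P2 M ⧸ LinearMap.range (sp2ToP2 : SP2 M →ₗ[ℤ] P2 M) :=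
      (AddMonoidHom.mk' (fun a => q (p2 a)) (fun a b => by
        rw [← map_add, ← sub_eq_zero, ← map_sub]
        refine (Submodule.Quotient.mk_eq_zero _).2 ⟨SP2.mk a b, ?_⟩
        rw [sp2ToP2_mk]; abel)).toIntLinearMap
    have : q = s.comp p2ToM := by
      apply p2_hom_ext
      intro a
      change q (p2 a) = q (p2 (p2ToM (p2 a)))
      rw [p2ToM_p2]
    have h := DFunLike.congr_fun this x
    rw [LinearMap.comp_apply, LinearMap.mem_ker.1 hx, map_zero] at h
    exact (Submodule.Quotient.mk_eq_zero _).1 h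
  · rintro _ ⟨x, rfl⟩
    have : p2ToM.comp sp2ToP2 = (0 : SP2 M →ₗ[ℤ] M) := by
      apply SP2.hom_ext
      intro a b
      change p2ToM (p2 (a + b) - p2 a - p2 b) = 0
      simp only [map_sub, p2ToM_p2]
      abel
    exact DFunLike.congr_fun this x

/-- Functoriality of `ℤ[M]`. -/
def algMap (f : M →ₗ[ℤ] M') : AddMonoidAlgebra ℤ M →+* AddMonoidAlgebra ℤ M' :=
  AddMonoidAlgebra.mapDomainRingHom ℤ f.toAddMonoidHom

@[simp] lemma algMap_grp (f : M →ₗ[ℤ] M') (a : M) : algMap f (grp a) = grp (f a) := by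
  simp [algMap]

lemma augA_algMap (f : M →ₗ[ℤ] M') (x : AddMonoidAlgebra ℤ M) :
    augA M' (algMap f x) = augA M x := by
  have : ((augA M').comp (algMap f)).toIntAlgHom.toLinearMap =
      (augA M).toIntAlgHom.toLinearMap := by
    apply alg_hom_ext; intro a
    change augA M' (algMap f (grp a)) = augA M (grp a)
    simp
  exact DFunLike.congr_fun this x

lemma algMap_aug (f : M →ₗ[ℤ] M') : augIdeal M ≤ (augIdeal M').comap (algMap f) := by
  intro x hx
  have h : augA M x = 0 := hx
  change augA M' (algMap f x) = 0
  rw [augA_algMap, h]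

/-- Functoriality of `Δ`. -/
def augMap (f : M →ₗ[ℤ] M') : augMod M →ₗ[ℤ] augMod M' :=
  ((algMap f).toIntAlgHom.toLinearMap).restrict (fun _ hx => algMap_aug f hx)

/-- Functoriality of `P₂`. -/
def P2.map (f : M →ₗ[ℤ] M') : P2 M →ₗ[ℤ] P2 M' :=
  (augCube M).mapQ (augCube M') (augMap f) (fun x hx => by
    change algMap f x ∈ augIdeal M' ^ 3
    have h : (x : AddMonoidAlgebra ℤ M) ∈ augIdeal M ^ 3 := hx
    have h2 : (augIdeal M ^ 3).map (algMap f) ≤ augIdeal M' ^ 3 := by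
      rw [Ideal.map_pow]
      exact Ideal.pow_right_mono (Ideal.map_le_iff_le_comap.2 (algMap_aug f)) 3
    exact h2 (Ideal.mem_map_of_mem _ h))

lemma P2.map_p2 (f : M →ₗ[ℤ] M') (a : M) : P2.map f (p2 a) = p2 (f a) := by
  change (augCube M').mkQ (augMap f (dlt a)) = (augCube M').mkQ (dlt (f a))
  congr 1
  apply Subtype.ext
  change algMap f (grp a - 1) = grp (f a) - 1
  rw [map_sub, map_one, algMap_grp]

end QuadraticExact

section QuadraticRep

open CategoryTheory

variable {G : Type} [Group G] {M : Type} [AddCommGroup M] (ρ : Representation ℤ G M)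

/-- The diagonal action on `SP²(M)`. -/
def sp2Rep : Representation ℤ G (SP2 M) where
  toFun g := SP2.map (ρ g)
  map_one' := by
    apply SP2.hom_ext; intro a b
    rw [SP2.map_mk, map_one]; rfl
  map_mul' g h := by
    apply SP2.hom_ext; intro a b
    rw [Module.End.mul_apply, SP2.map_mk, SP2.map_mk, SP2.map_mk, map_mul]; rfl

/-- The induced action on `Γ(M)`. -/
def gamRep : Representation ℤ G (Gam M) where
  toFun g := Gam.map (ρ g)
  map_one' := by
    apply Gam.hom_ext; intro a
    rw [Gam.map_gam, map_one]; rfl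
  map_mul' g h := by
    apply Gam.hom_ext; intro a
    rw [Module.End.mul_apply, Gam.map_gam, Gam.map_gam, Gam.map_gam, map_mul]; rfl

/-- The induced action on `P₂(M)`. -/
def p2Rep : Representation ℤ G (P2 M) where
  toFun g := P2.map (ρ g)
  map_one' := by
    apply p2_hom_ext; intro a
    rw [P2.map_p2, map_one]; rfl
  map_mul' g h := by
    apply p2_hom_ext; intro a
    rw [Module.End.mul_apply, P2.map_p2, P2.map_p2, P2.map_p2, map_mul]; rfl

/-- A `G`-equivariant linear map as a morphism of representations. -/
def equivHom {V W : Type} [AddCommGroup V] [AddCommGroup W] (ρ : Representation ℤ G V)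
    (σ : Representation ℤ G W) (f : V →ₗ[ℤ] W) (h : ∀ g v, f (ρ g v) = σ g (f v)) :
    Rep.of ρ ⟶ Rep.of σ :=
  Rep.ofHom (f.intertwiningMap_of_isIntertwiningMap ρ σ h)

/-- Exactness in `Rep k G` on elements. -/
lemma rep_exact_of {k G : Type} [CommRing k] [Group G] (S : ShortComplex (Rep.{0} k G))
    (h : ∀ x : S.X₂, S.g.hom x = 0 → ∃ y : S.X₁, S.f.hom y = x) : S.Exact := by
  rw [← ShortComplex.exact_map_iff_of_faithful _ (forget₂ (Rep.{0} k G) (ModuleCat.{0} k))]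
  rw [ShortComplex.moduleCat_exact_iff]
  exact h

/-- A short exact sequence of `G`-modules from a short exact sequence of abelian groups and
equivariant maps. -/
lemma shortExact_of {V W U : Type} [AddCommGroup V] [AddCommGroup W] [AddCommGroup U]
    {ρ : Representation ℤ G V} {σ : Representation ℤ G W} {τ : Representation ℤ G U}
    {f : V →ₗ[ℤ] W} {g : W →ₗ[ℤ] U} (hf : ∀ x v, f (ρ x v) = σ x (f v))
    (hg : ∀ x v, g (σ x v) = τ x (g v)) (hi : Function.Injective f)
    (he : Function.Exact f g) (hs : Function.Surjective g)
    (w : equivHom ρ σ f hf ≫ equivHom σ τ g hg = 0) :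
    (ShortComplex.mk (equivHom ρ σ f hf) (equivHom σ τ g hg) w).ShortExact where
  exact := rep_exact_of _ fun x hx => (he x).1 hx
  mono_f := (Rep.mono_iff_injective _).2 hi
  epi_g := (Rep.epi_iff_surjective _).2 hs

lemma equivHom_comp_zero {V W U : Type} [AddCommGroup V] [AddCommGroup W] [AddCommGroup U]
    {ρ : Representation ℤ G V} {σ : Representation ℤ G W} {τ : Representation ℤ G U}
    {f : V →ₗ[ℤ] W} {g : W →ₗ[ℤ] U} (hf : ∀ x v, f (ρ x v) = σ x (f v))
    (hg : ∀ x v, g (σ x v) = τ x (g v)) (he : Function.Exact f g) :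
    equivHom ρ σ f hf ≫ equivHom σ τ g hg = 0 := by
  ext x
  exact (he (f x)).2 ⟨x, rfl⟩

/-- The short complex of `G`-modules given by equivariant maps with `Exact f g`. -/
def exactComplex {V W U : Type} [AddCommGroup V] [AddCommGroup W] [AddCommGroup U]
    (ρ : Representation ℤ G V) (σ : Representation ℤ G W) (τ : Representation ℤ G U)
    (f : V →ₗ[ℤ] W) (g : W →ₗ[ℤ] U) (hf : ∀ x v, f (ρ x v) = σ x (f v))
    (hg : ∀ x v, g (σ x v) = τ x (g v)) (he : Function.Exact f g) : ShortComplex (Rep ℤ G) :=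
  ShortComplex.mk (equivHom ρ σ f hf) (equivHom σ τ g hg) (equivHom_comp_zero hf hg he)

lemma sp2ToP2_equivariant (g : G) (x : SP2 M) :
    sp2ToP2 (sp2Rep ρ g x) = p2Rep ρ g (sp2ToP2 x) := by
  have : sp2ToP2.comp (SP2.map (ρ g)) = (P2.map (ρ g)).comp sp2ToP2 := by
    apply SP2.hom_ext; intro a b
    simp only [LinearMap.comp_apply, SP2.map_mk, sp2ToP2_mk, map_sub, P2.map_p2, map_add]
  exact DFunLike.congr_fun this x

lemma p2ToM_equivariant (g : G) (x : P2 M) : p2ToM (p2Rep ρ g x) = ρ g (p2ToM x) := by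
  have : p2ToM.comp (P2.map (ρ g)) = (ρ g).comp p2ToM := by
    apply p2_hom_ext; intro a
    rw [LinearMap.comp_apply, LinearMap.comp_apply, P2.map_p2, p2ToM_p2, p2ToM_p2]
  exact DFunLike.congr_fun this x

lemma sp2ToGam_equivariant (g : G) (x : SP2 M) :
    sp2ToGam (sp2Rep ρ g x) = gamRep ρ g (sp2ToGam x) := by
  have : sp2ToGam.comp (SP2.map (ρ g)) = (Gam.map (ρ g)).comp sp2ToGam := by
    apply SP2.hom_ext; intro a b
    simp only [LinearMap.comp_apply, SP2.map_mk, sp2ToGam_mk, map_sub, Gam.map_gam, map_add]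
  exact DFunLike.congr_fun this x

/-- The sequence of `G`-modules `0 → SP²(M) → P₂(M) → M → 0`. -/
def p2Seq : ShortComplex (Rep ℤ G) :=
  exactComplex (sp2Rep ρ) (p2Rep ρ) ρ sp2ToP2 p2ToM (sp2ToP2_equivariant ρ)
    (p2ToM_equivariant ρ) p2_exact

lemma p2Seq_shortExact : (p2Seq ρ).ShortExact :=
  shortExact_of _ _ sp2ToP2_injective p2_exact p2ToM_surjective _

/-- The morphism of `G`-modules `SP²(M) → Γ(M)`. -/
def sp2ToGamHom : Rep.of (sp2Rep ρ) ⟶ Rep.of (gamRep ρ) :=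
  equivHom _ _ sp2ToGam (sp2ToGam_equivariant ρ)

end QuadraticRep
section FreeModules

variable {G : Type} [Group G]

/-- The free `ℤ[G]`-module on a set `S`, with `ℤ`-basis `g · s` for `(s, g) ∈ S × G`. -/
def freeRep (S : Type) : Representation ℤ G (S × G →₀ ℤ) where
  toFun g := Finsupp.lmapDomain ℤ ℤ (fun p => (p.1, g * p.2))
  map_one' := by ext; simp
  map_mul' g h := by ext; simp [mul_assoc]

@[simp] lemma freeRep_single {S : Type} (g : G) (s : S) (h : G) (n : ℤ) :
    freeRep S g (Finsupp.single (s, h) n) = Finsupp.single (s, g * h) n := by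
  simp [freeRep]

/-- The group ring `ℤ[G]` as a left module over itself. -/
def regRep (G : Type) [Group G] : Representation ℤ G (G →₀ ℤ) where
  toFun g := Finsupp.lmapDomain ℤ ℤ (fun h => g * h)
  map_one' := by ext; simp
  map_mul' g h := by ext; simp [mul_assoc]

@[simp] lemma regRep_single (g h : G) (n : ℤ) :
    regRep G g (Finsupp.single h n) = Finsupp.single (g * h) n := by
  simp [regRep]

lemma finsupp_hom_ext {S V : Type} [AddCommGroup V] {f g : (S →₀ ℤ) →ₗ[ℤ] V}
    (h : ∀ s, f (Finsupp.single s 1) = g (Finsupp.single s 1)) : f = g := by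
  apply Finsupp.lhom_ext'
  intro s
  exact LinearMap.ext_ring (h s)

/-- The action on the kernel of an equivariant map. -/
def kerRep {V W : Type} [AddCommGroup V] [AddCommGroup W] (ρ : Representation ℤ G V)
    (σ : Representation ℤ G W) (f : V →ₗ[ℤ] W) (h : ∀ g v, f (ρ g v) = σ g (f v)) :
    Representation ℤ G (LinearMap.ker f) :=
  ρ.subrepresentation (LinearMap.ker f) (fun g v hv => by
    have hv' : f v = 0 := hv
    change f (ρ g v) = 0
    rw [h, hv', map_zero])

end FreeModules

section Fox

variable {X : Type} {G : Type} [Group G] {V : Type} [AddCommGroup V]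

/-- The affine action `x · u = ρ(x) u + v(x)` of the free group on `X`. -/
def affine (π : FreeGroup X →* G) (ρ : Representation ℤ G V) (v : X → V) :
    FreeGroup X →* Equiv.Perm V :=
  FreeGroup.lift fun x =>
    { toFun := fun u => ρ (π (FreeGroup.of x)) u + v x
      invFun := fun u => ρ (π (FreeGroup.of x))⁻¹ (u - v x)
      left_inv := fun u => by simp
      right_inv := fun u => by simp }

lemma affine_of (π : FreeGroup X →* G) (ρ : Representation ℤ G V) (v : X → V) (x : X) (u : V) :
    affine π ρ v (FreeGroup.of x) u = ρ (π (FreeGroup.of x)) u + v x := by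
  simp [affine]

lemma affine_apply (π : FreeGroup X →* G) (ρ : Representation ℤ G V) (v : X → V)
    (w : FreeGroup X) (u : V) : affine π ρ v w u = ρ (π w) u + affine π ρ v w 0 := by
  induction w using FreeGroup.induction_on generalizing u with
  | C1 => simp
  | of x => simp [affine_of]
  | inv_of x _ =>
    have key : ∀ u, affine π ρ v (FreeGroup.of x)⁻¹ u = ρ (π (FreeGroup.of x))⁻¹ (u - v x) := by
      intro u
      rw [map_inv, Equiv.Perm.inv_eq_iff_eq, affine_of]
      simp
    rw [key, key]; simp [sub_eq_add_neg]
  | mul x y hx hy =>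
    rw [map_mul, Equiv.Perm.mul_apply, Equiv.Perm.mul_apply, hx, hy u, hx (affine π ρ v y 0)]
    simp [add_assoc]

/-- The crossed homomorphism `D : FreeGroup X → V` with given values `v` on the basis:
`D(x) = v(x)` and `D(u w) = D(u) + u · D(w)`. -/
def der (π : FreeGroup X →* G) (ρ : Representation ℤ G V) (v : X → V) (w : FreeGroup X) : V :=
  affine π ρ v w 0

variable (π : FreeGroup X →* G) (ρ : Representation ℤ G V) (v : X → V)

lemma der_of (x : X) : der π ρ v (FreeGroup.of x) = v x := by simp [der, affine_of]

lemma der_one : der π ρ v 1 = 0 := by simp [der]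

lemma der_mul (u w : FreeGroup X) : der π ρ v (u * w) = der π ρ v u + ρ (π u) (der π ρ v w) := by
  rw [der, map_mul, Equiv.Perm.mul_apply, affine_apply, add_comm]; rfl

lemma der_inv (u : FreeGroup X) : der π ρ v u⁻¹ = -ρ (π u)⁻¹ (der π ρ v u) := by
  have := der_mul π ρ v u⁻¹ u
  rw [inv_mul_cancel, der_one, map_inv] at this
  exact eq_neg_of_add_eq_zero_left this.symm

lemma der_conj (u n : FreeGroup X) (hn : π n = 1) :
    der π ρ v (u * n * u⁻¹) = ρ (π u) (der π ρ v n) := by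
  rw [der_mul, der_mul, der_inv, map_mul, hn, mul_one, map_neg, ← Module.End.mul_apply, ← map_mul,
    mul_inv_cancel, map_one]
  simp

end Fox

section Chains

variable {X A : Type} (r : A → FreeGroup X) (N : Subgroup (FreeGroup X)) [N.Normal]

/-- The `1`-chains `C₁(K̃)` of the universal cover: the free `ℤ[F/N]`-module on the 1-cells. -/
abbrev C1 : Type := X × (FreeGroup X ⧸ N) →₀ ℤ

/-- The `2`-chains `C₂(K̃)` of the universal cover: the free `ℤ[F/N]`-module on the 2-cells. -/
abbrev C2 (A : Type) {X : Type} (N : Subgroup (FreeGroup X)) : Type := A × (FreeGroup X ⧸ N) →₀ ℤ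

/-- The Fox derivative `D : F → C₁(K̃)`, `D(x) = e_x`, `D(u w) = D(u) + u D(w)`. -/
def fox (w : FreeGroup X) : C1 N :=
  der (QuotientGroup.mk' N) (freeRep X) (fun x => Finsupp.single (x, 1) 1) w

/-- The boundary `C₂(K̃) → C₁(K̃)`, sending the cell `e_a` to the Fox derivative of `r_a`. -/
def d2 : C2 A N →ₗ[ℤ] C1 N :=
  Finsupp.linearCombination ℤ fun p => freeRep X p.2 (fox N (r p.1))

/-- The boundary `C₁(K̃) → C₀(K̃) = ℤ[F/N]`, `e_x ↦ x - 1`. -/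
def d1 : C1 N →ₗ[ℤ] (FreeGroup X ⧸ N →₀ ℤ) :=
  Finsupp.linearCombination ℤ fun p =>
    Finsupp.single (p.2 * (FreeGroup.of p.1 : FreeGroup X ⧸ N)) 1 - Finsupp.single p.2 1

/-- The augmentation `ℤ[G] → ℤ`. -/
def eps (G : Type) : (G →₀ ℤ) →ₗ[ℤ] ℤ := Finsupp.linearCombination ℤ fun _ => 1

lemma d2_single (a : A) (g : FreeGroup X ⧸ N) :
    d2 r N (Finsupp.single (a, g) 1) = freeRep X g (fox N (r a)) := by
  simp [d2]

lemma d1_single (x : X) (g : FreeGroup X ⧸ N) : d1 N (Finsupp.single (x, g) 1) =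
    Finsupp.single (g * (FreeGroup.of x : FreeGroup X ⧸ N)) 1 - Finsupp.single g 1 := by
  simp [d1]

lemma eps_single {G : Type} (g : G) (n : ℤ) : eps G (Finsupp.single g n) = n := by
  simp [eps]

lemma d2_equivariant (g : FreeGroup X ⧸ N) (z : C2 A N) :
    d2 r N (freeRep A g z) = freeRep X g (d2 r N z) := by
  have : (d2 r N).comp (freeRep A g) = (freeRep X g).comp (d2 r N) := by
    apply finsupp_hom_ext
    rintro ⟨a, h⟩
    simp only [LinearMap.comp_apply, freeRep_single, d2_single]
    rw [map_mul, Module.End.mul_apply]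
  exact DFunLike.congr_fun this z

lemma d1_equivariant (g : FreeGroup X ⧸ N) (z : C1 N) :
    d1 N (freeRep X g z) = regRep _ g (d1 N z) := by
  have : (d1 N).comp (freeRep X g) = (regRep _ g).comp (d1 N) := by
    apply finsupp_hom_ext
    rintro ⟨x, h⟩
    simp only [LinearMap.comp_apply, freeRep_single, d1_single, map_sub, regRep_single, mul_assoc]
  exact DFunLike.congr_fun this z

lemma eps_equivariant {G : Type} [Group G] (g : G) (z : G →₀ ℤ) :
    eps G (regRep G g z) = Representation.trivial ℤ G ℤ g (eps G z) := by
  have : (eps G).comp (regRep G g) = eps G := by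
    apply finsupp_hom_ext
    intro h
    simp only [LinearMap.comp_apply, regRep_single, eps_single]
  exact DFunLike.congr_fun this z

lemma fox_of (x : X) : fox N (FreeGroup.of x) = Finsupp.single (x, 1) 1 := der_of _ _ _ _

lemma fox_one : fox N 1 = 0 := der_one _ _ _

lemma fox_mul (u w : FreeGroup X) :
    fox N (u * w) = fox N u + freeRep X (u : FreeGroup X ⧸ N) (fox N w) := der_mul _ _ _ _ _

lemma fox_inv (u : FreeGroup X) :
    fox N u⁻¹ = -freeRep X (u : FreeGroup X ⧸ N)⁻¹ (fox N u) := der_inv _ _ _ _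

lemma fox_conj (u n : FreeGroup X) (hn : n ∈ N) :
    fox N (u * n * u⁻¹) = freeRep X (u : FreeGroup X ⧸ N) (fox N n) :=
  der_conj _ _ _ _ _ ((QuotientGroup.eq_one_iff n).2 hn)

/-- The fundamental formula `d₁ D(w) = w - 1`. -/
lemma d1_fox (w : FreeGroup X) :
    d1 N (fox N w) = Finsupp.single (w : FreeGroup X ⧸ N) 1 - Finsupp.single 1 1 := by
  induction w using FreeGroup.induction_on with
  | C1 => simp [fox_one]
  | of x => rw [fox_of, d1_single, one_mul]
  | inv_of x h =>
    rw [fox_inv, map_neg, d1_equivariant, h, map_sub, regRep_single, regRep_single]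
    simp
  | mul x y hx hy =>
    rw [fox_mul, map_add, d1_equivariant, hx, hy, map_sub, regRep_single, regRep_single]
    simp

variable {r N}

lemma d2_exact1 (hN : N = Subgroup.normalClosure (Set.range r)) (z : C1 N) (hz : d1 N z = 0) :
    ∃ y, d2 r N y = z := by
  let B := LinearMap.range (d2 r N)
  let ρ : Representation ℤ (FreeGroup X ⧸ N) (C1 N ⧸ B) := (freeRep X).quotient B (by
    rintro g _ ⟨y, rfl⟩
    exact ⟨freeRep A g y, d2_equivariant r N g y⟩)
  let D : FreeGroup X → C1 N ⧸ B := fun w => B.mkQ (fox N w)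
  have hD : ∀ u w, D (u * w) = D u + ρ (u : FreeGroup X ⧸ N) (D w) := by
    intro u w
    change B.mkQ (fox N (u * w)) = _
    rw [fox_mul, map_add]; rfl
  have hD1 : D 1 = 0 := by change B.mkQ (fox N 1) = 0; rw [fox_one, map_zero]
  have hDN : ∀ n ∈ N, D n = 0 := by
    intro n hn
    have : N ≤ { carrier := {n | D n = 0 ∧ n ∈ N}
                 one_mem' := ⟨hD1, one_mem N⟩
                 mul_mem' := fun {a b} ha hb => ⟨by rw [hD, ha.1, hb.1]; simp, mul_mem ha.2 hb.2⟩
                 inv_mem' := fun {a} ha => ⟨by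
                  have h := hD a a⁻¹
                  rw [mul_inv_cancel, hD1, ha.1, zero_add] at h
                  have h2 : (a : FreeGroup X ⧸ N) = 1 := (QuotientGroup.eq_one_iff a).2 ha.2
                  rw [h2, map_one] at h
                  exact h.symm, inv_mem ha.2⟩ : Subgroup (FreeGroup X) } := by
      conv_lhs => rw [hN]
      rw [Subgroup.normalClosure, Subgroup.closure_le]
      intro x hx
      obtain ⟨_, ⟨a, rfl⟩, hc⟩ := Group.mem_conjugatesOfSet_iff.1 hx
      obtain ⟨g, rfl⟩ := isConj_iff.1 hc
      have hr : r a ∈ N := hN ▸ Subgroup.subset_normalClosure (Set.mem_range_self a)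
      refine ⟨?_, ‹N.Normal›.conj_mem _ hr g⟩
      change B.mkQ (fox N (g * r a * g⁻¹)) = 0
      rw [fox_conj N g _ hr]
      refine (Submodule.Quotient.mk_eq_zero _).2 ⟨Finsupp.single (a, (g : FreeGroup X ⧸ N)) 1, ?_⟩
      rw [d2_single]
    exact (this hn).1
  let DG : FreeGroup X ⧸ N → C1 N ⧸ B := fun g => Quotient.liftOn' g D (by
    intro a b hab
    have h1 : a⁻¹ * b ∈ N := QuotientGroup.leftRel_apply.1 hab
    have h2 := hD a (a⁻¹ * b)
    rw [hDN _ h1, map_zero, add_zero, mul_inv_cancel_left] at h2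
    exact h2.symm)
  have hDG : ∀ w : FreeGroup X, DG (w : FreeGroup X ⧸ N) = D w := fun w => rfl
  let s : (FreeGroup X ⧸ N →₀ ℤ) →ₗ[ℤ] C1 N ⧸ B := Finsupp.linearCombination ℤ DG
  have hs : s.comp (d1 N) = B.mkQ := by
    apply finsupp_hom_ext
    rintro ⟨x, g⟩
    obtain ⟨w, rfl⟩ := QuotientGroup.mk_surjective g
    rw [LinearMap.comp_apply, d1_single, map_sub]
    simp only [s, Finsupp.linearCombination_single, one_smul]
    rw [← QuotientGroup.mk_mul, hDG, hDG, hD]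
    change D w + B.mkQ (freeRep X (w : FreeGroup X ⧸ N) (fox N (FreeGroup.of x))) - D w = _
    rw [fox_of, freeRep_single, mul_one]; abel
  have := DFunLike.congr_fun hs z
  rw [LinearMap.comp_apply, hz, map_zero] at this
  exact (Submodule.Quotient.mk_eq_zero _).1 this.symm

end Chains
section Hurewicz

variable {X A : Type} {r : A → FreeGroup X} {N : Subgroup (FreeGroup X)} [N.Normal]

lemma rel_mem (hN : N = Subgroup.normalClosure (Set.range r)) (a : A) : r a ∈ N :=
  hN ▸ Subgroup.subset_normalClosure (Set.mem_range_self a)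

lemma bd_mem_N (hN : N = Subgroup.normalClosure (Set.range r)) (c : RelPi2 r) : bd r c ∈ N :=
  hN ▸ bd_mem r c

/-- The relative Hurewicz map `π₂(K, K¹) → C₂(K̃)`, `e_a^w ↦ w · e_a`. -/
def hC (hN : N = Subgroup.normalClosure (Set.range r)) : RelPi2 r →* Multiplicative (C2 A N) :=
  PresentedGroup.toGroup (f := fun p : A × FreeGroup X =>
    Multiplicative.ofAdd (Finsupp.single (p.1, (p.2 : FreeGroup X ⧸ N)) (1 : ℤ))) (by
      rintro x ⟨a, b, v, w, rfl⟩
      have h1 : ((v * r a * v⁻¹ : FreeGroup X) : FreeGroup X ⧸ N) = 1 :=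
        (QuotientGroup.eq_one_iff _).2 (‹N.Normal›.conj_mem _ (rel_mem hN a) v)
      have h2 : ((v * r a * v⁻¹ * w : FreeGroup X) : FreeGroup X ⧸ N) = w := by
        rw [QuotientGroup.mk_mul, h1, one_mul]
      simp only [map_mul, map_inv, FreeGroup.lift_apply_of, h2]
      rw [mul_inv_eq_one, mul_comm, inv_mul_cancel_left])

variable (hN : N = Subgroup.normalClosure (Set.range r))

lemma hC_of (a : A) (w : FreeGroup X) : hC hN (PresentedGroup.of (a, w)) =
    Multiplicative.ofAdd (Finsupp.single (a, (w : FreeGroup X ⧸ N)) 1) := by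
  simp [hC]

lemma hC_act (g : FreeGroup X) (c : RelPi2 r) : (hC hN (actOne r g c)).toAdd =
    freeRep A (g : FreeGroup X ⧸ N) (hC hN c).toAdd := by
  have : (hC hN).comp (actOne r g) =
      (AddMonoidHom.toMultiplicative (freeRep A (g : FreeGroup X ⧸ N)).toAddMonoidHom).comp
        (hC hN) := by
    apply PresentedGroup.ext; rintro ⟨a, w⟩
    rw [MonoidHom.comp_apply, MonoidHom.comp_apply, actOne_of, hC_of, hC_of]
    change _ = Multiplicative.ofAdd (freeRep A (g : FreeGroup X ⧸ N) (Finsupp.single _ 1))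
    rw [freeRep_single, QuotientGroup.mk_mul]
  exact congrArg Multiplicative.toAdd (DFunLike.congr_fun this c)

lemma d2_hC (c : RelPi2 r) : d2 r N (hC hN c).toAdd = fox N (bd r c) := by
  have hmul : ∀ c d : RelPi2 r, fox N (bd r (c * d)) = fox N (bd r c) + fox N (bd r d) := by
    intro c d
    rw [map_mul, fox_mul, (QuotientGroup.eq_one_iff _).2 (bd_mem_N hN c), map_one]; rfl
  induction c using PresentedGroup.induction_on with
  | _ x =>
    induction x using FreeGroup.induction_on with
    | C1 => simp [fox_one]
    | of p =>
      obtain ⟨a, v⟩ := p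
      change d2 r N (hC hN (PresentedGroup.of (a, v))).toAdd = fox N (bd r (PresentedGroup.of _))
      rw [hC_of, bd_of, fox_conj N v _ (rel_mem hN a)]
      exact d2_single r N a _
    | inv_of p hp =>
      have h := hmul ((PresentedGroup.mk (peifferRels r)) (FreeGroup.of p)) 
        ((PresentedGroup.mk (peifferRels r)) (FreeGroup.of p))⁻¹
      rw [mul_inv_cancel, map_one, fox_one] at h
      rw [map_inv, map_inv, toAdd_inv, map_neg, hp]
      exact neg_eq_of_add_eq_zero_right h.symm
    | mul x y hx hy =>
      rw [map_mul, map_mul, toAdd_mul, map_add, hx, hy, ← hmul, ← map_mul]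

lemma hC_surjective (z : C2 A N) : ∃ c, (hC hN c).toAdd = z := by
  have : AddSubgroup.toIntSubmodule (MonoidHom.toAdditiveLeft (hC hN)).range = ⊤ := by
    rw [eq_top_iff, ← Finsupp.iSup_lsingle_range (R := ℤ), iSup_le_iff]
    rintro ⟨a, g⟩
    rintro _ ⟨n, rfl⟩
    obtain ⟨w, rfl⟩ := QuotientGroup.mk_surjective g
    have h : Finsupp.lsingle (R := ℤ) (a, (w : FreeGroup X ⧸ N)) n =
        n • (Finsupp.single (a, (w : FreeGroup X ⧸ N)) (1 : ℤ)) := by simp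
    rw [h]
    apply Submodule.smul_mem
    exact ⟨Additive.ofMul (PresentedGroup.of (a, w)),
      congrArg Multiplicative.toAdd (hC_of hN a w)⟩
  have h : z ∈ AddSubgroup.toIntSubmodule (MonoidHom.toAdditiveLeft (hC hN)).range := by
    rw [this]; trivial
  obtain ⟨c, hc⟩ := h
  exact ⟨c.toMul, hc⟩

/-- The Hurewicz map `π₂(K) → C₂(K̃)`. -/
def hur : Pi2 r →ₗ[ℤ] C2 A N :=
  (MonoidHom.toAdditiveLeft ((hC hN).comp (bd r).ker.subtype)).toIntLinearMap

lemma hur_apply (x : Pi2 r) : hur hN x = (hC hN (x.toMul : RelPi2 r)).toAdd := rfl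

lemma hur_equivariant (g : FreeGroup X ⧸ N) (x : Pi2 r) :
    hur hN (pi2Rep r N hN g x) = freeRep A g (hur hN x) := by
  obtain ⟨w, rfl⟩ := QuotientGroup.mk_surjective g
  exact hC_act hN w _

/-- The class of `e_a^w` in the abelianization of `π₂(K, K¹)` depends only on `w` modulo `N`. -/
def cellClass (hN : N = Subgroup.normalClosure (Set.range r)) (p : A × (FreeGroup X ⧸ N)) :
    Additive (Abelianization (RelPi2 r)) :=
  Additive.ofMul (Quotient.liftOn' p.2
    (fun w => (Abelianization.of (PresentedGroup.of (p.1, w) : RelPi2 r))) (by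
      intro u w h
      have h1 : u⁻¹ * w ∈ N := QuotientGroup.leftRel_apply.1 h
      have h2 : w * u⁻¹ ∈ N := by
        have := ‹N.Normal›.conj_mem _ h1 u
        simpa [mul_assoc] using this
      rw [hN, ← range_bd] at h2
      obtain ⟨c, hc⟩ := h2
      have h3 : c * PresentedGroup.of (p.1, u) * c⁻¹ = (PresentedGroup.of (p.1, w) : RelPi2 r) := by
        rw [conj_eq_act, hc, actOne_of, inv_mul_cancel_right]
      change Abelianization.of _ = Abelianization.of _
      rw [← h3, map_mul, map_mul, mul_comm, map_inv, inv_mul_cancel_left]))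

lemma hC_ab (c : RelPi2 r) : Finsupp.linearCombination ℤ (cellClass hN) (hC hN c).toAdd =
    Additive.ofMul (Abelianization.of c) := by
  have : (AddMonoidHom.toMultiplicative
      (Finsupp.linearCombination ℤ (cellClass hN)).toAddMonoidHom).comp (hC hN) =
      (AddMonoidHom.toMultiplicative (AddMonoidHom.id _)).comp
        (MonoidHom.toAdditiveLeft.symm
          (MonoidHom.toAdditive (Abelianization.of (G := RelPi2 r)))) := by
    apply PresentedGroup.ext; rintro ⟨a, w⟩
    rw [MonoidHom.comp_apply, hC_of]
    change Multiplicative.ofAdd (Finsupp.linearCombination ℤ (cellClass hN) (Finsupp.single _ 1)) = _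
    rw [Finsupp.linearCombination_single, one_smul]
    rfl
  exact congrArg Multiplicative.toAdd (DFunLike.congr_fun this c)

/-- As `N` is free, the boundary `π₂(K, K¹) → N` has a section. -/
lemma exists_section (hN : N = Subgroup.normalClosure (Set.range r)) : ∃ t : N →* RelPi2 r, ∀ n, bd r (t n) = n := by
  have h : ∀ x : IsFreeGroup.Generators N, ∃ c : RelPi2 r, bd r c = (IsFreeGroup.of x : N) := by
    intro x
    have : ((IsFreeGroup.of x : N) : FreeGroup X) ∈ (bd r).range := by
      rw [range_bd, ← hN]; exact Subtype.prop _
    exact this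
  choose c hc using h
  refine ⟨IsFreeGroup.lift c, fun n => ?_⟩
  have : (bd r).comp (IsFreeGroup.lift c) = N.subtype := by
    apply IsFreeGroup.ext_hom
    intro x
    rw [MonoidHom.comp_apply, IsFreeGroup.lift_of, hc]; rfl
  exact DFunLike.congr_fun this n

lemma hur_injective : Function.Injective (hur hN) := by
  rw [← LinearMap.ker_eq_bot, LinearMap.ker_eq_bot']
  intro x hx
  obtain ⟨t, ht⟩ := exists_section hN
  let b : RelPi2 r →* N := (bd r).codRestrict N (bd_mem_N hN)
  let φ : RelPi2 r →* (bd r).ker := 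
    { toFun := fun c => ⟨c * (t (b c))⁻¹, by
        change bd r _ = 1
        rw [map_mul, map_inv, ht]; exact mul_inv_cancel _⟩
      map_one' := by ext; simp
      map_mul' := fun c d => by
        apply Subtype.ext
        change c * d * (t (b (c * d)))⁻¹ = c * (t (b c))⁻¹ * (d * (t (b d))⁻¹)
        have h := ker_bd_comm r (d * (t (b d))⁻¹) (t (b c))⁻¹ (by
          rw [map_mul, map_inv, ht]; exact mul_inv_cancel _)
        rw [mul_assoc c d, mul_assoc c (t (b c))⁻¹, ← h, map_mul, map_mul]; group }
  have h1 : Abelianization.of (x.toMul : RelPi2 r) = 1 := by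
    have := hC_ab hN (x.toMul : RelPi2 r)
    rw [← hur_apply, hx, map_zero] at this
    exact (congrArg Additive.toMul this).symm
  have h2 : φ (x.toMul : RelPi2 r) = 1 := by
    rw [← Abelianization.lift_apply_of φ, h1, map_one]
  have h3 : b (x.toMul : RelPi2 r) = 1 := Subtype.ext x.toMul.2
  have h4 : (x.toMul : RelPi2 r) * (t (b (x.toMul : RelPi2 r)))⁻¹ = 1 := congrArg Subtype.val h2
  rw [h3, map_one, inv_one, mul_one] at h4
  exact Pi2.ext h4

/-- If `n ∈ N` and `D(n) = 0` then `n ∈ [N, N]`. -/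
lemma mem_commutator_of_fox (n : N) (h : fox N (n : FreeGroup X) = 0) : Abelianization.of n = 1 := by
  let s : FreeGroup X ⧸ N → FreeGroup X := Quotient.out
  have hs : ∀ g, ((s g : FreeGroup X) : FreeGroup X ⧸ N) = g := fun g => QuotientGroup.out_eq' g
  let cls : FreeGroup X ⧸ N → FreeGroup X → N := fun g w =>
    ⟨s g * w * (s (g * (w : FreeGroup X ⧸ N)))⁻¹, by
      rw [← QuotientGroup.eq_one_iff, QuotientGroup.mk_mul, QuotientGroup.mk_mul,
        QuotientGroup.mk_inv, hs, hs, mul_inv_cancel]⟩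
  have cls_mul : ∀ g u w, cls g (u * w) = cls g u * cls (g * (u : FreeGroup X ⧸ N)) w := by
    intro g u w
    apply Subtype.ext
    simp only [cls, Subgroup.coe_mul, QuotientGroup.mk_mul, mul_assoc, inv_mul_cancel_left]
  have cls_one : ∀ g, cls g 1 = 1 := by
    intro g; apply Subtype.ext; simp [cls]
  let θ : C1 N →ₗ[ℤ] Additive (Abelianization N) := Finsupp.linearCombination ℤ
    fun p => Additive.ofMul (Abelianization.of (cls p.2 (FreeGroup.of p.1)))
  have hθ : ∀ (w : FreeGroup X) (g : FreeGroup X ⧸ N),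
      θ (freeRep X g (fox N w)) = Additive.ofMul (Abelianization.of (cls g w)) := by
    intro w
    induction w using FreeGroup.induction_on with
    | C1 => intro g; rw [fox_one, map_zero, map_zero, cls_one, map_one]; rfl
    | of x => intro g; rw [fox_of, freeRep_single, mul_one]; simp [θ]
    | inv_of x hx =>
      intro g
      rw [fox_inv, map_neg, ← Module.End.mul_apply, ← map_mul, map_neg, hx]
      have h := cls_mul g (FreeGroup.of x)⁻¹ (FreeGroup.of x)
      rw [inv_mul_cancel, cls_one] at h
      have h2 : cls g (FreeGroup.of x)⁻¹ =
          (cls (g * ((FreeGroup.of x : FreeGroup X) : FreeGroup X ⧸ N)⁻¹) (FreeGroup.of x))⁻¹ :=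
        eq_inv_of_mul_eq_one_left h.symm
      rw [h2, map_inv]; rfl
    | mul x y hx hy =>
      intro g
      rw [fox_mul, map_add, ← Module.End.mul_apply, ← map_mul, map_add, hx, hy, cls_mul, map_mul]
      rfl
  have h1 := hθ n 1
  rw [h, map_zero, map_zero] at h1
  have h2 : Abelianization.of (cls 1 n) = 1 := (congrArg Additive.toMul h1).symm
  have hs1 : s 1 ∈ N := by rw [← QuotientGroup.eq_one_iff, hs]
  have h3 : cls 1 n = ⟨s 1, hs1⟩ * n * (⟨s 1, hs1⟩)⁻¹ := by
    apply Subtype.ext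
    have : ((n : FreeGroup X) : FreeGroup X ⧸ N) = 1 := (QuotientGroup.eq_one_iff _).2 n.2
    simp only [cls, this, mul_one]; rfl
  rw [h3, map_mul, map_mul, mul_comm, map_inv, inv_mul_cancel_left] at h2
  exact h2

lemma hur_exact : Function.Exact (hur hN) (d2 r N) := by
  intro z
  constructor
  · intro hz
    obtain ⟨c, rfl⟩ := hC_surjective hN z
    rw [d2_hC] at hz
    let b : RelPi2 r →* N := (bd r).codRestrict N (bd_mem_N hN)
    have hb : Function.Surjective b := by
      rintro ⟨n, hn⟩
      have : n ∈ (bd r).range := by rw [range_bd, ← hN]; exact hn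
      obtain ⟨c, hc⟩ := this
      exact ⟨c, Subtype.ext hc⟩
    have h1 : b c ∈ commutator N := by
      rw [← Abelianization.ker_of]; exact mem_commutator_of_fox (b c) hz
    have h2 : (commutator (RelPi2 r)).map b = commutator N := by
      rw [commutator_def, commutator_def, Subgroup.map_commutator,
        ← MonoidHom.range_eq_map, MonoidHom.range_eq_top.2 hb]
    rw [← h2] at h1
    obtain ⟨c', hc', hbc⟩ := h1
    have h3 : hC hN c' = 1 := by
      rw [← Abelianization.lift_apply_of (hC hN)]
      rw [← Abelianization.ker_of] at hc'
      rw [show Abelianization.of c' = 1 from hc', map_one]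
    have h4 : bd r c' = bd r c := congrArg Subtype.val hbc
    refine ⟨Additive.ofMul ⟨c * c'⁻¹, ?_⟩, ?_⟩
    · change bd r _ = 1
      rw [map_mul, map_inv, h4, mul_inv_cancel]
    · change (hC hN (c * c'⁻¹)).toAdd = _
      rw [map_mul, map_inv, h3, inv_one, mul_one]
  · rintro ⟨x, rfl⟩
    rw [hur_apply, d2_hC, show bd r (x.toMul : RelPi2 r) = 1 from x.toMul.2, fox_one]

lemma d1_d2 (hN : N = Subgroup.normalClosure (Set.range r)) (z : C2 A N) : d1 N (d2 r N z) = 0 := by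
  obtain ⟨c, rfl⟩ := hC_surjective hN z
  rw [d2_hC, d1_fox, (QuotientGroup.eq_one_iff _).2 (bd_mem_N hN c), sub_self]

lemma eps_d1 (z : C1 N) : eps _ (d1 N z) = 0 := by
  have : (eps _).comp (d1 N) = 0 := by
    apply finsupp_hom_ext
    rintro ⟨x, g⟩
    rw [LinearMap.comp_apply, d1_single, map_sub, eps_single, eps_single, sub_self]; rfl
  exact DFunLike.congr_fun this z

lemma d1_exact0 (z : FreeGroup X ⧸ N →₀ ℤ) (hz : eps _ z = 0) : ∃ y, d1 N y = z := by
  let B := LinearMap.range (d1 N)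
  have : B.mkQ = (LinearMap.toSpanSingleton ℤ _ (B.mkQ (Finsupp.single 1 1))).comp (eps _) := by
    apply finsupp_hom_ext
    intro g
    obtain ⟨w, rfl⟩ := QuotientGroup.mk_surjective g
    rw [LinearMap.comp_apply, eps_single, LinearMap.toSpanSingleton_apply, one_smul, ← sub_eq_zero,
      ← map_sub]
    exact (Submodule.Quotient.mk_eq_zero _).2 ⟨fox N w, d1_fox N w⟩
  have h := DFunLike.congr_fun this z
  rw [LinearMap.comp_apply, hz, map_zero] at h
  exact (Submodule.Quotient.mk_eq_zero _).1 h

end Hurewicz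
section ChainSequences

open CategoryTheory

variable {X A : Type} (r : A → FreeGroup X) (N : Subgroup (FreeGroup X)) [N.Normal]
  (hN : N = Subgroup.normalClosure (Set.range r))

/-- The `G`-module of `1`-cycles `Z₁ = ker d₁`. -/
def z1Rep : Representation ℤ (FreeGroup X ⧸ N) (LinearMap.ker (d1 N)) :=
  kerRep (freeRep X) (regRep _) (d1 N) (d1_equivariant N)

/-- The augmentation ideal `Z₀ = ker ε` as a `G`-module. -/
def z0Rep : Representation ℤ (FreeGroup X ⧸ N) (LinearMap.ker (eps (FreeGroup X ⧸ N))) :=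
  kerRep (regRep _) (Representation.trivial ℤ _ ℤ) (eps _) eps_equivariant

/-- `d₁` as a map onto `Z₀`. -/
def d1' : C1 N →ₗ[ℤ] LinearMap.ker (eps (FreeGroup X ⧸ N)) :=
  (d1 N).codRestrict _ (eps_d1)

/-- `d₂` as a map onto `Z₁`. -/
def d2' : C2 A N →ₗ[ℤ] LinearMap.ker (d1 N) :=
  (d2 r N).codRestrict _ (d1_d2 hN)

lemma seq0_exact : Function.Exact (LinearMap.ker (eps (FreeGroup X ⧸ N))).subtype (eps _) :=
  LinearMap.exact_subtype_ker_map _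

lemma seq1_exact : Function.Exact (LinearMap.ker (d1 N)).subtype (d1' N) := fun z =>
  (Subtype.ext_iff (a1 := d1' N z) (a2 := 0)).trans (LinearMap.exact_subtype_ker_map (d1 N) z)

lemma seq2_exact : Function.Exact (hur hN) (d2' r N hN) := fun z =>
  (Subtype.ext_iff (a1 := d2' r N hN z) (a2 := 0)).trans (hur_exact hN z)

/-- The sequence `0 → Z₀ → ℤ[G] → ℤ → 0`. -/
def seq0 : ShortComplex (Rep ℤ (FreeGroup X ⧸ N)) :=
  exactComplex (z0Rep N) (regRep _) (Representation.trivial ℤ _ ℤ) (LinearMap.ker (eps _)).subtype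
    (eps _) (fun _ _ => rfl) eps_equivariant (seq0_exact N)

lemma seq0_shortExact : (seq0 N).ShortExact :=
  shortExact_of _ _ (Submodule.injective_subtype _) (seq0_exact N)
    (fun n => ⟨Finsupp.single 1 n, eps_single _ _⟩) _

/-- The sequence `0 → Z₁ → C₁(K̃) → Z₀ → 0`. -/
def seq1 : ShortComplex (Rep ℤ (FreeGroup X ⧸ N)) :=
  exactComplex (z1Rep N) (freeRep X) (z0Rep N) (LinearMap.ker (d1 N)).subtype (d1' N)
    (fun _ _ => rfl) (fun g v => Subtype.ext (d1_equivariant N g v)) (seq1_exact N)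

lemma seq1_shortExact : (seq1 N).ShortExact :=
  shortExact_of _ _ (Submodule.injective_subtype _) (seq1_exact N)
    (fun z => (d1_exact0 z.1 z.2).imp fun _ h => Subtype.ext h) _

/-- The sequence `0 → π₂(K) → C₂(K̃) → Z₁ → 0`. -/
def seq2 : ShortComplex (Rep ℤ (FreeGroup X ⧸ N)) :=
  exactComplex (pi2Rep r N hN) (freeRep A) (z1Rep N) (hur hN) (d2' r N hN)
    (hur_equivariant hN) (fun g v => Subtype.ext (d2_equivariant r N g v)) (seq2_exact r N hN)

lemma seq2_shortExact : (seq2 r N hN).ShortExact :=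
  shortExact_of _ _ (hur_injective hN) (seq2_exact r N hN)
    (fun z => (d2_exact1 hN z.1 z.2).imp fun _ h => Subtype.ext h) _

/-- The homomorphism `H₄(G) → H₁(G, π₂(K))`: the composite of the three connecting homomorphisms
obtained by dimension shifting along
`0 → π₂(K) → C₂(K̃) → C₁(K̃) → C₀(K̃) → ℤ → 0`. -/
def dimShift : groupHomology (Rep.of (Representation.trivial ℤ (FreeGroup X ⧸ N) ℤ)) 4 ⟶
    groupHomology (Rep.of (pi2Rep r N hN)) 1 :=
  groupHomology.δ (seq0_shortExact N) 4 3 rfl ≫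
    groupHomology.δ (seq1_shortExact N) 3 2 rfl ≫
      groupHomology.δ (seq2_shortExact r N hN) 2 1 rfl

/-- The connecting homomorphism `H₁(G, M) → H₀(G, SP²(M))` of `0 → SP²(M) → P₂(M) → M → 0`. -/
def p2Conn {G : Type} [Group G] {M : Type} [AddCommGroup M] (ρ : Representation ℤ G M) :
    groupHomology (Rep.of ρ) 1 ⟶ groupHomology (Rep.of (sp2Rep ρ)) 0 :=
  groupHomology.δ (p2Seq_shortExact ρ) 1 0 rfl

/-- The homomorphism `H₄(G) → H₀(G, Γ(π₂(K)))`, where `Γ(π₂(K)) = π₃(K)`. -/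
def toGamma : groupHomology (Rep.of (Representation.trivial ℤ (FreeGroup X ⧸ N) ℤ)) 4 ⟶
    groupHomology (Rep.of (gamRep (pi2Rep r N hN))) 0 :=
  dimShift r N hN ≫ p2Conn (pi2Rep r N hN) ≫
    (groupHomology.functor ℤ (FreeGroup X ⧸ N) 0).map (sp2ToGamHom (pi2Rep r N hN))

end ChainSequences
/-- A connected 2-dimensional CW complex `K = K₁ ∪ K₂ ∪ K₃` with a single `0`-cell and with
subcomplexes `Kᵢ` such that `K₁ ∩ K₂ ∩ K₃` is the `1`-skeleton `K¹`, given by its `1`-cells, its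
`2`-cells, the attaching elements `r` in the free group `π₁(K¹)`, and the sets `sub i` of the
`2`-cells of the `Kᵢ` (each of which contains `K¹`). -/
structure TripleComplex where
  /-- The set of `1`-cells, a free basis of `π₁(K¹)`. -/
  X : Type
  /-- The set of `2`-cells. -/
  Cell : Type
  /-- The class of the attaching map of a `2`-cell. -/
  r : Cell → FreeGroup X
  /-- The `2`-cells of the subcomplexes. -/
  sub : Fin 3 → Set Cell
  /-- `K = K₁ ∪ K₂ ∪ K₃`. -/
  cover : ∀ e, ∃ i, e ∈ sub i
  /-- `K₁ ∩ K₂ ∩ K₃ = K¹`. -/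
  inter : ∀ e, ∃ i, e ∉ sub i

section Main

open CategoryTheory

variable (K : TripleComplex)

/-- `F = π₁(K¹)`. -/
abbrev TripleComplex.F : Type := FreeGroup K.X

/-- `Rᵢ`, the kernel of `π₁(K¹) → π₁(Kᵢ)`: the normal closure of the attaching elements of the
`2`-cells of `Kᵢ`. -/
def TripleComplex.R (i : Fin 3) : Subgroup K.F := Subgroup.normalClosure (K.r '' K.sub i)

instance (i : Fin 3) : (K.R i).Normal := by unfold TripleComplex.R; infer_instance

/-- The normal subgroup `R₁R₂R₃`. -/
abbrev TripleComplex.N : Subgroup K.F := K.R 0 ⊔ K.R 1 ⊔ K.R 2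

/-- `G = F / R₁R₂R₃`, the fundamental group of `K`. -/
abbrev TripleComplex.G : Type := K.F ⧸ K.N

lemma TripleComplex.R_le (i : Fin 3) : K.R i ≤ K.N := by
  fin_cases i
  · exact le_sup_left.trans le_sup_left
  · exact le_sup_right.trans le_sup_left
  · exact le_sup_right

lemma TripleComplex.r_mem {e : K.Cell} {i : Fin 3} (h : e ∈ K.sub i) : K.r e ∈ K.R i :=
  Subgroup.subset_normalClosure ⟨e, h, rfl⟩

lemma TripleComplex.N_eq : K.N = Subgroup.normalClosure (Set.range K.r) := by
  apply le_antisymm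
  · have (i : Fin 3) : K.R i ≤ Subgroup.normalClosure (Set.range K.r) :=
      Subgroup.normalClosure_mono (Set.image_subset_range _ _)
    exact sup_le (sup_le (this 0) (this 1)) (this 2)
  · apply Subgroup.normalClosure_le_normal
    rintro _ ⟨e, rfl⟩
    obtain ⟨i, hi⟩ := K.cover e
    exact K.R_le i (K.r_mem hi)

/-- A choice, for every `2`-cell, of one of the subcomplexes `Kᵢ` that contain it: the partition
of the terms of an identity sequence into terms from `K₁`, from `K₂` and from `K₃`. -/
structure Labelling where
  /-- The index of the chosen subcomplex. -/
  lab : K.Cell → Fin 3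
  /-- The cell belongs to it. -/
  mem : ∀ e, e ∈ K.sub (lab e)

/-- `π₂(K)`. -/
abbrev TripleComplex.pi2 : Type := Pi2 K.r

/-- The `G`-module `π₂(K)`. -/
abbrev TripleComplex.pi2G : Representation ℤ K.G K.pi2 := pi2Rep K.r K.N K.N_eq

/-- The image in `π₂(K)` of `π₂(Kᵢ ∪ Kⱼ)`. -/
def TripleComplex.pi2Image (i j : Fin 3) : AddSubgroup K.pi2 :=
  (pi2Incl K.r (K.sub i ∪ K.sub j)).range

variable {K} (l : Labelling K)

lemma Labelling.r_mem (e : K.Cell) : K.r e ∈ K.R (l.lab e) := K.r_mem (l.mem e)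

/-- The map `Λ : π₂(K) → I₃(F; R₁, R₂, R₃)`, `Λ(c) = [r_c, s_c]`. -/
def Labelling.Lam : K.pi2 → I3 K.R := Lambda l.r_mem

/-- The homomorphism `Λ̄ : π₃(K) = Γ(π₂(K)) → I₃(F; R₁, R₂, R₃)` with `Λ̄ ∘ γ = Λ`. -/
def Labelling.LamBar : Gam K.pi2 →ₗ[ℤ] I3 K.R :=
  Gam.lift l.Lam (Lambda_neg l.r_mem) (crossL_add_left l.r_mem)

lemma Labelling.LamBar_gam (x : K.pi2) : l.LamBar (gam x) = l.Lam x := Gam.lift_gam _ _ _ _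

lemma Labelling.LamBar_equivariant (g : K.G) (x : Gam K.pi2) :
    l.LamBar (gamRep K.pi2G g x) = I3Rep K.R g (l.LamBar x) := by
  have : l.LamBar.comp (Gam.map (K.pi2G g)) = (I3Rep K.R g).comp l.LamBar := by
    apply Gam.hom_ext
    intro a
    obtain ⟨w, rfl⟩ := QuotientGroup.mk_surjective g
    rw [LinearMap.comp_apply, LinearMap.comp_apply, Gam.map_gam, LamBar_gam, LamBar_gam]
    exact Lambda_act l.r_mem w a
  exact DFunLike.congr_fun this x

/-- `Λ̄` as a morphism of `G`-modules. -/
def Labelling.LamBarHom : Rep.of (gamRep K.pi2G) ⟶ Rep.of (I3Rep K.R) :=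
  equivHom _ _ l.LamBar l.LamBar_equivariant

/-- `H₄(G)`, with trivial integral coefficients. -/
abbrev TripleComplex.H4 (K : TripleComplex) : ModuleCat ℤ := groupHomology (Rep.trivial ℤ K.G ℤ) 4

/-- `I₃(F; R₁, R₂, R₃)_F`, the coinvariants of the conjugation action of `F`, which factors
through `G`. -/
abbrev I3Coinv (K : TripleComplex) : ModuleCat ℤ := (Rep.coinvariantsFunctor ℤ K.G).obj
  (Rep.of (I3Rep K.R))

/-- The homomorphism `Ψ₄ : H₄(G) → I₃(F; R₁, R₂, R₃)_F`, the composite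
`H₄(G) → H₁(G, π₂(K)) → H₀(G, SP²(π₂(K))) → H₀(G, Γ(π₂(K))) → I₃(F; R₁, R₂, R₃)_F`. -/
def Labelling.Psi4 : K.H4 ⟶ I3Coinv K :=
  toGamma K.r K.N K.N_eq ≫ (groupHomology.functor ℤ K.G 0).map l.LamBarHom ≫
    (groupHomology.H0Iso (Rep.of (I3Rep K.R))).hom

variable (K)

/-- The projection `F / RᵢRⱼ → G`. -/
def TripleComplex.proj (i j : Fin 3) : K.F ⧸ (K.R i ⊔ K.R j) →* K.G :=
  QuotientGroup.map _ _ (MonoidHom.id _) (sup_le (K.R_le i) (K.R_le j))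

/-- `H₄(F / RᵢRⱼ)`, with trivial integral coefficients. -/
abbrev TripleComplex.H4pair (i j : Fin 3) : ModuleCat ℤ :=
  groupHomology (Rep.trivial ℤ (K.F ⧸ (K.R i ⊔ K.R j)) ℤ) 4

/-- The map `H₄(F / RᵢRⱼ) → H₄(G)` induced by the projection. -/
def TripleComplex.H4map (i j : Fin 3) : K.H4pair i j ⟶ K.H4 :=
  groupHomology.map (K.proj i j) (𝟙 (Rep.trivial ℤ (K.F ⧸ (K.R i ⊔ K.R j)) ℤ)) 4

/-- The natural map `H₄(F / R₁R₂) ⊕ H₄(F / R₂R₃) ⊕ H₄(F / R₁R₃) → H₄(G)`. -/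
def TripleComplex.H4sum : K.H4pair 0 1 ⊞ K.H4pair 1 2 ⊞ K.H4pair 0 2 ⟶ K.H4 :=
  Limits.biprod.desc (K.H4map 0 1) (Limits.biprod.desc (K.H4map 1 2) (K.H4map 0 2))

end Main
end TwoComplex

end

open CategoryTheory

/-! Work in the quotient of `F` by `commProd R`, where each `R i` commutes with the intersection of
the other two. There `Λ` of an identity sequence is the commutator of a pair `(p, q)`, with `p =
rho0` the product of the terms labelled `0` and `q = rho01` the product of the terms labelled `0` or
`1`. The pair satisfies `p ∈ R 0`, `p⁻¹ q ∈ R 1`, and `q ∈ R 2`, the last because the whole sequence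
has product `1`. For such pairs `comm_null` says that the commutator does not change when `(p, q)`
is multiplied by a null pair `(a u, b u)` with `a ∈ R 0 ∩ R 1`, `b ∈ R 1 ∩ R 2`, `u ∈ R 2 ∩ R 0`.

Two things turn out to be null. First, the effect of a change of labels: a cell with two admissible
labels has its values in both of the corresponding subgroups, and moving it from one label to the
other multiplies its pair by one of the basic null pairs. Null pairs are normalised by all pairs
that occur, so this passes to words (`rhoPair_relabel`), and `Λ` is independent of the labelling
(`Lambda_relabel`). Second, the pair of an identity sequence whose cells avoid some label: it has
the form `(1, q)`, `(p, p)` or `(p, 1)`, and the conditions above put the surviving entry in the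
right intersection (`rhoPair_preIncl_mem`). For an element coming from the union of two of the
subcomplexes the labels may be chosen so that the third one does not occur on it. Hence adding this
element does not change `Λ`, at any base point, and three such steps give the first claim.

For the second claim, all of `Ψ₄` before `Λ̄` is natural for the inclusion of a subcomplex
containing the 1-skeleton (`toGamma_naturality`): the Fox complexes, the Hurewicz map, the sequence
for `P₂`, and the map from `SP²` to `Γ` are all functorial, and connecting homomorphisms are
natural. So on the image of `H₄(F / RᵢRⱼ)` the map to `H₀(G, Γ(π₂(K)))` factors through `Γ` of `π₂`
of the union of the two subcomplexes. On that group `Λ̄` is zero, since by the first claim `Λ` takes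
the value `Λ(0) = 0` on the elements coming from the union (`LamBar_map_pi2Incl`). -/

namespace TwoComplex

open CategoryTheory

/-! ### Null pairs and the independence of `Λ` from the labels -/

section Relabel

variable {A F : Type} [Group F] {R : Fin 3 → Subgroup F} [hR : ∀ i, (R i).Normal] {r : A → F}
  {lab lab' : A → Fin 3}

/-- The pairs `(a u, b u)` with `a ∈ R₁ ∩ R₂`, `b ∈ R₂ ∩ R₃`, `u ∈ R₃ ∩ R₁`, modulo commutators. -/
def nullPairs (R : Fin 3 → Subgroup F) [hR : ∀ i, (R i).Normal] :
    Subgroup ((F ⧸ commProd R) × (F ⧸ commProd R)) where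
  carrier := {x | ∃ a ∈ barR R 0 ⊓ barR R 1, ∃ b ∈ barR R 1 ⊓ barR R 2, ∃ u ∈ barR R 2 ⊓ barR R 0,
    x.1 = a * u ∧ x.2 = b * u}
  one_mem' := ⟨1, one_mem _, 1, one_mem _, 1, one_mem _, by simp, by simp⟩
  mul_mem' := by
    rintro x y ⟨a, ha, b, hb, u, hu, e1, e2⟩ ⟨a', ha', b', hb', u', hu', e1', e2'⟩
    -- The witnesses come from `(a u)(a' u') = a (u a' u⁻¹) · (u u')`. Normality keeps the conjugate
    -- in its intersection, and both coordinates have the same last factor `u u'`.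
    refine ⟨a * (u * a' * u⁻¹), mul_mem ha (Subgroup.Normal.conj_mem inferInstance _ ha' u),
      b * (u * b' * u⁻¹), mul_mem hb (Subgroup.Normal.conj_mem inferInstance _ hb' u),
      u * u', mul_mem hu hu', ?_, ?_⟩
    · rw [Prod.fst_mul, e1, e1']; group
    · rw [Prod.snd_mul, e2, e2']; group
  inv_mem' := by
    rintro x ⟨a, ha, b, hb, u, hu, e1, e2⟩
    -- From `(a u)⁻¹ = (u⁻¹ a⁻¹ u) · u⁻¹`, and likewise with `b`.
    refine ⟨u⁻¹ * a⁻¹ * u⁻¹⁻¹, Subgroup.Normal.conj_mem inferInstance _ (inv_mem ha) u⁻¹,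
      u⁻¹ * b⁻¹ * u⁻¹⁻¹, Subgroup.Normal.conj_mem inferInstance _ (inv_mem hb) u⁻¹,
      u⁻¹, inv_mem hu, ?_, ?_⟩
    · rw [Prod.fst_inv, e1]; group
    · rw [Prod.snd_inv, e2]; group

/-- Null pairs are stable under conjugation by pairs that agree modulo `R₂`. -/
lemma nullPairs_conj {x g : (F ⧸ commProd R) × (F ⧸ commProd R)} (hx : x ∈ nullPairs R)
    (hg : g.1⁻¹ * g.2 ∈ barR R 1) : g * x * g⁻¹ ∈ nullPairs R := by
  obtain ⟨a, ha, b, hb, u, hu, e1, e2⟩ := hx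
  obtain ⟨g0, g1⟩ := g
  -- The common factor `u` must stay common after conjugation by the two different elements `g0` and
  -- `g1`. It does because `g0⁻¹ g1` is in `R 1` modulo commutators, and so commutes with `u ∈ R 2 ∩
  -- R 0`.
  have hc : g1 * u * g1⁻¹ = g0 * u * g0⁻¹ := by
    have := (comm1 R _ hg u hu).eq
    calc g1 * u * g1⁻¹ = g0 * ((g0⁻¹ * g1) * u) * g1⁻¹ := by group
      _ = g0 * u * g0⁻¹ := by rw [this]; group
  refine ⟨g0 * a * g0⁻¹, Subgroup.Normal.conj_mem inferInstance _ ha g0,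
    g1 * b * g1⁻¹, Subgroup.Normal.conj_mem inferInstance _ hb g1,
    g0 * u * g0⁻¹, Subgroup.Normal.conj_mem inferInstance _ hu g0, ?_, ?_⟩
  · change g0 * x.1 * g0⁻¹ = _
    rw [e1]; group
  · change g1 * x.2 * g1⁻¹ = _
    rw [e2, ← hc]; group

/-- The three basic kinds of null pair, one for each two-element set of labels: they are the changes
produced by exchanging the labels `0` and `1`, then `1` and `2`, then `2` and `0`. -/
lemma fst_mem_nullPairs {k : F} (h0 : k ∈ R 0) (h1 : k ∈ R 1) :
    ((k : F ⧸ commProd R), (1 : F ⧸ commProd R)) ∈ nullPairs R :=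
  ⟨k, ⟨mem_barR R h0, mem_barR R h1⟩, 1, one_mem _, 1, one_mem _, by simp, by simp⟩

lemma snd_mem_nullPairs {k : F} (h1 : k ∈ R 1) (h2 : k ∈ R 2) :
    ((1 : F ⧸ commProd R), (k : F ⧸ commProd R)) ∈ nullPairs R :=
  ⟨1, one_mem _, k, ⟨mem_barR R h1, mem_barR R h2⟩, 1, one_mem _, by simp, by simp⟩

lemma diag_mem_nullPairs {k : F} (h2 : k ∈ R 2) (h0 : k ∈ R 0) :
    ((k : F ⧸ commProd R), (k : F ⧸ commProd R)) ∈ nullPairs R :=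
  ⟨1, one_mem _, 1, one_mem _, k, ⟨mem_barR R h2, mem_barR R h0⟩, by simp, by simp⟩

/-- The pair of the products of the terms with label `1`, and with label `1` or `2`. -/
def rhoPair (R : Fin 3 → Subgroup F) [hR : ∀ i, (R i).Normal] (r : A → F) (lab : A → Fin 3) :
    FreeGroup (A × F) →* (F ⧸ commProd R) × (F ⧸ commProd R) :=
  ((QuotientGroup.mk' _).comp (rho0 r lab)).prod ((QuotientGroup.mk' _).comp (rho01 r lab))

lemma rhoPair_fst (x : FreeGroup (A × F)) :
    (rhoPair R r lab x).1 = (rho0 r lab x : F ⧸ commProd R) := rfl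

lemma rhoPair_snd (x : FreeGroup (A × F)) :
    (rhoPair R r lab x).2 = (rho01 r lab x : F ⧸ commProd R) := rfl

/-- This is exactly the hypothesis of `nullPairs_conj`: conjugation by the pair of any word,
identity sequence or not, preserves null pairs. -/
lemma rhoPair_mem (h : ∀ a, r a ∈ R (lab a)) (x : FreeGroup (A × F)) :
    (rhoPair R r lab x).1⁻¹ * (rhoPair R r lab x).2 ∈ barR R 1 :=
  mem_barR R (rho_mem1 h x)

/-- Changing the label of a term changes the pair by a null pair. -/
lemma rhoPair_of_relabel (h : ∀ a, r a ∈ R (lab a)) (h' : ∀ a, r a ∈ R (lab' a)) (p : A × F) :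
    (rhoPair R r lab (FreeGroup.of p))⁻¹ * rhoPair R r lab' (FreeGroup.of p) ∈ nullPairs R := by
  obtain ⟨a, w⟩ := p
  have h3 (i : Fin 3) : i = 0 ∨ i = 1 ∨ i = 2 := by fin_cases i <;> simp
  obtain ⟨k, hk⟩ : ∃ k, k = w * r a * w⁻¹ := ⟨_, rfl⟩
  have m : k ∈ R (lab a) := hk ▸ (hR _).conj_mem _ (h a) w
  have m' : k ∈ R (lab' a) := hk ▸ (hR _).conj_mem _ (h' a) w
  -- A single symbol with value `k` contributes `(k, k)`, `(1, k)` or `(1, 1)` according to whether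
  -- its label is `0`, `1` or `2`.
  have e (l : A → Fin 3) : rhoPair R r l (FreeGroup.of (a, w)) =
      (((if l a = 0 then k else 1 : F) : F ⧸ commProd R),
        ((if l a = 2 then 1 else k : F) : F ⧸ commProd R)) := by
    simp [rhoPair, rho0, rho01, hk]
  rw [e, e]
  -- In the off-diagonal cases the quotient of the two contributions has `k` or `k⁻¹` in the first,
  -- the second, or both coordinates. By `m` and `m'` the element `k` is in the subgroups of both
  -- labels, which is what the corresponding kind of null pair requires.
  rcases h3 (lab a) with hb | hb | hb <;> rcases h3 (lab' a) with ha | ha | ha <;>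
    rw [hb] at m <;> rw [ha] at m' <;>
    simp only [ha, hb, if_true, if_false, Fin.isValue, Fin.reduceEq, one_ne_zero,
      inv_mul_cancel, QuotientGroup.mk_one, Prod.inv_mk, Prod.mk_mul_mk, inv_one, one_mul,
      mul_one]
  · exact one_mem (nullPairs R)
  · simpa using inv_mem (fst_mem_nullPairs m m')
  · simpa using inv_mem (diag_mem_nullPairs m' m)
  · exact fst_mem_nullPairs m' m
  · exact one_mem (nullPairs R)
  · simpa using inv_mem (snd_mem_nullPairs m m')
  · exact diag_mem_nullPairs m m'
  · exact snd_mem_nullPairs m' m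
  · exact one_mem (nullPairs R)

/-- For two homomorphisms `f` and `f'`, the quotient `f⁻¹ f'` at `x y` is its value at `x`,
conjugated by `f y⁻¹`, times its value at `y`. Since null pairs are stable under these conjugations,
it is enough to know the quotient on the free generators. -/
lemma rhoPair_relabel (h : ∀ a, r a ∈ R (lab a)) (h' : ∀ a, r a ∈ R (lab' a))
    (x : FreeGroup (A × F)) :
    (rhoPair R r lab x)⁻¹ * rhoPair R r lab' x ∈ nullPairs R := by
  induction x using FreeGroup.induction_on with
  | C1 => simp [one_mem]
  | of p => exact rhoPair_of_relabel h h' p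
  | inv_of p hp =>
    -- For an inverse the quotient becomes `f f'⁻¹`, which is the conjugate by `f'` of the inverse
    -- of `f⁻¹ f'`; hence the conjugating pair belongs to the new labels.
    have e : (rhoPair R r lab (FreeGroup.of p)⁻¹)⁻¹ * rhoPair R r lab' (FreeGroup.of p)⁻¹ =
        rhoPair R r lab' (FreeGroup.of p) * ((rhoPair R r lab (FreeGroup.of p))⁻¹ *
          rhoPair R r lab' (FreeGroup.of p))⁻¹ * (rhoPair R r lab' (FreeGroup.of p))⁻¹ := by
      rw [map_inv, map_inv]; group
    rw [e]
    exact nullPairs_conj (inv_mem hp) (rhoPair_mem h' _)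
  | mul x y hx hy =>
    have e : (rhoPair R r lab (x * y))⁻¹ * rhoPair R r lab' (x * y) =
        rhoPair R r lab y⁻¹ * ((rhoPair R r lab x)⁻¹ * rhoPair R r lab' x) *
          (rhoPair R r lab y⁻¹)⁻¹ * ((rhoPair R r lab y)⁻¹ * rhoPair R r lab' y) := by
      rw [map_mul, map_mul, map_inv]; group
    rw [e]
    exact mul_mem (nullPairs_conj hx (rhoPair_mem h _)) hy

/-- `comm_null` in terms of pairs. Only `x` has to be an identity sequence, which places its second
coordinate in `R 2`; the null factor `n` need not come from any word. -/
lemma comm_rhoPair_mul_null (h : ∀ a, r a ∈ R (lab a)) {x : FreeGroup (A × F)}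
    (hx : preBd r x = 1) {n : (F ⧸ commProd R) × (F ⧸ commProd R)} (hn : n ∈ nullPairs R) :
    comm (rhoPair R r lab x * n).1 (rhoPair R r lab x * n).2 =
      comm (rhoPair R r lab x).1 (rhoPair R r lab x).2 := by
  obtain ⟨a, ha, b, hb, u, hu, e1, e2⟩ := hn
  rw [Prod.fst_mul, Prod.snd_mul, e1, e2]
  exact comm_null (comm0 R) (comm1 R) (comm2 R) (mem_barR R (rho0_mem h x))
    (mem_barR R (rho01_mem h hx)) (mem_barR R (rho_mem1 h x)) ha hb hu

/-- `Λ` does not depend on the labels. -/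
lemma Lambda_relabel (h : ∀ a, r a ∈ R (lab a)) (h' : ∀ a, r a ∈ R (lab' a)) (x : Pi2 r) :
    Lambda h' x = Lambda h x := by
  apply I3.ext
  obtain ⟨z, hz, bz⟩ := exists_rep x
  rw [I3Incl_Lambda h x hz, I3Incl_Lambda h' x hz]
  -- The same word `z` represents `x` for both labellings, and its new pair is the old pair times
  -- the null pair `(rhoPair R r lab z)⁻¹ * rhoPair R r lab' z`.
  have := comm_rhoPair_mul_null h bz (rhoPair_relabel h h' z)
  rwa [mul_inv_cancel_left] at this

/-- Elements represented by an identity sequence with a null pair are in the kernel of the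
quadratic map `Λ`. -/
lemma Lambda_add_of_null (h : ∀ a, r a ∈ R (lab a)) (x b : Pi2 r) {y : FreeGroup (A × F)}
    (hy : PresentedGroup.mk (peifferRels r) y = (b.toMul : RelPi2 r))
    (hn : rhoPair R r lab y ∈ nullPairs R) : Lambda h (x + b) = Lambda h x := by
  apply I3.ext
  obtain ⟨z, hz, bz⟩ := exists_rep x
  have hzy : PresentedGroup.mk (peifferRels r) (z * y) = ((x + b).toMul : RelPi2 r) := by
    rw [map_mul, hz, hy]; rfl
  rw [I3Incl_Lambda h x hz, I3Incl_Lambda h _ hzy, ← rhoPair_fst, ← rhoPair_snd, map_mul]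
  exact comm_rhoPair_mul_null h bz hn

/-- The inclusion of the free group on the symbols `e_a^w` with `a ∈ S`. -/
def preIncl (F : Type) (S : Set A) : FreeGroup (S × F) →* FreeGroup (A × F) :=
  FreeGroup.map fun p => ((p.1 : A), p.2)

lemma relIncl_mk (r : A → F) (S : Set A) (x : FreeGroup (S × F)) :
    relIncl r S (PresentedGroup.mk _ x) = PresentedGroup.mk _ (preIncl F S x) := by
  have : (relIncl r S).comp (PresentedGroup.mk _) =
      (PresentedGroup.mk _).comp (preIncl F S) := by
    ext p
    simp [relIncl, preIncl, PresentedGroup.toGroup]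
    rfl
  exact DFunLike.congr_fun this x

lemma preBd_preIncl (r : A → F) (S : Set A) (x : FreeGroup (S × F)) :
    preBd r (preIncl F S x) = preBd (fun a : S => r a) x := by
  have : (preBd r).comp (preIncl F S) = preBd (fun a : S => r a) := by
    ext p; simp [preBd, preIncl]
  exact DFunLike.congr_fun this x

/-- This and the next two lemmas describe how the pair degenerates when a label is absent: without
`0` the first coordinate is trivial, without `2` the second is the full boundary, and without `1`
the two coincide. -/
lemma rho0_preIncl_of_ne {S : Set A} (hS : ∀ a ∈ S, lab a ≠ 0) (x : FreeGroup (S × F)) :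
    rho0 r lab (preIncl F S x) = 1 := by
  have : (rho0 r lab).comp (preIncl F S) = 1 := by
    ext ⟨a, w⟩; simp [rho0, preIncl, hS a a.2]
  exact DFunLike.congr_fun this x

lemma rho01_preIncl_of_ne {S : Set A} (hS : ∀ a ∈ S, lab a ≠ 2) (x : FreeGroup (S × F)) :
    rho01 r lab (preIncl F S x) = preBd (fun a : S => r a) x := by
  have : (rho01 r lab).comp (preIncl F S) = preBd (fun a : S => r a) := by
    ext ⟨a, w⟩; simp [rho01, preIncl, preBd, hS a a.2]
  exact DFunLike.congr_fun this x

lemma rho0_preIncl_eq_rho01 {S : Set A} (hS : ∀ a ∈ S, lab a ≠ 1) (x : FreeGroup (S × F)) :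
    rho0 r lab (preIncl F S x) = rho01 r lab (preIncl F S x) := by
  have : (rho0 r lab).comp (preIncl F S) = (rho01 r lab).comp (preIncl F S) := by
    ext ⟨a, w⟩
    have h3 : lab a = 0 ∨ lab a = 1 ∨ lab a = 2 := by
      generalize lab a = i; fin_cases i <;> simp
    rcases h3 with h | h | h
    · simp [rho01, rho0, preIncl, h]
    · exact absurd h (hS a a.2)
    · simp [rho01, rho0, preIncl, h]
  exact DFunLike.congr_fun this x

/-- If the cells of `S` miss some label, then identity sequences in these cells give null pairs. -/
lemma rhoPair_preIncl_mem (h : ∀ a, r a ∈ R (lab a)) {S : Set A} {i : Fin 3}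
    (hS : ∀ a ∈ S, lab a ≠ i) {x : FreeGroup (S × F)} (hx : preBd (fun a : S => r a) x = 1) :
    rhoPair R r lab (preIncl F S x) ∈ nullPairs R := by
  have hx' : preBd r (preIncl F S x) = 1 := (preBd_preIncl r S x).trans hx
  have m0 := rho0_mem h (preIncl F S x)
  have m1 := rho_mem1 h (preIncl F S x)
  have m2 := rho01_mem h hx'
  have h3 : i = 0 ∨ i = 1 ∨ i = 2 := by fin_cases i <;> simp
  have e : rhoPair R r lab (preIncl F S x) = ((rho0 r lab (preIncl F S x) : F ⧸ commProd R),
    (rho01 r lab (preIncl F S x) : F ⧸ commProd R)) := rfl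
  rw [e]
  -- In each case one of the memberships `m0`, `m1`, `m2` holds for the surviving entry at once and
  -- another does after the degeneration. Without `0` the pair is `(1, q)` with `q ∈ R 1 ∩ R 2`.
  -- Without `1` it is `(p, p)` with `p ∈ R 2 ∩ R 0`. Without `2` the second entry is the boundary,
  -- which is `1`, and the pair is `(p, 1)` with `p ∈ R 0 ∩ R 1`.
  rcases h3 with rfl | rfl | rfl
  · have e0 := rho0_preIncl_of_ne (r := r) hS x
    rw [e0] at m1 ⊢
    exact snd_mem_nullPairs (by simpa using m1) m2
  · have e0 := rho0_preIncl_eq_rho01 (r := r) hS x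
    rw [e0] at m0 ⊢
    exact diag_mem_nullPairs m2 m0
  · have e0 := (rho01_preIncl_of_ne (r := r) hS x).trans hx
    rw [e0] at m1 ⊢
    exact fst_mem_nullPairs m0 (by simpa using m1)

/-- The image of `b` is represented by a word in the symbols of cells of `S` alone, and the absence
of the label `i` there makes its pair null. -/
lemma Lambda_add_pi2Incl (h : ∀ a, r a ∈ R (lab a)) {S : Set A} {i : Fin 3}
    (hS : ∀ a ∈ S, lab a ≠ i) (x : Pi2 r) (b : Pi2 (fun a : S => r a)) :
    Lambda h (x + pi2Incl r S b) = Lambda h x := by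
  obtain ⟨y, hy, by1⟩ := exists_rep b
  refine Lambda_add_of_null h x _ (y := preIncl F S y) ?_ (rhoPair_preIncl_mem h hS by1)
  rw [← relIncl_mk, hy]; rfl

end Relabel

/-! ### Invariance of `Λ` under translation by elements from two of the subcomplexes -/

section LamNull

variable {K : TripleComplex}

/-- Prefer `i`, then `j`, and keep the old label only for cells outside the union. On the union
every label other than `i` and `j` is then unused. -/
lemma Labelling.exists_relabel (l : Labelling K) (i j : Fin 3) :
    ∃ l' : Labelling K, ∀ e ∈ K.sub i ∪ K.sub j, l'.lab e = i ∨ l'.lab e = j := by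
  classical
  refine ⟨⟨fun e => if e ∈ K.sub i then i else if e ∈ K.sub j then j else l.lab e, fun e => ?_⟩,
    fun e he => ?_⟩
  · split_ifs with h1 h2
    exacts [h1, h2, l.mem e]
  · dsimp only
    split_ifs with h1 h2
    exacts [Or.inl rfl, Or.inr rfl, (he.elim h1 h2).elim]

lemma Labelling.Lam_relabel (l l' : Labelling K) : l'.Lam = l.Lam :=
  funext fun x => Lambda_relabel l.r_mem l'.r_mem x

/-- A cell of the union may carry the third label under the given `l`. As `Λ` is independent of
labels, it can be computed with a labelling adapted to `i` and `j`, for which the third label is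
missing. -/
lemma Labelling.Lam_add_pi2Incl (l : Labelling K) (i j : Fin 3) (a : K.pi2)
    (b : Pi2 (fun e : ↥(K.sub i ∪ K.sub j) => K.r e)) :
    l.Lam (a + pi2Incl K.r (K.sub i ∪ K.sub j) b) = l.Lam a := by
  -- With three indices some `k` differs from both `i` and `j`; this is the label avoided by `l'` on
  -- the union.
  have key : ∀ i j : Fin 3, ∃ k, i ≠ k ∧ j ≠ k := by decide
  obtain ⟨k, hki, hkj⟩ := key i j
  obtain ⟨l', hl'⟩ := l.exists_relabel i j
  rw [← l.Lam_relabel l']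
  refine Lambda_add_pi2Incl l'.r_mem (i := k) (fun e he => ?_) a b
  rcases hl' e he with h | h <;> rw [h] <;> assumption

lemma Labelling.Lam_add_of_mem (l : Labelling K) (i j : Fin 3) {b : K.pi2}
    (hb : b ∈ K.pi2Image i j) (a : K.pi2) : l.Lam (a + b) = l.Lam a := by
  obtain ⟨b, rfl⟩ := hb
  exact l.Lam_add_pi2Incl i j a b

lemma Labelling.Lam_zero (l : Labelling K) : l.Lam 0 = 0 := by
  rw [← l.LamBar_gam, gam_zero, map_zero]

end LamNull

noncomputable section

/-! ### Pasting of commutative squares -/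

section Squares

variable {C : Type*} [Category C]

lemma square_comp {A B D A' B' D' : C} {f : A ⟶ B} {g : B ⟶ D} {f' : A' ⟶ B'} {g' : B' ⟶ D'}
    {a : A ⟶ A'} {b : B ⟶ B'} {d : D ⟶ D'} (h₁ : f ≫ b = a ≫ f') (h₂ : g ≫ d = b ≫ g') :
    (f ≫ g) ≫ d = a ≫ f' ≫ g' := by
  rw [Category.assoc, h₂, ← Category.assoc, h₁, Category.assoc]

lemma square_comp_zero [Limits.HasZeroMorphisms C] {A B A' B' D E : C} {f : A ⟶ B}
    {f' : A' ⟶ B'} {a : A ⟶ A'} {b : B ⟶ B'} {g : B' ⟶ D} {k : D ⟶ E}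
    (h₁ : f ≫ b = a ≫ f') (h₂ : b ≫ g = 0) : a ≫ f' ≫ g ≫ k = 0 := by
  rw [← Category.assoc a, ← h₁, Category.assoc, ← Category.assoc b, h₂, Limits.zero_comp,
    Limits.comp_zero]

end Squares

/-! ### Naturality of connecting homomorphisms along a change of group -/

section Naturality

variable {G' G : Type} [Group G'] [Group G]

/-- A map that is equivariant along a group homomorphism, as a morphism to the restriction. -/
def semiHom (φ : G' →* G) {V W : Type} [AddCommGroup V] [AddCommGroup W]
    (ρ : Representation ℤ G' V) (σ : Representation ℤ G W) (f : V →ₗ[ℤ] W)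
    (h : ∀ g v, f (ρ g v) = σ (φ g) (f v)) : Rep.of ρ ⟶ Rep.res φ (Rep.of σ) :=
  Rep.ofHom (f.intertwiningMap_of_isIntertwiningMap ρ (σ.comp φ) h)

/-- Chains are functorial in the group and the coefficients together. Both composites are therefore
induced by `φ` and one coefficient map each, and these agree on elements by `h`. -/
lemma chainsMap_naturality {k : Type} [CommRing k] (φ : G' →* G) {A' B' : Rep k G'}
    {A B : Rep k G}
    (f' : A' ⟶ B') (f : A ⟶ B) (α : A' ⟶ Rep.res φ A) (β : B' ⟶ Rep.res φ B)
    (h : ∀ x, β.hom (f'.hom x) = f.hom (α.hom x)) :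
    groupHomology.chainsMap φ α ≫ groupHomology.chainsMap (MonoidHom.id G) f =
      groupHomology.chainsMap (MonoidHom.id G') f' ≫ groupHomology.chainsMap φ β := by
  rw [← groupHomology.chainsMap_comp, ← groupHomology.chainsMap_comp]
  exact groupHomology.chainsMap_congr rfl (LinearMap.ext fun x => (h x).symm)

/-- Naturality of the connecting homomorphism in the group and the short exact sequence. -/
lemma delta_naturality (φ : G' →* G) {S' : ShortComplex (Rep ℤ G')} {S : ShortComplex (Rep ℤ G)}
    (hS' : S'.ShortExact) (hS : S.ShortExact) (τ₁ : S'.X₁ ⟶ Rep.res φ S.X₁)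
    (τ₂ : S'.X₂ ⟶ Rep.res φ S.X₂) (τ₃ : S'.X₃ ⟶ Rep.res φ S.X₃)
    (h₁ : ∀ x, τ₂.hom (S'.f.hom x) = S.f.hom (τ₁.hom x))
    (h₂ : ∀ x, τ₃.hom (S'.g.hom x) = S.g.hom (τ₂.hom x)) (i j : ℕ) (hij : j + 1 = i) :
    groupHomology.δ hS' i j hij ≫ groupHomology.map φ τ₁ j =
      groupHomology.map φ τ₃ i ≫ groupHomology.δ hS i j hij :=
  -- The connecting homomorphisms are those of the short exact sequences of chain complexes obtained
  -- from `S'` and `S`; the three chain maps along `φ` form a morphism between these sequences.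
  HomologicalComplex.HomologySequence.δ_naturality
    (S₁ := S'.map (groupHomology.chainsFunctor ℤ G'))
    (S₂ := S.map (groupHomology.chainsFunctor ℤ G))
    { τ₁ := groupHomology.chainsMap φ τ₁
      τ₂ := groupHomology.chainsMap φ τ₂
      τ₃ := groupHomology.chainsMap φ τ₃
      comm₁₂ := chainsMap_naturality φ _ _ _ _ h₁
      comm₂₃ := chainsMap_naturality φ _ _ _ _ h₂ } _ _ i j hij

/-- Naturality of the connecting homomorphism for sequences given by linear maps. -/
lemma delta_exactComplex_naturality (φ : G' →* G)
    {V' W' U' V W U : Type} [AddCommGroup V'] [AddCommGroup W'] [AddCommGroup U']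
    [AddCommGroup V] [AddCommGroup W] [AddCommGroup U]
    {ρ' : Representation ℤ G' V'} {σ' : Representation ℤ G' W'} {τ' : Representation ℤ G' U'}
    {ρ : Representation ℤ G V} {σ : Representation ℤ G W} {τ : Representation ℤ G U}
    {f' : V' →ₗ[ℤ] W'} {g' : W' →ₗ[ℤ] U'} {f : V →ₗ[ℤ] W} {g : W →ₗ[ℤ] U}
    {hf' hg' he' hf hg he}
    (hS' : (exactComplex ρ' σ' τ' f' g' hf' hg' he').ShortExact)
    (hS : (exactComplex ρ σ τ f g hf hg he).ShortExact)
    (α : V' →ₗ[ℤ] V) (β : W' →ₗ[ℤ] W) (γ : U' →ₗ[ℤ] U)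
    (hα : ∀ g v, α (ρ' g v) = ρ (φ g) (α v)) (hβ : ∀ g v, β (σ' g v) = σ (φ g) (β v))
    (hγ : ∀ g v, γ (τ' g v) = τ (φ g) (γ v))
    (h₁ : ∀ x, β (f' x) = f (α x)) (h₂ : ∀ x, γ (g' x) = g (β x)) (i j : ℕ) (hij : j + 1 = i) :
    groupHomology.δ hS' i j hij ≫ groupHomology.map φ (semiHom φ ρ' ρ α hα) j =
      groupHomology.map φ (semiHom φ τ' τ γ hγ) i ≫ groupHomology.δ hS i j hij :=
  delta_naturality φ hS' hS (semiHom φ ρ' ρ α hα) (semiHom φ σ' σ β hβ) (semiHom φ τ' τ γ hγ)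
    h₁ h₂ i j hij

end Naturality

/-! ### Naturality of `SP²`, `P₂` and `Γ` -/

section QuadraticNaturality

variable {G' G : Type} [Group G'] [Group G] {M' M : Type} [AddCommGroup M'] [AddCommGroup M]
  (φ : G' →* G) {ρ' : Representation ℤ G' M'} {ρ : Representation ℤ G M} (f : M' →ₗ[ℤ] M)
  (h : ∀ g v, f (ρ' g v) = ρ (φ g) (f v))

include h

lemma SP2.map_semi (g : G') (x : SP2 M') :
    SP2.map f (sp2Rep ρ' g x) = sp2Rep ρ (φ g) (SP2.map f x) := by
  have : (SP2.map f).comp (SP2.map (ρ' g)) = (SP2.map (ρ (φ g))).comp (SP2.map f) := by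
    apply SP2.hom_ext; intro a b
    simp only [LinearMap.comp_apply, SP2.map_mk, h]
  exact DFunLike.congr_fun this x

lemma P2.map_semi (g : G') (x : P2 M') :
    P2.map f (p2Rep ρ' g x) = p2Rep ρ (φ g) (P2.map f x) := by
  have : (P2.map f).comp (P2.map (ρ' g)) = (P2.map (ρ (φ g))).comp (P2.map f) := by
    apply p2_hom_ext; intro a
    simp only [LinearMap.comp_apply, P2.map_p2, h]
  exact DFunLike.congr_fun this x

lemma Gam.map_semi (g : G') (x : Gam M') :
    Gam.map f (gamRep ρ' g x) = gamRep ρ (φ g) (Gam.map f x) := by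
  have : (Gam.map f).comp (Gam.map (ρ' g)) = (Gam.map (ρ (φ g))).comp (Gam.map f) := by
    apply Gam.hom_ext; intro a
    simp only [LinearMap.comp_apply, Gam.map_gam, h]
  exact DFunLike.congr_fun this x

omit h in
lemma P2.map_sp2ToP2 (x : SP2 M') : P2.map f (sp2ToP2 x) = sp2ToP2 (SP2.map f x) := by
  have : (P2.map f).comp sp2ToP2 = sp2ToP2.comp (SP2.map f) := by
    apply SP2.hom_ext; intro a b
    simp only [LinearMap.comp_apply, SP2.map_mk, sp2ToP2_mk, map_sub, P2.map_p2, map_add]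
  exact DFunLike.congr_fun this x

omit h in
lemma p2ToM_map (x : P2 M') : f (p2ToM x) = p2ToM (P2.map f x) := by
  have : f.comp p2ToM = p2ToM.comp (P2.map f) := by
    apply p2_hom_ext; intro a
    simp only [LinearMap.comp_apply, P2.map_p2, p2ToM_p2]
  exact DFunLike.congr_fun this x

omit h in
lemma Gam.map_sp2ToGam (x : SP2 M') : Gam.map f (sp2ToGam x) = sp2ToGam (SP2.map f x) := by
  have : (Gam.map f).comp sp2ToGam = sp2ToGam.comp (SP2.map f) := by
    apply SP2.hom_ext; intro a b
    simp only [LinearMap.comp_apply, SP2.map_mk, sp2ToGam_mk, map_sub, Gam.map_gam, map_add]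
  exact DFunLike.congr_fun this x

/-- The maps `SP2.map f`, `P2.map f` and `f` form a morphism, along `φ`, between the two short exact
sequences that define the connecting homomorphisms. -/
lemma p2Conn_naturality :
    p2Conn ρ' ≫ groupHomology.map φ (semiHom φ _ _ (SP2.map f) (SP2.map_semi φ f h)) 0 =
      groupHomology.map φ (semiHom φ ρ' ρ f h) 1 ≫ p2Conn ρ :=
  delta_exactComplex_naturality φ (p2Seq_shortExact ρ') (p2Seq_shortExact ρ) (SP2.map f)
    (P2.map f) f _ (P2.map_semi φ f h) h (P2.map_sp2ToP2 f) (p2ToM_map f) 1 0 rfl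

/-- No connecting homomorphism is involved, so the square already commutes on chains. The maps given
by `groupHomology.functor` are homology maps of chain maps along the identity, which is what the
`change` exposes. -/
lemma sp2ToGamHom_naturality :
    (groupHomology.functor ℤ G' 0).map (sp2ToGamHom ρ') ≫
        groupHomology.map φ (semiHom φ _ _ (Gam.map f) (Gam.map_semi φ f h)) 0 =
      groupHomology.map φ (semiHom φ _ _ (SP2.map f) (SP2.map_semi φ f h)) 0 ≫
        (groupHomology.functor ℤ G 0).map (sp2ToGamHom ρ) := by
  have := chainsMap_naturality φ (sp2ToGamHom ρ') (sp2ToGamHom ρ)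
    (semiHom φ _ _ (SP2.map f) (SP2.map_semi φ f h))
    (semiHom φ _ _ (Gam.map f) (Gam.map_semi φ f h)) (Gam.map_sp2ToGam f)
  change HomologicalComplex.homologyMap _ _ ≫ HomologicalComplex.homologyMap _ _ =
    HomologicalComplex.homologyMap _ _ ≫ HomologicalComplex.homologyMap _ _
  rw [← HomologicalComplex.homologyMap_comp, ← HomologicalComplex.homologyMap_comp, this]

end QuadraticNaturality

/-! ### The chain complexes of the universal covers of a subcomplex and of `K` -/

section ChainNaturality

variable {X A : Type} (r : A → FreeGroup X) (S : Set A)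
  {N' N : Subgroup (FreeGroup X)} [N'.Normal] [N.Normal]
  (hN' : N' = Subgroup.normalClosure (Set.range fun a : S => r a))
  (hN : N = Subgroup.normalClosure (Set.range r))
  (φ : FreeGroup X ⧸ N' →* FreeGroup X ⧸ N)
  (hφ : ∀ w : FreeGroup X, φ (w : FreeGroup X ⧸ N') = (w : FreeGroup X ⧸ N))

/-- The map of group rings induced by a group homomorphism. -/
def ringMap {G' G : Type} [Group G'] [Group G] (φ : G' →* G) : (G' →₀ ℤ) →ₗ[ℤ] (G →₀ ℤ) :=
  Finsupp.lmapDomain ℤ ℤ φ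

/-- The map of free modules induced by a map of bases and a group homomorphism. -/
def freeMap {G' G : Type} [Group G'] [Group G] (φ : G' →* G) {T' T : Type} (t : T' → T) :
    (T' × G' →₀ ℤ) →ₗ[ℤ] (T × G →₀ ℤ) :=
  Finsupp.lmapDomain ℤ ℤ fun p => (t p.1, φ p.2)

section Free

variable {G' G : Type} [Group G'] [Group G] (φ : G' →* G) {T' T : Type} (t : T' → T)

@[simp] lemma ringMap_single (g : G') (n : ℤ) :
    ringMap φ (Finsupp.single g n) = Finsupp.single (φ g) n := by
  simp [ringMap]

@[simp] lemma freeMap_single (s : T') (g : G') (n : ℤ) :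
    freeMap φ t (Finsupp.single (s, g) n) = Finsupp.single (t s, φ g) n := by
  simp [freeMap]

lemma ringMap_semi (g : G') (x : G' →₀ ℤ) :
    ringMap φ (regRep G' g x) = regRep G (φ g) (ringMap φ x) := by
  have : (ringMap φ).comp (regRep G' g) = (regRep G (φ g)).comp (ringMap φ) :=
    finsupp_hom_ext fun s => by simp
  exact DFunLike.congr_fun this x

lemma freeMap_semi (g : G') (x : T' × G' →₀ ℤ) :
    freeMap φ t (freeRep T' g x) = freeRep T (φ g) (freeMap φ t x) := by
  have : (freeMap φ t).comp (freeRep T' g) = (freeRep T (φ g)).comp (freeMap φ t) :=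
    finsupp_hom_ext fun s => by
      obtain ⟨s, h⟩ := s
      simp
  exact DFunLike.congr_fun this x

lemma eps_ringMap (x : G' →₀ ℤ) : eps G (ringMap φ x) = eps G' x := by
  have : (eps G).comp (ringMap φ) = eps G' := finsupp_hom_ext fun s => by simp [eps]
  exact DFunLike.congr_fun this x

end Free

include hφ

/-- Both sides are crossed homomorphisms on the free group, with `w` acting through its class modulo
`N`, and they agree on the basis. -/
lemma fox_naturality (w : FreeGroup X) : freeMap φ id (fox N' w) = fox N w := by
  induction w using FreeGroup.induction_on with
  | C1 => rw [fox_one, fox_one, map_zero]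
  | of x => rw [fox_of, fox_of, freeMap_single, map_one]; rfl
  | inv_of x hx => rw [fox_inv, fox_inv, map_neg, freeMap_semi, hx, map_inv, hφ]
  | mul x y hx hy => rw [fox_mul, fox_mul, map_add, freeMap_semi, hx, hy, hφ]

lemma d1_naturality (x : C1 N') : d1 N (freeMap φ id x) = ringMap φ (d1 N' x) := by
  have : (d1 N).comp (freeMap φ id) = (ringMap φ).comp (d1 N') :=
    finsupp_hom_ext fun s => by
      obtain ⟨s, g⟩ := s
      simp only [LinearMap.comp_apply, freeMap_single, d1_single, map_sub, ringMap_single, map_mul,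
        hφ, id]
  exact DFunLike.congr_fun this x

/-- The boundary of a cell is a translate of the Fox derivative of its attaching element, so this
reduces to `fox_naturality`. -/
lemma d2_naturality (x : C2 S N') :
    d2 r N (freeMap φ Subtype.val x) = freeMap φ id (d2 (fun a : S => r a) N' x) := by
  have : (d2 r N).comp (freeMap φ Subtype.val) =
      (freeMap φ id).comp (d2 (fun a : S => r a) N') :=
    finsupp_hom_ext fun s => by
      obtain ⟨s, g⟩ := s
      simp only [LinearMap.comp_apply, freeMap_single, d2_single, freeMap_semi]
      rw [fox_naturality φ hφ]
  exact DFunLike.congr_fun this x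

/-- The map of `0`-cycles. -/
def z0Map : LinearMap.ker (eps (FreeGroup X ⧸ N')) →ₗ[ℤ] LinearMap.ker (eps (FreeGroup X ⧸ N)) :=
  (ringMap φ).restrict fun x hx => (eps_ringMap φ x).trans hx

/-- The map of `1`-cycles. -/
def z1Map : LinearMap.ker (d1 N') →ₗ[ℤ] LinearMap.ker (d1 N) :=
  (freeMap φ id).restrict fun x (hx : d1 N' x = 0) =>
    (d1_naturality φ hφ x).trans (by rw [hx, map_zero])

/-- The comparison is made on the relative group, where it can be checked on the generators `e_a^w`,
and is then restricted to the kernel of the boundary. -/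
lemma hur_naturality (x : Pi2 (fun a : S => r a)) :
    freeMap φ Subtype.val (hur hN' x) = hur hN (pi2Incl r S x) := by
  have : (AddMonoidHom.toMultiplicative (freeMap φ (Subtype.val : S → A)).toAddMonoidHom).comp
      (hC hN') = (hC hN).comp (relIncl r S) := by
    apply PresentedGroup.ext; rintro ⟨a, w⟩
    have e : relIncl r S (PresentedGroup.of (a, w)) = PresentedGroup.of ((a : A), w) := by
      simp [relIncl]
    rw [MonoidHom.comp_apply, MonoidHom.comp_apply, e, hC_of, hC_of]
    change Multiplicative.ofAdd (freeMap φ Subtype.val (Finsupp.single _ 1)) = _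
    rw [freeMap_single, hφ]
  exact congrArg Multiplicative.toAdd (DFunLike.congr_fun this (x.toMul : RelPi2 _))

/-- The map `π₂(K¹ ∪ S) → π₂(K)` is equivariant along the map of fundamental groups. -/
lemma pi2Incl_semi (g : FreeGroup X ⧸ N') (x : Pi2 (fun a : S => r a)) :
    (pi2Incl r S).toIntLinearMap (pi2Rep _ N' hN' g x) =
      pi2Rep r N hN (φ g) ((pi2Incl r S).toIntLinearMap x) := by
  -- The Hurewicz map embeds `π₂(K)` equivariantly in the free module of 2-chains, where
  -- semilinearity is visible on the basis.
  apply hur_injective hN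
  rw [hur_equivariant]
  change hur hN (pi2Incl r S _) = freeRep A (φ g) (hur hN (pi2Incl r S x))
  rw [← hur_naturality r S hN' hN φ hφ, ← hur_naturality r S hN' hN φ hφ, hur_equivariant,
    freeMap_semi]

/-- The inclusion induces a map of the augmented complexes, hence of their cycles. It thus gives
morphisms between the three short exact sequences used for dimension shifting, and the three squares
of connecting homomorphisms are pasted. -/
lemma dimShift_naturality :
    dimShift _ N' hN' ≫ groupHomology.map φ
        (semiHom φ _ _ (pi2Incl r S).toIntLinearMap (pi2Incl_semi r S hN' hN φ hφ)) 1 =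
      groupHomology.map φ (semiHom φ (Representation.trivial ℤ (FreeGroup X ⧸ N') ℤ)
        (Representation.trivial ℤ (FreeGroup X ⧸ N) ℤ) LinearMap.id (fun _ _ => rfl)) 4 ≫
        dimShift r N hN := by
  have e0 := delta_exactComplex_naturality φ (seq0_shortExact N') (seq0_shortExact N)
    (z0Map φ) (ringMap φ) LinearMap.id
    (fun g v => Subtype.ext (ringMap_semi φ g v.1)) (ringMap_semi φ) (fun _ _ => rfl)
    (fun _ => rfl) (fun x => (eps_ringMap φ x).symm) 4 3 rfl
  have e1 := delta_exactComplex_naturality φ (seq1_shortExact N') (seq1_shortExact N)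
    (z1Map φ hφ) (freeMap φ id) (z0Map φ)
    (fun g v => Subtype.ext (freeMap_semi φ id g v.1)) (freeMap_semi φ id)
    (fun g v => Subtype.ext (ringMap_semi φ g v.1))
    (fun _ => rfl) (fun x => Subtype.ext (d1_naturality φ hφ x).symm) 3 2 rfl
  have e2 := delta_exactComplex_naturality φ (seq2_shortExact _ N' hN') (seq2_shortExact r N hN)
    (pi2Incl r S).toIntLinearMap (freeMap φ Subtype.val) (z1Map φ hφ)
    (pi2Incl_semi r S hN' hN φ hφ) (freeMap_semi φ Subtype.val)
    (fun g v => Subtype.ext (freeMap_semi φ id g v.1))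
    (hur_naturality r S hN' hN φ hφ)
    (fun x => Subtype.ext (d2_naturality r S φ hφ x).symm) 2 1 rfl
  exact square_comp e0 (square_comp e1 e2)

/-- Its use: on classes coming from the fundamental group of the subcomplex, `toGamma` factors
through `Γ` of the second homotopy group of the subcomplex. -/
lemma toGamma_naturality :
    toGamma _ N' hN' ≫ groupHomology.map φ (semiHom φ _ _
        (Gam.map (pi2Incl r S).toIntLinearMap)
        (Gam.map_semi φ _ (pi2Incl_semi r S hN' hN φ hφ))) 0 =
      groupHomology.map φ (semiHom φ (Representation.trivial ℤ (FreeGroup X ⧸ N') ℤ)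
        (Representation.trivial ℤ (FreeGroup X ⧸ N) ℤ) LinearMap.id (fun _ _ => rfl)) 4 ≫
        toGamma r N hN := by
  exact square_comp (dimShift_naturality r S hN' hN φ hφ)
    (square_comp (p2Conn_naturality φ _ (pi2Incl_semi r S hN' hN φ hφ))
      (sp2ToGamHom_naturality φ _ (pi2Incl_semi r S hN' hN φ hφ)))

end ChainNaturality

/-! ### Vanishing of `Ψ₄` on the classes from `F / RᵢRⱼ` -/

section Vanishing

variable {K : TripleComplex} (l : Labelling K)

/-- This identifies `F / RᵢRⱼ` with the fundamental group of the union of the two subcomplexes, so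
that the naturality results apply with `S` its set of 2-cells. -/
lemma TripleComplex.sup_eq_normalClosure (K : TripleComplex) (i j : Fin 3) :
    K.R i ⊔ K.R j =
      Subgroup.normalClosure (Set.range fun e : ↥(K.sub i ∪ K.sub j) => K.r e) := by
  apply le_antisymm
  · refine sup_le ?_ ?_ <;> apply Subgroup.normalClosure_mono <;> rintro _ ⟨e, he, rfl⟩
    · exact ⟨⟨e, Or.inl he⟩, rfl⟩
    · exact ⟨⟨e, Or.inr he⟩, rfl⟩
  · apply Subgroup.normalClosure_le_normal
    rintro _ ⟨⟨e, he⟩, rfl⟩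
    rcases he with he | he
    · exact le_sup_left (a := K.R i) (K.r_mem he)
    · exact le_sup_right (a := K.R i) (K.r_mem he)

lemma Labelling.LamBar_map_pi2Incl (i j : Fin 3)
    (x : Gam (Pi2 fun e : ↥(K.sub i ∪ K.sub j) => K.r e)) :
    l.LamBar (Gam.map (pi2Incl K.r (K.sub i ∪ K.sub j)).toIntLinearMap x) = 0 := by
  have : l.LamBar.comp (Gam.map (pi2Incl K.r (K.sub i ∪ K.sub j)).toIntLinearMap) = 0 := by
    apply Gam.hom_ext; intro a
    rw [LinearMap.comp_apply, Gam.map_gam, l.LamBar_gam]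
    -- Translation invariance at the base point `0` gives the vanishing of `Λ` itself, because `Λ(0)
    -- = 0`. It suffices to treat the elements `γ(a)`, since these generate `Γ`.
    have := l.Lam_add_pi2Incl i j 0 a
    rw [zero_add, l.Lam_zero] at this
    exact this
  exact DFunLike.congr_fun this x

/-- By `nat` the composite passes through `Γ` of `π₂` of the union, and `van` says that `Λ̄` kills
the image of that group in coinvariants. -/
lemma Labelling.H4map_comp_Psi4 (i j : Fin 3) : K.H4map i j ≫ l.Psi4 = 0 := by
  have nat := toGamma_naturality K.r (K.sub i ∪ K.sub j) (K.sup_eq_normalClosure i j) K.N_eq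
    (K.proj i j) (fun _ => rfl)
  have van : groupHomology.map (K.proj i j) (semiHom (K.proj i j) _ _
      (Gam.map (pi2Incl K.r (K.sub i ∪ K.sub j)).toIntLinearMap)
      (Gam.map_semi _ _ (pi2Incl_semi K.r _ (K.sup_eq_normalClosure i j) K.N_eq (K.proj i j)
        (fun _ => rfl)))) 0 ≫ (groupHomology.functor ℤ K.G 0).map l.LamBarHom = 0 := by
    change HomologicalComplex.homologyMap _ _ ≫ HomologicalComplex.homologyMap _ _ = 0
    rw [← HomologicalComplex.homologyMap_comp, ← groupHomology.chainsMap_comp]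
    -- The composite is induced by `K.proj i j` and the coefficient map `Λ̄ ∘ Γ(i_{ij})`. That map
    -- is zero, so the chain map vanishes before homology is taken.
    refine (congrArg (HomologicalComplex.homologyMap · 0) ?_).trans
      (HomologicalComplex.homologyMap_zero _ _ _)
    refine (groupHomology.chainsMap_congr rfl ?_).trans (groupHomology.chainsMap_zero (K.proj i j))
    exact LinearMap.ext (l.LamBar_map_pi2Incl i j)
  -- The remaining factor of `Ψ₄`, the isomorphism of `H₀` with the coinvariants, is the map `k` of
  -- `square_comp_zero`. The coefficient identity in `H4map` and the `semiHom` of the identity in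
  -- `nat` agree by definition.
  exact square_comp_zero nat van

end Vanishing

end

end TwoComplex

open CategoryTheory
theorem mainTheorem5 (K : TwoComplex.TripleComplex) (l : TwoComplex.Labelling K) :
    (∀ a b : K.pi2, b ∈ K.pi2Image 0 1 ⊔ K.pi2Image 0 2 ⊔ K.pi2Image 1 2 →
      l.Lam (a + b) = l.Lam a) ∧
    K.H4sum ≫ l.Psi4 = 0 := by
  refine ⟨fun a b hb => ?_, ?_⟩
  · obtain ⟨c, hc, d, hd, rfl⟩ := AddSubgroup.mem_sup.1 hb
    obtain ⟨e, he, f, hf, rfl⟩ := AddSubgroup.mem_sup.1 hc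
    -- Since `Λ` is only quadratic, the summands cannot be treated separately. Instead they are
    -- removed one after another from `((a + e) + f) + d`, using invariance at the base points `a +
    -- e + f`, `a + e` and `a`.
    rw [← add_assoc, ← add_assoc, l.Lam_add_of_mem 1 2 hd, l.Lam_add_of_mem 0 2 hf,
      l.Lam_add_of_mem 0 1 he]
  · unfold TwoComplex.TripleComplex.H4sum
    -- A map out of a biproduct vanishes if its restriction to each summand does; the iterated
    -- biproduct has three summands.
    refine Limits.biprod.hom_ext' _ _ ?_ (Limits.biprod.hom_ext' _ _ ?_ ?_) <;>
      simp only [Limits.biprod.inl_desc_assoc, Limits.biprod.inr_desc_assoc, Limits.comp_zero,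
        l.H4map_comp_Psi4]
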